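/- Let $\tau>1$. A (finite) $\tau$-HST is a finite rooted tree with positive edge lengths such that, along every root-to-leaf path, each edge is shorter than the preceding one by a factor of at least $\tau$. It induces a metric $d$ on the set $X$ of its leaves, namely path length. Let $n=|X|$ and $1\le k\le n$. In the $k$-server problem on $(X,d)$ a configuration is a set of $k$ points of $X$ (the server locations), requests $r_1,r_2,\dots\in X$ arrive one by one, and after each $r_t$ the configuration $A_t$ must be chosen with $r_t\in A_t$. The cost is the sum over $t$ of the earthmover distances between $A_{t-1}$ and $A_t$, i.e. the total distance travelled by the servers. A randomized online algorithm chooses $A_t$ at random, with a distribution depending only on $r_1,\dots,r_t$ and its own past configurations. Theorem. For every $\tau>1$ there is a constant $C=C(\tau)$ such that for every $\tau$-HST with $n$ leaves and every $1\le k\le n$ there is a $C\log n\,\log(k+1)$-competitive randomized online algorithm for the $k$-server problem on its leaf metric. That is, there is a number $c$, depending only on the tree, its edge lengths and $k$, such that for every initial configuration $A_0$ there is a randomized online algorithm starting in $A_0$ which, on every finite request sequence $r_1,\dots,r_T$, has $$\mathbb E[\mathrm{cost}]\ \le\ C\,\log n\,\log(k+1)\cdot \mathrm{cost}(B_0,B_1,\dots,B_T)+c$$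 for every offline solution, i.e. every sequence of configurations $B_0,\dots,B_T$ with $r_t\in B_t$ for $1\le t\le T$ (in particular for an optimal one). For $k\ge 2$ the ratio is $O_\tau(\log n\log k)$. -/

import Mathlib

noncomputable section

/-! ### The `k`-server problem on a finite set of points `X` with distances `d` -/

namespace KServer

/-- A configuration of the `k` servers: a set of exactly `k` points, one server at each. -/
abbrev Config (X : Type*) [Fintype X] (k : ℕ) : Type _ := {A : Finset X // A.card = k}

/-- The earthmover distance between two configurations: the least total distance travelled by the
servers in moving from `A` to `B`, over all ways of matching the points of `A` to those of `B`. -/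
def moveCost {X : Type*} [Fintype X] {k : ℕ} (d : X → X → ℝ) (A B : Config X k) : ℝ :=
  ⨅ f : A.1 ≃ B.1, ∑ a : A.1, d a (f a)

/-- `Serves σ Bs`: the list of configurations `Bs` serves the request sequence `σ`, that is, they
have the same length and the `t`-th request is a point of the `t`-th configuration. -/
def Serves {X : Type*} [Fintype X] {k : ℕ} (σ : List X) (Bs : List (Config X k)) : Prop :=
  List.Forall₂ (fun r B => r ∈ B.1) σ Bs

/-- The total movement cost of a list of configurations, starting from the configuration `A`. -/
def pathCost {X : Type*} [Fintype X] {k : ℕ} (d : X → X → ℝ) :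
    Config X k → List (Config X k) → ℝ
  | _, [] => 0
  | A, B :: Bs => moveCost d A B + pathCost d B Bs

/-- A randomized online algorithm for the `k`-server problem. It starts in the configuration
`init`. When a request `r` arrives, it draws its next configuration at random, from a distribution
that depends only on `r` and on the history `h` of past requests and past configurations (most
recent first), and this configuration has a server at `r`. -/
structure RandomizedAlgorithm (X : Type*) [Fintype X] (k : ℕ) where
  init : Config X k
  next : List (X × Config X k) → X → PMF (Config X k)
  serves : ∀ h r, ∀ B ∈ (next h r).support, r ∈ B.1

namespace RandomizedAlgorithm

variable {X : Type*} [Fintype X] {k : ℕ}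

/-- The current configuration after the history `h` (most recent first). -/
def current (alg : RandomizedAlgorithm X k) : List (X × Config X k) → Config X k
  | [] => alg.init
  | p :: _ => p.2

/-- The expected movement cost of the algorithm on the remaining requests, given the history. -/
def expectedCostFrom (alg : RandomizedAlgorithm X k) (d : X → X → ℝ) :
    List (X × Config X k) → List X → ℝ
  | _, [] => 0
  | h, r :: σ => ∑ B : Config X k, (alg.next h r B).toReal *
      (moveCost d (alg.current h) B + alg.expectedCostFrom d ((r, B) :: h) σ)

/-- The expected total movement cost of the algorithm on the request sequence `σ`. -/
def expectedCost (alg : RandomizedAlgorithm X k) (d : X → X → ℝ) (σ : List X) : ℝ :=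
  alg.expectedCostFrom d [] σ

/-- The algorithm is `ρ`-competitive with additive term `c`: on every request sequence its expected
cost is at most `ρ` times the cost of any offline solution (hence of an optimal one), plus `c`.
The offline solution knows all requests and may start anywhere. -/
def IsCompetitive (alg : RandomizedAlgorithm X k) (d : X → X → ℝ) (ρ c : ℝ) : Prop :=
  ∀ (σ : List X) (B₀ : Config X k) (Bs : List (Config X k)), Serves σ Bs →
    alg.expectedCost d σ ≤ ρ * pathCost d B₀ Bs + c

end RandomizedAlgorithm

end KServer

/-! ### Hierarchically separated trees

In Mathlib's `RootedTree` a node `u` is an ancestor of (or equal to) `v` iff `u ≤ v`, the root is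
`⊥` and the parent of `v` is `Order.pred v`. The number `w v` is the length of the edge from `v` to
its parent, for `v ≠ ⊥`. The value `w ⊥` plays no role. -/

namespace HST

/-- `(T, w)` is a `τ`-HST: edge lengths are positive, and along every path from the root to a leaf
each edge is shorter than the preceding one by a factor of at least `τ`. -/
structure IsHST (T : RootedTree) (w : T → ℝ) (τ : ℝ) : Prop where
  pos : ∀ v : T, v ≠ ⊥ → 0 < w v
  decreasing : ∀ v : T, v ≠ ⊥ → Order.pred v ≠ ⊥ → τ * w v ≤ w (Order.pred v)

/-- The leaves of the tree. -/
abbrev Leaf (T : RootedTree) : Type _ := {v : T // IsMax v}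

instance (T : RootedTree) [Fintype T] : Fintype (Leaf T) := Fintype.ofFinite _

open scoped Classical in
/-- The length of the tree path between two leaves: the sum of the lengths of the edges from `u`
to its parent over all nodes `u` whose subtree contains exactly one of the two leaves. -/
def leafDist (T : RootedTree) [Fintype T] (w : T → ℝ) (a b : Leaf T) : ℝ :=
  ∑ u : T, if Xor (u ≤ a.1) (u ≤ b.1) then w u else 0

end HST

end

noncomputable section
namespace KServer

/-! ### Linear inequalities and entropic projection -/

/-! A deterministic fractional solution is maintained online. It is rounded to a random placement of
servers, which the actual servers follow lazily.

The metric. Up to scaling and a factor depending only on τ, the leaf metric is `rho e`, that is 2 ^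
e - 1, for an integer ultrametric `e` (`HST.IsHST.exists_ultra`). Its own tree may be deep. It is
replaced by a cluster tree of height at most log₂ n (`IsUltra.tree`): every cluster has a core point
that forms a child of its own, and every other child contains at most half of the cluster. Moving
one server over a distance ρ changes the weighted server counts of the nodes by O(ρ)
(`IsUltra.sum_tree_abs_le`), and an edge weight bounds the distance between the cores at its ends
(`IsUltra.tree_rho_le`).

The fractional algorithm. A slot (v, j) carries the probability of at most j servers below v, and
linear inequalities relate the slots of the children to those of the parent. A request projects the
state, with respect to a weighted entropy, onto the states that serve it
(`exists_entropic_projection`). By the Lagrange conditions the movement is paid by the drop of a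
potential made of a divergence from the offline state and a depth-weighted linear term
(`WTree.exists_step`). All slots are at least δ = 1/(4k), so an offline move raises the potential by
at most a multiple of height * log (1/δ) times its length. These are the two logarithms of the
ratio.

The rounding. A fractional state yields a measure of mass k on the points. The random placement is
kept balanced: the number of servers in each ball is the measure of the ball, rounded up or down. It
can follow the measure at a cost proportional to the transportation cost (`exists_isStep`). The core
of this is `exists_exchange`, where servers are rerouted between placements, level by level, with
geometrically growing costs.

The online algorithm. A placement may put several servers on one point, so labelled servers at
distinct points follow it lazily (`lazyMove_cost`). Drawing each configuration from its conditional
law given the visible history turns this hidden chain into an online algorithm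
(`HiddenChain.exists_algorithm`). -/

/-- Farkas' lemma for finitely many linear functionals. -/
theorem farkas {V : Type*} [AddCommGroup V] [Module ℝ V] {κ : Type*} (s : Finset κ) :
    ∀ (a : κ → V →ₗ[ℝ] ℝ) (g : V →ₗ[ℝ] ℝ),
      (∀ x, (∀ i ∈ s, 0 ≤ a i x) → 0 ≤ g x) →
      ∃ c : κ → ℝ, (∀ i, 0 ≤ c i) ∧ (∀ i, c i ≠ 0 → i ∈ s) ∧ g = ∑ i ∈ s, c i • a i := by
  classical
  induction s using Finset.induction_on with
  | empty =>
    intro a g h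
    refine ⟨0, by simp, by simp, ?_⟩
    ext x
    have h1 := h x (by simp)
    have h2 := h (-x) (by simp)
    simp only [map_neg] at h2
    simp only [Finset.sum_empty, LinearMap.zero_apply]
    linarith
  | insert j s hj ih =>
    intro a g h
    by_cases hs : ∀ x, (∀ i ∈ s, 0 ≤ a i x) → 0 ≤ g x
    · obtain ⟨c, hc, hcs, hg⟩ := ih a g hs
      have hcj : c j = 0 := by
        by_contra hne
        exact hj (hcs j hne)
      refine ⟨c, hc, fun i hi => Finset.mem_insert_of_mem (hcs i hi), ?_⟩
      rw [Finset.sum_insert hj, hcj, zero_smul, zero_add, hg]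
    · push Not at hs
      obtain ⟨x₁, hx₁, hgx₁⟩ := hs
      have hjx₁ : a j x₁ < 0 := by
        by_contra hcon
        push Not at hcon
        have := h x₁ (by
          intro i hi
          rcases Finset.mem_insert.1 hi with rfl | hi
          · exact hcon
          · exact hx₁ i hi)
        linarith
      -- With `a j x₀ = -1` the map `x ↦ x + (a j x) • x₀` is a projection onto the kernel of `a j`.
      -- Composed with it, the functionals satisfy the hypothesis without the constraint `j`.
      set x₀ := (-(a j x₁))⁻¹ • x₁ with hx₀
      have hpos : 0 < (-(a j x₁))⁻¹ := by
        apply inv_pos.2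
        linarith
      have hj₀ : a j x₀ = -1 := by
        rw [hx₀, map_smul, smul_eq_mul, inv_neg, neg_mul, inv_mul_cancel₀ hjx₁.ne]
      have hi₀ : ∀ i ∈ s, 0 ≤ a i x₀ := by
        intro i hi
        rw [hx₀, map_smul, smul_eq_mul]
        exact mul_nonneg hpos.le (hx₁ i hi)
      have hg₀ : g x₀ < 0 := by
        rw [hx₀, map_smul, smul_eq_mul]
        exact mul_neg_of_pos_of_neg hpos hgx₁
      obtain ⟨c, hc, hcs, hg⟩ := ih (fun i => a i + (a i x₀) • a j) (g + (g x₀) • a j) (by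
        intro x hx
        have := h (x + (a j x) • x₀) (by
          intro i hi
          rcases Finset.mem_insert.1 hi with rfl | hi
          · simp [hj₀]
          · have := hx i hi
            simp only [LinearMap.add_apply, LinearMap.smul_apply, smul_eq_mul, map_add,
              map_smul] at this ⊢
            linarith)
        simp only [LinearMap.add_apply, LinearMap.smul_apply, smul_eq_mul, map_add,
          map_smul] at this ⊢
        linarith)
      refine ⟨fun i => if i = j then -(g x₀) + ∑ i ∈ s, c i * a i x₀ else c i, ?_, ?_, ?_⟩
      · intro i
        dsimp only
        split_ifs with hij
        · have : 0 ≤ ∑ i ∈ s, c i * a i x₀ :=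
            Finset.sum_nonneg fun i hi => mul_nonneg (hc i) (hi₀ i hi)
          linarith
        · exact hc i
      · intro i hi
        dsimp only at hi
        split_ifs at hi with hij
        · simp [hij]
        · exact Finset.mem_insert_of_mem (hcs i hi)
      · have hs' : ∑ i ∈ s, (if i = j then -(g x₀) + ∑ i ∈ s, c i * a i x₀ else c i) • a i
            = ∑ i ∈ s, c i • a i := by
          refine Finset.sum_congr rfl fun i hi => ?_
          rw [if_neg]
          rintro rfl
          exact hj hi
        rw [Finset.sum_insert hj, hs']
        simp only [if_true]
        ext x
        have hx := congrArg (fun f => f x) hg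
        simp only [LinearMap.add_apply, LinearMap.smul_apply, smul_eq_mul, LinearMap.sum_apply,
          mul_add, Finset.sum_add_distrib] at hx ⊢
        have : ∑ i ∈ s, c i * (a i x₀ * a j x) = (∑ i ∈ s, c i * a i x₀) * a j x := by
          rw [Finset.sum_mul]
          exact Finset.sum_congr rfl fun i _ => by ring
        rw [this] at hx
        linear_combination hx

/-- This is the tangent line of t log (t / z) - t at t = e² z, where the slope is 2. The positive
slope makes the entropy coercive. -/
theorem two_mul_sub_le_entropy {t z : ℝ} (ht : 0 ≤ t) (hz : 0 < z) :
    2 * t - Real.exp 2 * z ≤ t * Real.log (t / z) - t := by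
  rcases ht.eq_or_lt with rfl | ht
  · simp only [mul_zero, zero_mul]
    have := mul_pos (Real.exp_pos 2) hz
    linarith
  have h := Real.one_sub_inv_le_log_of_pos (x := t / z / Real.exp 2) (by positivity)
  rw [Real.log_div (by positivity) (by positivity), Real.log_exp] at h
  have h2 := mul_le_mul_of_nonneg_left h ht.le
  have h3 : t * (1 - (t / z / Real.exp 2)⁻¹) = t - Real.exp 2 * z := by
    field_simp
  rw [h3] at h2
  linarith

theorem hasDerivAt_entropy {t z d : ℝ} (ht : 0 < t) (hz : 0 < z) :
    HasDerivAt (fun ε : ℝ => (t + ε * d) * Real.log ((t + ε * d) / z) - (t + ε * d))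
      (d * Real.log (t / z)) 0 := by
  have h1 : HasDerivAt (fun ε : ℝ => t + ε * d) d 0 := by
    simpa using ((hasDerivAt_id (0 : ℝ)).mul_const d).const_add t
  have h2 : HasDerivAt (fun ε : ℝ => (t + ε * d) / z) (d / z) 0 := h1.div_const z
  have h3 := h2.log (by simp; exact ⟨ht.ne', hz.ne'⟩)
  have h4 := (h1.mul h3).sub h1
  have hval : d * Real.log (t / z) = d * Real.log ((t + 0 * d) / z) +
      (t + 0 * d) * (d / z / ((t + 0 * d) / z)) - d := by
    have := ht.ne'
    have := hz.ne'
    simp only [zero_mul, add_zero]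
    field_simp
    ring
  rw [hval]
  exact h4

/-- The entropic projection of a positive vector to a polyhedron of positive vectors, with its
Lagrange multipliers. -/
theorem exists_entropic_projection {ι κ : Type*} [Fintype ι] [Fintype κ] (A : κ → ι → ℝ)
    (b : κ → ℝ) (w z : ι → ℝ) (hw : ∀ i, 0 < w i) (hz : ∀ i, 0 < z i)
    (hpos : ∀ y : ι → ℝ, (∀ κ, b κ ≤ ∑ i, A κ i * y i) → ∀ i, 0 < y i)
    (hne : ∃ y : ι → ℝ, ∀ κ, b κ ≤ ∑ i, A κ i * y i) :
    ∃ (z' : ι → ℝ) (c : κ → ℝ), (∀ κ, b κ ≤ ∑ i, A κ i * z' i) ∧ (∀ κ, 0 ≤ c κ) ∧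
      (∀ κ, c κ ≠ 0 → ∑ i, A κ i * z' i = b κ) ∧
      ∀ y : ι → ℝ, ∑ i, y i * (w i * Real.log (z' i / z i)) = ∑ κ, c κ * ∑ i, A κ i * y i := by
  classical
  obtain ⟨y₀, hy₀⟩ := hne
  set f : (ι → ℝ) → ℝ := fun y => ∑ i, w i * (y i * Real.log (y i / z i) - y i) with hf
  -- If `y i` exceeds `R i` then `2 * w i * y i > E`, and the tangent bound gives `f y > f y₀`. A
  -- minimum over the box `[0, R]` is therefore a minimum over all of `F`.
  set E : ℝ := f y₀ + ∑ i, w i * (Real.exp 2 * z i) with hE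
  set R : ι → ℝ := fun i => max (y₀ i) (E / (2 * w i) + Real.exp 2 * z i) with hR
  set F : Set (ι → ℝ) := {y | ∀ κ, b κ ≤ ∑ i, A κ i * y i} with hF
  have hFc : IsClosed F := by
    rw [hF, Set.ofPred_forall]
    refine isClosed_iInter fun κ => isClosed_le continuous_const ?_
    fun_prop
  have hcomp : IsCompact (Set.Icc 0 R ∩ F) := isCompact_Icc.inter_right hFc
  have hcont : Continuous f := by
    rw [hf]
    refine continuous_finsetSum _ fun i _ => continuous_const.mul (Continuous.sub ?_ (by fun_prop))
    -- The box contains vectors with zero coordinates, and x log x is continuous there as well.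
    have : (fun y : ι → ℝ => y i * Real.log (y i / z i)) =
        fun y => z i * ((y i / z i) * Real.log (y i / z i)) := by
      ext y
      have := (hz i).ne'
      field_simp
    rw [this]
    exact continuous_const.mul (Real.continuous_mul_log.comp (by fun_prop))
  have hy₀m : y₀ ∈ Set.Icc 0 R ∩ F :=
    ⟨⟨fun i => (hpos y₀ hy₀ i).le, fun i => le_max_left _ _⟩, hy₀⟩
  obtain ⟨z', hz'm, hz'min⟩ := hcomp.exists_isMinOn ⟨y₀, hy₀m⟩ hcont.continuousOn
  have hz'pos := hpos z' hz'm.2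
  have hmin : ∀ y ∈ F, f z' ≤ f y := by
    intro y hy
    by_cases hyR : y ≤ R
    · exact hz'min ⟨⟨fun i => (hpos y hy i).le, hyR⟩, hy⟩
    · rw [Pi.le_def] at hyR
      push Not at hyR
      obtain ⟨i, hi⟩ := hyR
      have h1 : f z' ≤ f y₀ := hz'min hy₀m
      have hterm : ∀ j, w j * (2 * y j - Real.exp 2 * z j) ≤
          w j * (y j * Real.log (y j / z j) - y j) := fun j =>
        mul_le_mul_of_nonneg_left (two_mul_sub_le_entropy (hpos y hy j).le (hz j)) (hw j).le
      have h2 : ∑ j, w j * (2 * y j - Real.exp 2 * z j) ≤ f y :=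
        Finset.sum_le_sum fun j _ => hterm j
      have h3 : w i * (2 * y i) ≤ ∑ j, w j * (2 * y j) :=
        Finset.single_le_sum (f := fun j => w j * (2 * y j))
          (fun j _ => mul_nonneg (hw j).le (by linarith [hpos y hy j])) (Finset.mem_univ i)
      have h4 : E / (2 * w i) < y i := by
        have := lt_of_le_of_lt (le_max_right _ _) hi
        have h5 := mul_pos (Real.exp_pos 2) (hz i)
        linarith
      rw [div_lt_iff₀ (by linarith [hw i])] at h4
      have h5 : ∑ j, w j * (2 * y j - Real.exp 2 * z j) =
          ∑ j, w j * (2 * y j) - ∑ j, w j * (Real.exp 2 * z j) := by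
        rw [← Finset.sum_sub_distrib]
        exact Finset.sum_congr rfl fun j _ => by ring
      linarith
  -- Only the constraints that are tight at `z'` restrict small displacements. In every direction
  -- they allow, the one-sided derivative of `f` is nonnegative, so Farkas' lemma writes the
  -- gradient as a nonnegative combination of tight constraints.
  set tight : Finset κ := Finset.univ.filter fun κ => ∑ i, A κ i * z' i = b κ with htight
  let lin : (ι → ℝ) → ((ι → ℝ) →ₗ[ℝ] ℝ) := fun v => ∑ i, v i • LinearMap.proj i
  have hlin : ∀ v y, lin v y = ∑ i, v i * y i := by
    intro v y
    simp [lin]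
  obtain ⟨c, hc, hcs, hg⟩ := farkas tight (fun κ => lin (A κ))
    (lin fun i => w i * Real.log (z' i / z i)) (by
    intro d hd
    simp only [hlin] at hd ⊢
    have hfeas : ∀ᶠ ε : ℝ in nhdsWithin 0 (Set.Ioi 0), (fun i => z' i + ε * d i) ∈ F := by
      rw [hF]
      simp only [Set.mem_ofPred_eq, Filter.eventually_all]
      intro κ
      have hexp : ∀ ε : ℝ, ∑ i, A κ i * (z' i + ε * d i) =
          ∑ i, A κ i * z' i + ε * ∑ i, A κ i * d i := by
        intro ε
        rw [Finset.mul_sum, ← Finset.sum_add_distrib]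
        exact Finset.sum_congr rfl fun i _ => by ring
      simp only [hexp]
      rcases (hz'm.2 κ).eq_or_lt with heq | hlt
      · filter_upwards [self_mem_nhdsWithin] with ε hε
        have := hd κ (by simp [htight, heq])
        have := mul_nonneg (le_of_lt (Set.mem_Ioi.1 hε)) this
        linarith
      · have hc : Continuous fun ε : ℝ => ∑ i, A κ i * z' i + ε * ∑ i, A κ i * d i := by fun_prop
        have := hc.tendsto 0
        simp only [zero_mul, add_zero] at this
        have := this.eventually (lt_mem_nhds hlt)
        exact (this.filter_mono nhdsWithin_le_nhds).mono fun ε h => h.le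
    have hder : HasDerivAt (fun ε : ℝ => f fun i => z' i + ε * d i)
        (∑ i, w i * (d i * Real.log (z' i / z i))) 0 := by
      rw [hf]
      exact HasDerivAt.fun_sum fun i _ =>
        (hasDerivAt_entropy (hz'pos i) (hz i)).const_mul (w i)
    have hslope := (hasDerivAt_iff_tendsto_slope.1 hder).mono_left
      (nhdsWithin_mono (0 : ℝ) (s := Set.Ioi 0) (fun x hx => (ne_of_gt hx : x ≠ 0)))
    have := ge_of_tendsto hslope (b := 0) (by
      filter_upwards [hfeas, self_mem_nhdsWithin] with ε hε hε0
      rw [slope_def_field]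
      apply div_nonneg _ (by rw [sub_zero]; exact le_of_lt hε0)
      simpa using hmin _ hε)
    calc (0 : ℝ) ≤ _ := this
      _ = _ := Finset.sum_congr rfl fun i _ => by ring)
  refine ⟨z', c, hz'm.2, hc, fun κ hκ => (Finset.mem_filter.1 (hcs κ hκ)).2, fun y => ?_⟩
  have := congrArg (fun φ => φ y) hg
  simp only [hlin, LinearMap.sum_apply, LinearMap.smul_apply, smul_eq_mul] at this
  rw [← Finset.sum_subset (Finset.subset_univ tight)
    (f := fun κ => c κ * ∑ i, A κ i * y i), ← this]
  · exact Finset.sum_congr rfl fun i _ => by ring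
  · intro κ _ hκ
    have : c κ = 0 := by
      by_contra h
      exact hκ (hcs κ h)
    rw [this, zero_mul]

end KServer
end

noncomputable section
namespace KServer

/-! ### The fractional problem on a weighted tree -/

open scoped Classical in
/-- A finite weighted tree whose leaves are the points of `X`; `cl v` is the set of leaves below
the node `v`, `w v` is the length of the edge from `v` to its parent, and `pos v` is the point of
`X` where a server at `v` is stationed. -/
structure WTree (X : Type*) [Fintype X] where
  V : Type*
  [fintypeV : Fintype V]
  root : V
  par : V → V
  depth : V → ℕ
  height : ℕ
  cl : V → Finset X
  w : V → ℝ
  leaf : X → V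
  depth_root : depth root = 0
  depth_par : ∀ v, v ≠ root → depth v = depth (par v) + 1
  depth_le : ∀ v, depth v ≤ height
  cl_root : cl root = Finset.univ
  cl_leaf : ∀ x, cl (leaf x) = {x}
  leaf_ne_root : ∀ x, leaf x ≠ root
  cl_nonempty : ∀ v, (cl v).Nonempty
  card_cl : ∀ u, (∃ v, v ≠ root ∧ par v = u) → ∀ B : Finset X,
    ∑ v ∈ Finset.univ.filter (fun v => v ≠ root ∧ par v = u), (B ∩ cl v).card = (B ∩ cl u).card
  w_pos : ∀ v, 0 < w v
  par_ne_leaf : ∀ v, v ≠ root → ∀ x, par v ≠ leaf x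
  pos : V → X
  pos_leaf : ∀ x, pos (leaf x) = x

attribute [instance] WTree.fintypeV

namespace WTree

open scoped Classical

variable {X : Type*} [Fintype X] (T : WTree X)

/-- The slots of a tree: the pairs of a node `v` other than the root and a number `j` below the
number of leaves of `v`. The value of a slot is the probability to have at most `j` servers below
`v`. -/
abbrev Slot : Type _ := Σ v : {v : T.V // v ≠ T.root}, Fin (T.cl v).card

instance : Fintype T.Slot := inferInstance

/-- The first slot of a leaf. -/
def leafSlot (x : X) : T.Slot := ⟨⟨T.leaf x, T.leaf_ne_root x⟩, ⟨0, by simp [T.cl_leaf]⟩⟩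

/-- The sum of the first `m` terms of the sequence that is `δ` on `j < c` and `1` on `j ≥ c`. -/
def stepSum (δ : ℝ) (c m : ℕ) : ℝ := ∑ j ∈ Finset.range m, if c ≤ j then 1 else δ

/-- The sum of the values of the first `m` slots of `u`. -/
def slotSum (z : T.Slot → ℝ) (u : T.V) (m : ℕ) : ℝ :=
  ∑ p : T.Slot, if p.1.1 = u ∧ p.2.1 < m then z p else 0

/-- The sum of the values of the first `m` slots of `u`, with the prescribed values at the root. -/
def demand (δ : ℝ) (k : ℕ) (z : T.Slot → ℝ) (u : T.V) (m : ℕ) : ℝ :=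
  (if u = T.root then stepSum δ k m else 0) + T.slotSum z u m

/-- The fractional server states. -/
def Feasible (δ : ℝ) (k : ℕ) (z : T.Slot → ℝ) : Prop :=
  ∀ (u : T.V) (S : Finset T.Slot), (∀ p ∈ S, T.par p.1 = u) →
    T.demand δ k z u S.card ≤ ∑ p ∈ S, z p

/-- The fractional state given by the set `B` of servers, with zeros replaced by `δ`. -/
def state (δ : ℝ) (B : Finset X) (p : T.Slot) : ℝ := if (B ∩ T.cl p.1).card ≤ p.2.1 then 1 else δ

theorem stepSum_succ (δ : ℝ) (c m : ℕ) :
    stepSum δ c (m + 1) = stepSum δ c m + if c ≤ m then 1 else δ := by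
  rw [stepSum, Finset.sum_range_succ, stepSum]

theorem stepSum_eq (δ : ℝ) (c m : ℕ) : stepSum δ c m = δ * m + (1 - δ) * ((m - c : ℕ) : ℝ) := by
  induction m with
  | zero => simp [stepSum]
  | succ m ih =>
    rw [stepSum_succ, ih]
    split_ifs with h
    · rw [Nat.succ_sub h]
      push_cast
      ring
    · rw [Nat.sub_eq_zero_of_le (by omega : m ≤ c), Nat.sub_eq_zero_of_le (by omega : m + 1 ≤ c)]
      push_cast
      ring

theorem slotSum_root (z : T.Slot → ℝ) (m : ℕ) : T.slotSum z T.root m = 0 := by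
  refine Finset.sum_eq_zero fun p _ => if_neg ?_
  rintro ⟨h, -⟩
  exact p.1.2 h

theorem slotSum_eq (z : T.Slot → ℝ) (u : T.V) (hu : u ≠ T.root) (m : ℕ) :
    T.slotSum z u m = ∑ j : Fin (T.cl u).card, if j.1 < m then z ⟨⟨u, hu⟩, j⟩ else 0 := by
  rw [slotSum, Fintype.sum_sigma, Finset.sum_eq_single ⟨u, hu⟩]
  · simp
  · intro v _ hv
    refine Finset.sum_eq_zero fun j _ => if_neg ?_
    rintro ⟨h, -⟩
    exact hv (Subtype.ext h)
  · simp

theorem slotSum_succ (z : T.Slot → ℝ) (u : T.V) (hu : u ≠ T.root) (m : ℕ) :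
    T.slotSum z u (m + 1) =
      T.slotSum z u m + if h : m < (T.cl u).card then z ⟨⟨u, hu⟩, ⟨m, h⟩⟩ else 0 := by
  rw [T.slotSum_eq z u hu, T.slotSum_eq z u hu]
  have : ∀ j : Fin (T.cl u).card, (if j.1 < m + 1 then z ⟨⟨u, hu⟩, j⟩ else 0) =
      (if j.1 < m then z ⟨⟨u, hu⟩, j⟩ else 0) + if j.1 = m then z ⟨⟨u, hu⟩, j⟩ else 0 := by
    intro j
    by_cases h1 : j.1 < m
    · rw [if_pos h1, if_pos (by omega), if_neg (by omega), add_zero]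
    · by_cases h2 : j.1 = m
      · rw [if_neg h1, if_pos (by omega), if_pos h2, zero_add]
      · rw [if_neg h1, if_neg (by omega), if_neg h2, zero_add]
  rw [Finset.sum_congr rfl fun j _ => this j, Finset.sum_add_distrib]
  congr 1
  split_ifs with h
  · rw [Finset.sum_eq_single ⟨m, h⟩]
    · simp
    · intro j _ hj
      exact if_neg fun h' => hj (Fin.ext h')
    · simp
  · refine Finset.sum_eq_zero fun j _ => if_neg ?_
    have := j.2
    omega

theorem slotSum_zero (z : T.Slot → ℝ) (u : T.V) : T.slotSum z u 0 = 0 :=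
  Finset.sum_eq_zero fun p _ => if_neg (by simp)

/-- The induction on the depth of a slot. -/
theorem slot_induction {P : T.Slot → Prop}
    (h : ∀ p : T.Slot, (∀ q : T.Slot, q.1.1 = T.par p.1 → P q) → P p) (p : T.Slot) : P p := by
  induction hd : T.depth p.1 using Nat.strong_induction_on generalizing p with
  | _ d ih =>
    refine h p fun q hq => ih (T.depth q.1) ?_ q rfl
    rw [hq, ← hd, T.depth_par p.1 p.1.2]
    exact Nat.lt_succ_self _

variable {T} {δ : ℝ} {k : ℕ}

/-- A single slot is at least the first slot of the parent, and the chain ends at the value δ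
prescribed at the root, where k ≥ 1. This bound keeps the logarithms of the potential under control.
-/
theorem Feasible.le (hk : 1 ≤ k) {z : T.Slot → ℝ} (hz : T.Feasible δ k z) (p : T.Slot) :
    δ ≤ z p := by
  induction p using T.slot_induction with
  | h p ih =>
    have h := hz (T.par p.1) {p} (by simp)
    rw [Finset.card_singleton, Finset.sum_singleton] at h
    refine le_trans ?_ h
    rw [demand]
    by_cases hu : T.par p.1 = T.root
    · rw [if_pos hu, hu, slotSum_root, add_zero, stepSum]
      simp
      rw [if_neg (by omega)]
    · rw [if_neg hu, T.slotSum_succ z _ hu, slotSum_zero, dif_pos (Finset.card_pos.2 (T.cl_nonempty _)),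
        zero_add, zero_add]
      exact ih _ rfl

/-- A child v has only |B ∩ cl v| such slots, and these numbers add up to |B ∩ cl u| over the
children of u. -/
theorem card_slots_lt_le (u : T.V) (S : Finset T.Slot) (hS : ∀ p ∈ S, T.par p.1 = u)
    (B : Finset X) :
    (S.filter fun p => p.2.1 < (B ∩ T.cl p.1).card).card ≤ (B ∩ T.cl u).card := by
  rcases S.eq_empty_or_nonempty with rfl | ⟨p₀, hp₀⟩
  · simp
  rw [← T.card_cl u ⟨p₀.1, p₀.1.2, hS p₀ hp₀⟩ B]
  rw [Finset.card_eq_sum_card_fiberwise (f := fun p : T.Slot => p.1.1)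
    (t := Finset.univ.filter fun v => v ≠ T.root ∧ T.par v = u)]
  · refine Finset.sum_le_sum fun v _ => ?_
    rw [← Finset.card_range (B ∩ T.cl v).card]
    refine Finset.card_le_card_of_injOn (fun p => p.2.1) ?_ ?_
    · intro p hp
      simp only [Finset.coe_filter, Finset.mem_filter, Set.mem_ofPred_eq] at hp
      simpa [← hp.2] using hp.1.2
    · intro p hp q hq hpq
      simp only [Finset.coe_filter, Set.mem_ofPred_eq] at hp hq
      obtain ⟨⟨v₁, h₁⟩, j₁⟩ := p
      obtain ⟨⟨v₂, h₂⟩, j₂⟩ := q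
      have h12 : v₁ = v₂ := hp.2.trans hq.2.symm
      subst h12
      congr 1
      exact Fin.ext hpq
  · intro p hp
    simp only [Finset.coe_filter, Set.mem_ofPred_eq] at hp
    simpa using ⟨p.1.2, hS p hp.1⟩

theorem state_le_one (hδ : δ ≤ 1) (B : Finset X) (p : T.Slot) : T.state δ B p ≤ 1 := by
  rw [state]
  split_ifs <;> linarith

theorem le_state (hδ : δ ≤ 1) (B : Finset X) (p : T.Slot) : δ ≤ T.state δ B p := by
  rw [state]
  split_ifs <;> linarith

theorem state_leafSlot {B : Finset X} {r : X} (hr : r ∈ B) : T.state δ B (T.leafSlot r) = δ := by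
  rw [state, if_neg]
  simp [leafSlot, T.cl_leaf, Finset.inter_singleton_of_mem hr]

/-- A set of slots of children of u has at most |B ∩ cl u| members of value δ, so its sum dominates
the step sequence of u. Offline states can thus be tested against the Lagrange conditions, and the
polyhedron is nonempty. -/
theorem feasible_state (hδ0 : 0 ≤ δ) (hδ : δ ≤ 1) {B : Finset X} (hB : B.card = k) :
    T.Feasible δ k (T.state δ B) := by
  intro u S hS
  have h1 : T.demand δ k (T.state δ B) u S.card ≤ stepSum δ (B ∩ T.cl u).card S.card := by
    rw [demand]
    by_cases hu : u = T.root
    · rw [if_pos hu, hu, slotSum_root, add_zero, T.cl_root, Finset.inter_univ, hB]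
    · rw [if_neg hu, zero_add, T.slotSum_eq _ u hu, stepSum]
      simp only [state]
      rw [Fin.sum_univ_eq_sum_range (fun j => if j < S.card then
        if (B ∩ T.cl u).card ≤ j then (1 : ℝ) else δ else 0) (T.cl u).card, ← Finset.sum_filter]
      refine Finset.sum_le_sum_of_subset_of_nonneg ?_ ?_
      · intro j hj
        simp only [Finset.mem_filter] at hj
        exact Finset.mem_range.2 hj.2
      · intro j _ _
        split_ifs <;> linarith
  refine h1.trans ?_
  rw [stepSum_eq]
  have h2 : ∑ p ∈ S, T.state δ B p = δ * S.card +
      (1 - δ) * ((S.filter fun p => (B ∩ T.cl p.1).card ≤ p.2.1).card : ℝ) := by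
    have : ∀ p ∈ S, T.state δ B p =
        δ + (1 - δ) * if (B ∩ T.cl p.1).card ≤ p.2.1 then 1 else 0 := by
      intro p _
      rw [state]
      split_ifs <;> ring
    rw [Finset.sum_congr rfl this, Finset.sum_add_distrib, ← Finset.mul_sum, Finset.sum_boole,
      Finset.sum_const, nsmul_eq_mul]
    ring
  rw [h2]
  have h3 := card_slots_lt_le u S hS B
  have h4 := Finset.card_filter_add_card_filter_not (s := S)
    (fun p : T.Slot => (B ∩ T.cl p.1).card ≤ p.2.1)
  simp only [not_le] at h4
  have h5 : (S.card - (B ∩ T.cl u).card : ℕ) ≤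
      (S.filter fun p => (B ∩ T.cl p.1).card ≤ p.2.1).card := by omega
  have h6 := mul_le_mul_of_nonneg_left (Nat.cast_le (α := ℝ).2 h5) (by linarith : 0 ≤ 1 - δ)
  linarith

end WTree

end KServer
end

/-! ### The fractional algorithm: entropic projection and potential -/

noncomputable section
namespace KServer
namespace WTree

open scoped Classical

variable {X : Type*} [Fintype X] {T : WTree X} {δ : ℝ} {k : ℕ}

/-- The part of the potential that compares the fractional state with the set `B` of servers. -/
def divergence (T : WTree X) (δ : ℝ) (B : Finset X) (z : T.Slot → ℝ) : ℝ :=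
  ∑ p : T.Slot, T.state δ B p * (T.w p.1 * -Real.log (z p))

/-- The potential of the fractional algorithm. -/
def potential (T : WTree X) (δ : ℝ) (B : Finset X) (z : T.Slot → ℝ) : ℝ :=
  4 * T.height * T.divergence δ B z +
    ∑ p : T.Slot, (4 * T.height + 1 - 2 * T.depth p.1) * (T.w p.1 * z p)

/-- The Lagrange conditions for the projection of the fractional state `z` to the feasible states
that serve `r`. -/
theorem exists_projection (hδ0 : 0 < δ) (hδ : δ ≤ 1) (hk : 1 ≤ k) (z : T.Slot → ℝ)
    (hz : ∀ p, 0 < z p) (r : X) (hkX : k ≤ Fintype.card X) :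
    ∃ (z' : T.Slot → ℝ) (ζ : ℝ) (c : T.V → Finset T.Slot → ℝ), T.Feasible δ k z' ∧
      z' (T.leafSlot r) ≤ 2 * δ ∧ 0 ≤ ζ ∧ ζ * z' (T.leafSlot r) = ζ * (2 * δ) ∧
      (∀ u S, 0 ≤ c u S) ∧
      (∀ u S, c u S ≠ 0 → (∀ p ∈ S, T.par p.1 = u) ∧ ∑ p ∈ S, z' p = T.demand δ k z' u S.card) ∧
      ∀ y : T.Slot → ℝ, ∑ p, y p * (T.w p.1 * Real.log (z' p / z p)) =
        ∑ u, ∑ S, c u S * (∑ p ∈ S, y p - T.slotSum y u S.card) - ζ * y (T.leafSlot r) := by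
  set good : T.V → Finset T.Slot → Prop := fun u S => ∀ p ∈ S, T.par p.1 = u with hgood
  -- The row `none` is the service constraint. A row `some (u, S)` is a feasibility inequality, or 0
  -- ≥ 0 if `S` does not consist of slots of children of `u`. Service only asks for the value 2δ,
  -- whereas offline states that serve `r` have δ there. This gap is used in the potential argument.
  let A : Option (T.V × Finset T.Slot) → T.Slot → ℝ := fun κ p =>
    match κ with
    | none => if p = T.leafSlot r then -1 else 0
    | some (u, S) => if good u S then
        (if p ∈ S then 1 else 0) - (if p.1.1 = u ∧ p.2.1 < S.card then 1 else 0) else 0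
  let b : Option (T.V × Finset T.Slot) → ℝ := fun κ =>
    match κ with
    | none => -(2 * δ)
    | some (u, S) => if good u S then (if u = T.root then stepSum δ k S.card else 0) else 0
  have hA0 : ∀ y : T.Slot → ℝ, ∑ p, A none p * y p = -y (T.leafSlot r) := by
    intro y
    simp [A]
  have hA1 : ∀ (y : T.Slot → ℝ) u S, good u S →
      ∑ p, A (some (u, S)) p * y p = ∑ p ∈ S, y p - T.slotSum y u S.card := by
    intro y u S hg
    simp only [A, if_pos hg, sub_mul, ite_mul, one_mul, zero_mul, Finset.sum_sub_distrib,
      Finset.sum_ite_mem, Finset.univ_inter, slotSum]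
  have hA2 : ∀ (y : T.Slot → ℝ) u S, ¬ good u S → ∑ p, A (some (u, S)) p * y p = 0 := by
    intro y u S hg
    simp only [A, if_neg hg, zero_mul, Finset.sum_const_zero]
  have hfeas : ∀ y : T.Slot → ℝ, (∀ κ, b κ ≤ ∑ p, A κ p * y p) →
      T.Feasible δ k y ∧ y (T.leafSlot r) ≤ 2 * δ := by
    intro y hy
    constructor
    · intro u S hS
      have := hy (some (u, S))
      rw [hA1 y u S hS] at this
      simp only [b, if_pos (show good u S from hS)] at this
      rw [demand]
      linarith
    · have := hy none
      rw [hA0] at this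
      simp only [b] at this
      linarith
  obtain ⟨B, hrB, hB⟩ : ∃ B : Finset X, r ∈ B ∧ B.card = k := by
    obtain ⟨B, hB1, -, hB2⟩ := Finset.exists_subsuperset_card_eq
      (Finset.subset_univ ({r} : Finset X)) (by simpa using hk) (by simpa using hkX)
    exact ⟨B, hB1 (Finset.mem_singleton_self r), hB2⟩
  obtain ⟨z', c, h1, h2, h3, h4⟩ := exists_entropic_projection A b (fun p => T.w p.1) z
    (fun p => T.w_pos _) hz
    (fun y hy p => lt_of_lt_of_le hδ0 ((hfeas y hy).1.le hk p))
    ⟨T.state δ B, by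
      rintro (_ | ⟨u, S⟩)
      · rw [hA0, state_leafSlot hrB]
        simp only [b]
        linarith
      · by_cases hg : good u S
        · rw [hA1 _ u S hg]
          have := feasible_state (T := T) hδ0.le hδ hB u S hg
          rw [demand] at this
          simp only [b, if_pos hg]
          linarith
        · rw [hA2 _ u S hg]
          simp only [b, if_neg hg, le_refl]⟩
  refine ⟨z', c none, fun u S => if good u S then c (some (u, S)) else 0, (hfeas z' h1).1,
    (hfeas z' h1).2, h2 none, ?_, ?_, ?_, ?_⟩
  · by_cases hc : c none = 0
    · simp [hc]
    · have := h3 none hc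
      rw [hA0] at this
      simp only [b, neg_inj] at this
      rw [this]
  · intro u S
    dsimp only
    split_ifs
    · exact h2 _
    · exact le_rfl
  · intro u S hc
    dsimp only at hc
    split_ifs at hc with hg
    · refine ⟨hg, ?_⟩
      have := h3 _ hc
      rw [hA1 _ u S hg] at this
      simp only [b, if_pos hg] at this
      rw [demand]
      linarith
    · exact absurd rfl hc
  · intro y
    rw [h4 y, Fintype.sum_option, hA0, Fintype.sum_prod_type, add_comm, mul_neg, ← sub_eq_add_neg]
    congr 1
    refine Finset.sum_congr rfl fun u _ => Finset.sum_congr rfl fun S _ => ?_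
    by_cases hg : good u S
    · rw [hA1 y u S hg]
      simp only [if_pos hg]
    · rw [hA2 y u S hg]
      simp only [if_neg hg, mul_zero, zero_mul]

theorem sub_le_mul_log {z z' : ℝ} (hz : 0 < z) (hz' : 0 < z') : z' - z ≤ z' * Real.log (z' / z) := by
  have h := Real.one_sub_inv_le_log_of_pos (x := z' / z) (by positivity)
  have h2 := mul_le_mul_of_nonneg_left h hz'.le
  have h3 : z' * (1 - (z' / z)⁻¹) = z' - z := by field_simp
  linarith

theorem sum_abs_le_of_le {ι : Type*} [Fintype ι] (f g : ι → ℝ) (hg : ∀ i, 0 ≤ g i)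
    (h : ∀ i, f i ≤ g i) : ∑ i, |f i| ≤ 2 * ∑ i, g i - ∑ i, f i := by
  rw [Finset.mul_sum, ← Finset.sum_sub_distrib]
  refine Finset.sum_le_sum fun i _ => ?_
  rcases abs_cases (f i) with ⟨h1, h2⟩ | ⟨h1, h2⟩ <;> linarith [h i, hg i]

/-- One step of the fractional algorithm: its movement is paid by the drop of the potential. -/
theorem exists_step (hδ0 : 0 < δ) (hδ : δ ≤ 1) (hk : 1 ≤ k) (hkX : k ≤ Fintype.card X)
    (z : T.Slot → ℝ) (hz : ∀ p, 0 < z p) (hz1 : ∀ p, z p ≤ 1) (r : X) :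
    ∃ z' : T.Slot → ℝ, T.Feasible δ k z' ∧ (∀ p, z' p ≤ 1) ∧ z' (T.leafSlot r) ≤ 2 * δ ∧
      ∀ B : Finset X, B.card = k → r ∈ B →
        ∑ p, T.w p.1 * |z' p - z p| ≤ T.potential δ B z - T.potential δ B z' := by
  obtain ⟨z', ζ, c, hf, hr, hζ, hζr, hc, htight, hL⟩ := exists_projection hδ0 hδ hk z hz r hkX
  have hz' : ∀ p, 0 < z' p := fun p => lt_of_lt_of_le hδ0 (hf.le hk p)
  set L : T.Slot → ℝ := fun p => T.w p.1 * Real.log (z' p / z p) with hLdef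
  -- `a p` collects the multipliers of the tight sets through `p`. As `w * (z' - z) ≤ z' * L` and `L
  -- ≤ a`, the weighted increase at `p` is at most `z' p * a p`, and `G` below is the total of these
  -- bounds.
  set a : T.Slot → ℝ := fun p => ∑ u, ∑ S, c u S * if p ∈ S then 1 else 0 with ha
  have ha0 : ∀ p, 0 ≤ a p := fun p => Finset.sum_nonneg fun u _ => Finset.sum_nonneg fun S _ =>
    mul_nonneg (hc u S) (by split_ifs <;> norm_num)
  have hLa : ∀ p, L p ≤ a p := by
    intro p
    have h := hL (fun q => if q = p then 1 else 0)
    have hlhs : ∑ q, (if q = p then (1 : ℝ) else 0) * (T.w q.1 * Real.log (z' q / z q)) = L p := by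
      simp [hLdef]
    rw [hlhs] at h
    rw [h]
    have h1 : 0 ≤ ζ * if T.leafSlot r = p then 1 else 0 :=
      mul_nonneg hζ (by split_ifs <;> norm_num)
    have h2 : ∑ u, ∑ S, c u S * (∑ q ∈ S, (if q = p then (1 : ℝ) else 0) -
        T.slotSum (fun q => if q = p then 1 else 0) u S.card) ≤ a p := by
      refine Finset.sum_le_sum fun u _ => Finset.sum_le_sum fun S _ =>
        mul_le_mul_of_nonneg_left ?_ (hc u S)
      rw [Finset.sum_ite_eq']
      have : 0 ≤ T.slotSum (fun q => if q = p then 1 else 0) u S.card :=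
        Finset.sum_nonneg fun q _ => by
          beta_reduce
          split_ifs <;> norm_num
      linarith
    linarith
  have hwL : ∀ p, T.w p.1 * (z' p - z p) ≤ z' p * L p := by
    intro p
    have := mul_le_mul_of_nonneg_left (sub_le_mul_log (hz p) (hz' p)) (T.w_pos p.1).le
    calc _ ≤ _ := this
      _ = _ := by rw [hLdef]; ring
  have hz'1 : ∀ p, z' p ≤ 1 := by
    intro p
    induction p using T.slot_induction with
    | h p ih =>
      by_contra hcon
      push Not at hcon
      have hLp : 0 < L p := by
        refine mul_pos (T.w_pos _) (Real.log_pos ?_)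
        rw [one_lt_div (hz p)]
        linarith [hz1 p]
      have hap : 0 < a p := lt_of_lt_of_le hLp (hLa p)
      obtain ⟨u, -, hu⟩ := Finset.exists_ne_zero_of_sum_ne_zero hap.ne'
      obtain ⟨S, -, hS⟩ := Finset.exists_ne_zero_of_sum_ne_zero hu
      have hpS : p ∈ S := by
        by_contra hn
        simp [hn] at hS
      obtain ⟨hgood, ht⟩ := htight u S (left_ne_zero_of_mul hS)
      -- `S` is tight and `S` without `p` is feasible, so `z' p` is at most the last increment of
      -- the demand at `u`. This is a prescribed value at the root, a slot of `u`, or zero, hence at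
      -- most 1.
      have h1 := hf u (S.erase p) fun q hq => hgood q (Finset.mem_of_mem_erase hq)
      have h2 := Finset.sum_erase_add S z' hpS
      obtain ⟨m, hm⟩ : ∃ m, S.card = m + 1 :=
        ⟨S.card - 1, by have := Finset.card_pos.2 ⟨p, hpS⟩; omega⟩
      rw [Finset.card_erase_of_mem hpS, hm, Nat.add_sub_cancel] at h1
      rw [hm] at ht
      have h3 : T.demand δ k z' u (m + 1) ≤ T.demand δ k z' u m + 1 := by
        rw [demand, demand]
        by_cases hu : u = T.root
        · rw [if_pos hu, if_pos hu, hu, slotSum_root, slotSum_root, stepSum_succ]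
          split_ifs <;> linarith
        · rw [if_neg hu, if_neg hu, T.slotSum_succ _ _ hu]
          split_ifs
          · have := ih ⟨⟨u, hu⟩, ⟨m, by assumption⟩⟩ (hgood p hpS).symm
            linarith
          · linarith
      linarith
  refine ⟨z', hf, hz'1, hr, fun B hB hrB => ?_⟩
  set Λ : ℝ := ∑ u, ∑ S, c u S * (if u = T.root then stepSum δ k S.card else 0) with hΛ
  set G : ℝ := ∑ u, ∑ S, c u S * ∑ p ∈ S, z' p with hG
  set W : ℝ := ∑ p : T.Slot, T.w p.1 * (z' p - z p) with hW
  set W' : ℝ := ∑ p : T.Slot, T.depth p.1 * (T.w p.1 * (z' p - z p)) with hW'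
  have hGa : ∑ p, z' p * a p = G := by
    rw [ha, hG]
    simp only [Finset.mul_sum]
    rw [Finset.sum_comm]
    refine Finset.sum_congr rfl fun u _ => ?_
    rw [Finset.sum_comm]
    refine Finset.sum_congr rfl fun S _ => ?_
    simp only [mul_ite, mul_one, mul_zero]
    rw [Finset.sum_ite_mem, Finset.univ_inter]
    exact Finset.sum_congr rfl fun p _ => mul_comm _ _
  have hup : ∑ p, |T.w p.1 * (z' p - z p)| ≤ 2 * G - W := by
    rw [← hGa]
    exact sum_abs_le_of_le _ _ (fun p => mul_nonneg (hz' p).le (ha0 p)) fun p =>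
      (hwL p).trans (mul_le_mul_of_nonneg_left (hLa p) (hz' p).le)
  have hstate : Λ - ζ * δ ≤ ∑ p, T.state δ B p * L p := by
    rw [hL, state_leafSlot hrB]
    have : Λ ≤ ∑ u, ∑ S, c u S * (∑ p ∈ S, T.state δ B p -
        T.slotSum (T.state δ B) u S.card) := by
      refine Finset.sum_le_sum fun u _ => Finset.sum_le_sum fun S _ => ?_
      by_cases h0 : c u S = 0
      · rw [h0, zero_mul, zero_mul]
      · refine mul_le_mul_of_nonneg_left ?_ (hc u S)
        have := feasible_state (T := T) hδ0.le hδ hB u S (htight u S h0).1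
        rw [demand] at this
        linarith
    linarith
  have hself : ∑ p, z' p * L p = Λ - ζ * (2 * δ) := by
    rw [hL, hζr]
    congr 1
    refine Finset.sum_congr rfl fun u _ => Finset.sum_congr rfl fun S _ => ?_
    by_cases h0 : c u S = 0
    · rw [h0, zero_mul, zero_mul]
    · rw [(htight u S h0).2, demand, add_sub_cancel_right]
  -- Weighting by depth isolates `G`: below a node `u` the slots in `S` have weight `depth u + 1`
  -- and the slots of `u` have weight `depth u`, while both sums of `z'` agree by tightness. At the
  -- root the depth 0 removes the second sum.
  have hdepth : ∑ p : T.Slot, T.depth p.1 * z' p * L p =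
      G - ζ * (T.depth (T.leaf r) * z' (T.leafSlot r)) := by
    rw [hL fun p => T.depth p.1 * z' p]
    congr 1
    refine Finset.sum_congr rfl fun u _ => Finset.sum_congr rfl fun S _ => ?_
    by_cases h0 : c u S = 0
    · rw [h0, zero_mul, zero_mul]
    · congr 1
      obtain ⟨hgood, ht⟩ := htight u S h0
      have h1 : ∑ p ∈ S, T.depth p.1 * z' p = (T.depth u + 1) * ∑ p ∈ S, z' p := by
        rw [Finset.mul_sum]
        refine Finset.sum_congr rfl fun p hp => ?_
        rw [T.depth_par p.1 p.1.2, hgood p hp]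
        push_cast
        ring
      have h2 : T.slotSum (fun p => T.depth p.1 * z' p) u S.card =
          T.depth u * T.slotSum z' u S.card := by
        rw [slotSum, slotSum, Finset.mul_sum]
        refine Finset.sum_congr rfl fun p _ => ?_
        split_ifs with h
        · rw [h.1]
        · rw [mul_zero]
      rw [h1, h2]
      by_cases hu : u = T.root
      · rw [hu, T.depth_root, Nat.cast_zero]
        ring
      · rw [ht, demand, if_neg hu]
        ring
  have hWL : W ≤ ∑ p, z' p * L p := Finset.sum_le_sum fun p _ => hwL p
  -- This is `hwL` summed with the weights height minus depth, which are nonnegative. It bounds the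
  -- depth-weighted sum, and hence `G`, from above.
  have hDW : T.height * W - W' ≤ T.height * ∑ p, z' p * L p - ∑ p : T.Slot, T.depth p.1 * z' p * L p := by
    rw [hW, hW', Finset.mul_sum, Finset.mul_sum, ← Finset.sum_sub_distrib, ← Finset.sum_sub_distrib]
    refine Finset.sum_le_sum fun p _ => ?_
    have h1 : (T.depth p.1 : ℝ) ≤ T.height := Nat.cast_le.2 (T.depth_le _)
    have := mul_le_mul_of_nonneg_left (hwL p) (sub_nonneg.2 h1)
    linarith
  have hdr : ζ * (T.depth (T.leaf r) * z' (T.leafSlot r)) ≤ T.height * (ζ * (2 * δ)) := by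
    rw [← hζr]
    have h1 : (T.depth (T.leaf r) : ℝ) ≤ T.height := Nat.cast_le.2 (T.depth_le _)
    have := mul_le_mul_of_nonneg_right h1 (mul_nonneg hζ (hz' (T.leafSlot r)).le)
    linarith
  have hdrop : T.divergence δ B z - T.divergence δ B z' = ∑ p, T.state δ B p * L p := by
    rw [divergence, divergence, ← Finset.sum_sub_distrib]
    refine Finset.sum_congr rfl fun p _ => ?_
    rw [hLdef]
    simp only
    rw [Real.log_div (hz' p).ne' (hz p).ne']
    ring
  have hlin : ∑ p : T.Slot, (4 * T.height + 1 - 2 * T.depth p.1) * (T.w p.1 * z p) -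
      ∑ p : T.Slot, (4 * T.height + 1 - 2 * T.depth p.1) * (T.w p.1 * z' p) =
      -((4 * T.height + 1) * W) + 2 * W' := by
    rw [hW, hW', Finset.mul_sum, Finset.mul_sum, ← Finset.sum_sub_distrib, ← Finset.sum_neg_distrib,
      ← Finset.sum_add_distrib]
    exact Finset.sum_congr rfl fun p _ => by ring
  have habs : ∑ p : T.Slot, T.w p.1 * |z' p - z p| = ∑ p : T.Slot, |T.w p.1 * (z' p - z p)| :=
    Finset.sum_congr rfl fun p _ => by rw [abs_mul, abs_of_pos (T.w_pos _)]
  have hpot : T.potential δ B z - T.potential δ B z' =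
      4 * T.height * ∑ p, T.state δ B p * L p - (4 * T.height + 1) * W + 2 * W' := by
    rw [← hdrop, potential, potential]
    linarith
  rw [habs, hpot]
  -- Twice `hstate` gives 2Λ - 2ζδ, and Λ - 2ζδ ≥ W by `hself` and `hWL`. The multiplier ζ cancels
  -- because the offline value at the requested leaf is half of the allowed 2δ.
  have h1 : Λ ≤ 2 * ∑ p, T.state δ B p * L p - W := by linarith
  have h2 := mul_le_mul_of_nonneg_left h1 (Nat.cast_nonneg (α := ℝ) T.height)
  rw [hself, mul_sub] at hDW
  linarith

end WTree
end KServer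
end

noncomputable section
namespace KServer
namespace WTree

open scoped Classical

variable {X : Type*} [Fintype X] {T : WTree X} {δ : ℝ} {k : ℕ}

/-! #### Bounds for the potential -/

theorem divergence_le (hδ0 : 0 < δ) (hδ : δ ≤ 1) (B : Finset X) {z : T.Slot → ℝ}
    (hz : ∀ p, δ ≤ z p) : T.divergence δ B z ≤ ∑ p : T.Slot, T.w p.1 * -Real.log δ := by
  refine Finset.sum_le_sum fun p _ => ?_
  have h1 : -Real.log (z p) ≤ -Real.log δ := neg_le_neg (Real.log_le_log hδ0 (hz p))
  have h2 : 0 ≤ -Real.log δ := neg_nonneg.2 (Real.log_nonpos hδ0.le hδ)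
  have h3 := T.w_pos p.1
  have h4 : T.w p.1 * -Real.log (z p) ≤ T.w p.1 * -Real.log δ :=
    mul_le_mul_of_nonneg_left h1 h3.le
  have h5 : 0 ≤ T.w p.1 * -Real.log δ := mul_nonneg h3.le h2
  have h6 := state_le_one hδ B p
  have h7 := hδ0.le.trans (le_state hδ B p)
  nlinarith

theorem divergence_nonneg (hδ0 : 0 < δ) (hδ : δ ≤ 1) (B : Finset X) {z : T.Slot → ℝ}
    (hz : ∀ p, δ ≤ z p) (hz1 : ∀ p, z p ≤ 1) : 0 ≤ T.divergence δ B z :=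
  Finset.sum_nonneg fun p _ => mul_nonneg (hδ0.le.trans (le_state hδ B p))
    (mul_nonneg (T.w_pos _).le (neg_nonneg.2 (Real.log_nonpos (hδ0.le.trans (hz p)) (hz1 p))))

theorem coeff_nonneg (v : T.V) : (0 : ℝ) ≤ 4 * T.height + 1 - 2 * T.depth v := by
  have h1 : (T.depth v : ℝ) ≤ T.height := Nat.cast_le.2 (T.depth_le _)
  have h2 : (0 : ℝ) ≤ T.height := Nat.cast_nonneg _
  linarith

theorem potential_nonneg (hδ0 : 0 < δ) (hδ : δ ≤ 1) (B : Finset X) {z : T.Slot → ℝ}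
    (hz : ∀ p, δ ≤ z p) (hz1 : ∀ p, z p ≤ 1) : 0 ≤ T.potential δ B z :=
  add_nonneg (mul_nonneg (by positivity) (divergence_nonneg hδ0 hδ B hz hz1))
    (Finset.sum_nonneg fun p _ => mul_nonneg (coeff_nonneg _)
      (mul_nonneg (T.w_pos _).le (hδ0.le.trans (hz p))))

theorem exists_potential_le (T : WTree X) (hδ0 : 0 < δ) (hδ : δ ≤ 1) :
    ∃ c : ℝ, ∀ (B : Finset X) (z : T.Slot → ℝ), (∀ p, δ ≤ z p) → (∀ p, z p ≤ 1) →
      T.potential δ B z ≤ c := by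
  refine ⟨4 * T.height * ∑ p : T.Slot, T.w p.1 * -Real.log δ +
    ∑ p : T.Slot, (4 * T.height + 1 - 2 * T.depth p.1) * (T.w p.1 * 1), fun B z hz hz1 => ?_⟩
  refine add_le_add (mul_le_mul_of_nonneg_left (divergence_le hδ0 hδ B hz) (by positivity)) ?_
  exact Finset.sum_le_sum fun p _ => mul_le_mul_of_nonneg_left
    (mul_le_mul_of_nonneg_left (hz1 p) (T.w_pos _).le) (coeff_nonneg _)

theorem sum_abs_indicator_le (δ : ℝ) (hδ0 : 0 ≤ δ) (hδ : δ ≤ 1) (n a b : ℕ) :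
    ∑ j : Fin n, |(if a ≤ j.1 then (1 : ℝ) else δ) - (if b ≤ j.1 then 1 else δ)| ≤ |(a : ℝ) - b| := by
  wlog hab : a ≤ b generalizing a b
  · have := this b a (by omega)
    rw [abs_sub_comm (a : ℝ)]
    refine le_trans (le_of_eq ?_) this
    exact Finset.sum_congr rfl fun j _ => abs_sub_comm _ _
  have h1 : ∀ j : Fin n, |(if a ≤ j.1 then (1 : ℝ) else δ) - (if b ≤ j.1 then 1 else δ)| ≤
      if j.1 ∈ Finset.Ico a b then 1 else 0 := by
    intro j
    by_cases h2 : a ≤ j.1 <;> by_cases h3 : b ≤ j.1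
    · rw [if_pos h2, if_pos h3, sub_self, abs_zero]
      split_ifs <;> norm_num
    · rw [if_pos h2, if_neg h3, if_pos (Finset.mem_Ico.2 ⟨h2, by omega⟩),
        abs_of_nonneg (by linarith)]
      linarith
    · omega
    · rw [if_neg h2, if_neg h3, sub_self, abs_zero]
      split_ifs <;> norm_num
  refine (Finset.sum_le_sum fun j _ => h1 j).trans ?_
  rw [Fin.sum_univ_eq_sum_range (fun j => if j ∈ Finset.Ico a b then (1 : ℝ) else 0) n,
    Finset.sum_boole, abs_of_nonpos (by simpa using hab)]
  have : ((Finset.range n).filter fun j => j ∈ Finset.Ico a b).card ≤ b - a := by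
    rw [← Nat.card_Ico]
    exact Finset.card_le_card fun j hj => (Finset.mem_filter.1 hj).2
  calc _ ≤ ((b - a : ℕ) : ℝ) := Nat.cast_le.2 this
    _ = _ := by rw [Nat.cast_sub hab]; ring

/-- Only the divergence depends on the offline set. At a node, at most as many slots change as the
number of servers does, and each has a weight of at most `w * -log δ`. -/
theorem potential_sub_le (hδ0 : 0 < δ) (hδ : δ ≤ 1) (B B' : Finset X) {z : T.Slot → ℝ}
    (hz : ∀ p, δ ≤ z p) (hz1 : ∀ p, z p ≤ 1) :
    T.potential δ B' z - T.potential δ B z ≤ 4 * T.height * (-Real.log δ *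
      ∑ v : {v : T.V // v ≠ T.root}, T.w v *
        |((B' ∩ T.cl v).card : ℝ) - (B ∩ T.cl v).card|) := by
  rw [potential, potential, add_sub_add_right_eq_sub, ← mul_sub]
  refine mul_le_mul_of_nonneg_left ?_ (by positivity)
  rw [divergence, divergence, ← Finset.sum_sub_distrib, Fintype.sum_sigma, Finset.mul_sum]
  refine Finset.sum_le_sum fun v _ => ?_
  have h1 : ∀ j : Fin (T.cl v).card, T.state δ B' ⟨v, j⟩ * (T.w v * -Real.log (z ⟨v, j⟩)) -
      T.state δ B ⟨v, j⟩ * (T.w v * -Real.log (z ⟨v, j⟩)) ≤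
      T.w v * -Real.log δ * |T.state δ B' ⟨v, j⟩ - T.state δ B ⟨v, j⟩| := by
    intro j
    have h2 : -Real.log (z ⟨v, j⟩) ≤ -Real.log δ := neg_le_neg (Real.log_le_log hδ0 (hz _))
    have h3 : 0 ≤ -Real.log (z ⟨v, j⟩) :=
      neg_nonneg.2 (Real.log_nonpos (hδ0.le.trans (hz _)) (hz1 _))
    have h4 := T.w_pos v
    rw [← sub_mul, mul_comm]
    calc _ ≤ T.w v * -Real.log (z ⟨v, j⟩) * |T.state δ B' ⟨v, j⟩ - T.state δ B ⟨v, j⟩| :=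
          mul_le_mul_of_nonneg_left (le_abs_self _) (mul_nonneg h4.le h3)
      _ ≤ _ := mul_le_mul_of_nonneg_right (mul_le_mul_of_nonneg_left h2 h4.le) (abs_nonneg _)
  refine (Finset.sum_le_sum fun j _ => h1 j).trans ?_
  rw [← Finset.mul_sum]
  have h2 : 0 ≤ -Real.log δ := neg_nonneg.2 (Real.log_nonpos hδ0.le hδ)
  have h3 := sum_abs_indicator_le δ hδ0.le hδ (T.cl v).card (B' ∩ T.cl v).card (B ∩ T.cl v).card
  calc _ ≤ T.w v * -Real.log δ * |((B' ∩ T.cl v).card : ℝ) - (B ∩ T.cl v).card| :=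
        mul_le_mul_of_nonneg_left h3 (mul_nonneg (T.w_pos _).le h2)
    _ = _ := by ring

/-! #### The server measure of a fractional state -/

/-- The function that is constant on the first half of each unit interval between two integers and
has slope two on the second half. -/
def shrink (x : ℝ) : ℝ := max (⌊x⌋ : ℝ) (2 * x - ⌊x⌋ - 1)

theorem shrink_eq_of {x : ℝ} {n : ℤ} (h1 : n ≤ x) (h2 : x < n + 1) :
    shrink x = max (n : ℝ) (2 * x - n - 1) := by
  rw [shrink, Int.floor_eq_iff.2 ⟨h1, h2⟩]

theorem shrink_sub_le {x y : ℝ} (h : x ≤ y) :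
    0 ≤ shrink y - shrink x ∧ shrink y - shrink x ≤ 2 * (y - x) := by
  have hx1 := Int.floor_le x
  have hx2 := Int.lt_floor_add_one x
  have hy1 := Int.floor_le y
  have hy2 := Int.lt_floor_add_one y
  have hxy : ⌊x⌋ ≤ ⌊y⌋ := Int.floor_le_floor h
  rw [shrink, shrink]
  rcases hxy.eq_or_lt with heq | hlt
  · rw [heq]
    rcases max_cases ((⌊y⌋ : ℤ) : ℝ) (2 * x - ⌊y⌋ - 1) with ⟨h1, h2⟩ | ⟨h1, h2⟩ <;>
      rcases max_cases ((⌊y⌋ : ℤ) : ℝ) (2 * y - ⌊y⌋ - 1) with ⟨h3, h4⟩ | ⟨h3, h4⟩ <;>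
        rw [h1, h3] <;> constructor <;> linarith
  · have : ((⌊x⌋ : ℤ) : ℝ) + 1 ≤ ⌊y⌋ := by exact_mod_cast hlt
    rcases max_cases ((⌊x⌋ : ℤ) : ℝ) (2 * x - ⌊x⌋ - 1) with ⟨h1, h2⟩ | ⟨h1, h2⟩ <;>
      rcases max_cases ((⌊y⌋ : ℤ) : ℝ) (2 * y - ⌊y⌋ - 1) with ⟨h3, h4⟩ | ⟨h3, h4⟩ <;>
        rw [h1, h3] <;> constructor <;> linarith

theorem shrink_mono {x y : ℝ} (h : x ≤ y) : shrink x ≤ shrink y := by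
  linarith [(shrink_sub_le h).1]

theorem abs_shrink_sub_le (x y : ℝ) : |shrink x - shrink y| ≤ 2 * |x - y| := by
  rcases le_total y x with h | h
  · have := shrink_sub_le h
    rw [abs_of_nonneg this.1, abs_of_nonneg (by linarith)]
    exact this.2
  · have := shrink_sub_le h
    rw [abs_sub_comm, abs_of_nonneg this.1, abs_sub_comm, abs_of_nonneg (by linarith)]
    exact this.2

/-- On fractional parts `shrink` is the excess max(0, 2t - 1), and a sum that crosses an integer
gains a full unit. Superadditivity keeps the counts of the children below that of their parent,
while the flat halves absorb surplus mass at the root. -/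
theorem shrink_add_le (x y : ℝ) : shrink x + shrink y ≤ shrink (x + y) := by
  have hx1 := Int.floor_le x
  have hx2 := Int.lt_floor_add_one x
  have hy1 := Int.floor_le y
  have hy2 := Int.lt_floor_add_one y
  rcases lt_or_ge (x + y) (⌊x⌋ + ⌊y⌋ + 1) with h | h
  · rw [shrink_eq_of (x := x + y) (n := ⌊x⌋ + ⌊y⌋) (by push_cast; linarith)
      (by push_cast; linarith), shrink, shrink]
    push_cast
    rcases max_cases ((⌊x⌋ : ℤ) : ℝ) (2 * x - ⌊x⌋ - 1) with ⟨h1, h2⟩ | ⟨h1, h2⟩ <;>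
      rcases max_cases ((⌊y⌋ : ℤ) : ℝ) (2 * y - ⌊y⌋ - 1) with ⟨h3, h4⟩ | ⟨h3, h4⟩ <;>
        rw [h1, h3, le_max_iff] <;> first | (left; linarith) | (right; linarith)
  · rw [shrink_eq_of (x := x + y) (n := ⌊x⌋ + ⌊y⌋ + 1) (by push_cast; linarith)
      (by push_cast; linarith), shrink, shrink]
    push_cast
    rcases max_cases ((⌊x⌋ : ℤ) : ℝ) (2 * x - ⌊x⌋ - 1) with ⟨h1, h2⟩ | ⟨h1, h2⟩ <;>
      rcases max_cases ((⌊y⌋ : ℤ) : ℝ) (2 * y - ⌊y⌋ - 1) with ⟨h3, h4⟩ | ⟨h3, h4⟩ <;>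
        rw [h1, h3, le_max_iff] <;> first | (left; linarith) | (right; linarith)

theorem shrink_zero : shrink 0 = 0 := by simp [shrink]

theorem sum_shrink_le {ι : Type*} (s : Finset ι) (f : ι → ℝ) :
    ∑ i ∈ s, shrink (f i) ≤ shrink (∑ i ∈ s, f i) := by
  induction s using Finset.induction_on with
  | empty => simp [shrink_zero]
  | insert i s hi ih =>
    rw [Finset.sum_insert hi, Finset.sum_insert hi]
    exact (add_le_add_right ih _).trans (shrink_add_le _ _)

/-- The scaled fractional number of servers below the node `v`. -/
def mass (T : WTree X) (δ : ℝ) (z : T.Slot → ℝ) (v : {v : T.V // v ≠ T.root}) : ℝ :=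
  (∑ j : Fin (T.cl v).card, (1 - z ⟨v, j⟩)) / (1 - 2 * δ)

/-- The truncated fractional number of servers below the node `v`. -/
def count (T : WTree X) (δ : ℝ) (k : ℕ) (z : T.Slot → ℝ) (v : T.V) : ℝ :=
  if h : v ≠ T.root then shrink (T.mass δ z ⟨v, h⟩) else k

theorem count_root (z : T.Slot → ℝ) : T.count δ k z T.root = k := dif_neg (by simp)

theorem count_of_ne (z : T.Slot → ℝ) (v : {v : T.V // v ≠ T.root}) :
    T.count δ k z v = shrink (T.mass δ z v) := dif_pos v.2

theorem mass_nonneg (hδ : δ ≤ 1 / 4) {z : T.Slot → ℝ} (hz1 : ∀ p, z p ≤ 1)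
    (v : {v : T.V // v ≠ T.root}) : 0 ≤ T.mass δ z v :=
  div_nonneg (Finset.sum_nonneg fun j _ => by linarith [hz1 ⟨v, j⟩]) (by linarith)

theorem count_nonneg (hδ : δ ≤ 1 / 4) {z : T.Slot → ℝ} (hz1 : ∀ p, z p ≤ 1) (v : T.V) :
    0 ≤ T.count δ k z v := by
  by_cases h : v = T.root
  · rw [h, count_root]
    positivity
  · rw [count_of_ne z ⟨v, h⟩, ← shrink_zero]
    exact shrink_mono (mass_nonneg hδ hz1 _)

theorem sum_children (T : WTree X) (u : T.V) (f : {v : T.V // v ≠ T.root} → ℝ) (g : T.V → ℝ)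
    (hfg : ∀ v : {v : T.V // v ≠ T.root}, f v = g v) :
    ∑ v : {v : T.V // v ≠ T.root}, (if T.par v = u then f v else 0) =
      ∑ v ∈ Finset.univ.filter (fun v => v ≠ T.root ∧ T.par v = u), g v := by
  rw [← Finset.sum_filter]
  refine Finset.sum_bij (fun v _ => v.1) ?_ ?_ ?_ ?_
  · intro v hv
    simp only [Finset.mem_filter, Finset.mem_univ, true_and] at hv ⊢
    exact ⟨v.2, hv⟩
  · intro a _ b _ h
    exact Subtype.ext h
  · intro v hv
    simp only [Finset.mem_filter, Finset.mem_univ, true_and] at hv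
    exact ⟨⟨v, hv.1⟩, by simpa using hv.2, rfl⟩
  · intro v _
    exact hfg v

/-- The number of servers below a node is at least the number below its children. -/
theorem sum_count_le (hδ0 : 0 < δ) (hδ : δ * (4 * k) ≤ 1) (hk : 1 ≤ k)
    (hkX : k ≤ Fintype.card X) {z : T.Slot → ℝ} (hz1 : ∀ p, z p ≤ 1) (hz : T.Feasible δ k z)
    (u : T.V) :
    ∑ v : {v : T.V // v ≠ T.root}, (if T.par v = u then T.count δ k z v else 0) ≤
      T.count δ k z u := by
  have hk' : (1 : ℝ) ≤ k := by exact_mod_cast hk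
  have hδ4 : δ ≤ 1 / 4 := by nlinarith
  have h12 : 0 < 1 - 2 * δ := by linarith
  by_cases hch : ∃ v, v ≠ T.root ∧ T.par v = u
  swap
  · rw [Finset.sum_eq_zero]
    · exact count_nonneg hδ4 hz1 u
    · intro v _
      exact if_neg fun h => hch ⟨v, v.2, h⟩
  have hfs : ∑ v : {v : T.V // v ≠ T.root}, (if T.par v = u then T.count δ k z v else 0) ≤
      shrink (∑ v : {v : T.V // v ≠ T.root}, if T.par v = u then T.mass δ z v else 0) := by
    refine le_trans (le_of_eq ?_) (sum_shrink_le _ _)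
    refine Finset.sum_congr rfl fun v _ => ?_
    split_ifs
    · exact count_of_ne z v
    · exact shrink_zero.symm
  refine hfs.trans ?_
  set S : Finset T.Slot := Finset.univ.filter fun p => T.par p.1 = u with hS
  have hsum : ∀ f : T.Slot → ℝ, ∑ p ∈ S, f p =
      ∑ v : {v : T.V // v ≠ T.root}, if T.par v = u then ∑ j, f ⟨v, j⟩ else 0 := by
    intro f
    rw [hS, Finset.sum_filter, Fintype.sum_sigma]
    refine Finset.sum_congr rfl fun v _ => ?_
    split_ifs <;> simp
  have hcardR : (S.card : ℝ) = (T.cl u).card := by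
    have h1 := hsum fun _ => 1
    rw [Finset.sum_const, nsmul_eq_mul, mul_one] at h1
    have h2 := T.card_cl u hch Finset.univ
    simp only [Finset.univ_inter] at h2
    rw [h1, T.sum_children u _ (fun v => ((T.cl v).card : ℝ)) (fun v => by simp), ← h2]
    push_cast
    rfl
  have hcard : S.card = (T.cl u).card := by exact_mod_cast hcardR
  have hmass : ∑ v : {v : T.V // v ≠ T.root}, (if T.par v = u then T.mass δ z v else 0) =
      ((T.cl u).card - ∑ p ∈ S, z p) / (1 - 2 * δ) := by
    rw [← hcardR, hsum, eq_div_iff h12.ne', Finset.sum_mul]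
    have h1 := hsum fun _ => 1
    rw [Finset.sum_const, nsmul_eq_mul, mul_one] at h1
    rw [h1, ← Finset.sum_sub_distrib]
    refine Finset.sum_congr rfl fun v _ => ?_
    split_ifs
    · rw [mass, div_mul_cancel₀ _ h12.ne', Finset.sum_sub_distrib]
    · ring
  have hfe := hz u S (fun p hp => (Finset.mem_filter.1 hp).2)
  rw [hmass]
  by_cases hu : u = T.root
  · rw [hu, count_root]
    rw [demand, if_pos hu, hu, slotSum_root, add_zero, stepSum_eq, hcard, hu, T.cl_root,
      Finset.card_univ, Nat.cast_sub hkX] at hfe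
    rw [T.cl_root, Finset.card_univ]
    -- The mass below the root is at most k(1 - δ) before division by 1 - 2δ. As δ * 4k ≤ 1, the
    -- quotient is at most k + 1/2, where `shrink` still has the value k.
    have h1 : ((Fintype.card X : ℝ) - ∑ p ∈ S, z p) / (1 - 2 * δ) ≤ k + 1 / 2 := by
      rw [div_le_iff₀ h12]
      nlinarith
    refine (shrink_mono h1).trans ?_
    rw [shrink_eq_of (n := (k : ℤ)) (by push_cast; linarith) (by push_cast; linarith)]
    push_cast
    rw [max_le_iff]
    constructor <;> linarith
  · rw [count_of_ne z ⟨u, hu⟩]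
    refine shrink_mono ?_
    rw [mass]
    refine div_le_div_of_nonneg_right ?_ h12.le
    rw [demand, if_neg hu, zero_add, T.slotSum_eq z u hu, hcard] at hfe
    simp only [Fin.is_lt, if_true] at hfe
    rw [Finset.sum_sub_distrib]
    simp only [Finset.sum_const, Finset.card_univ, Fintype.card_fin, nsmul_eq_mul, mul_one]
    linarith

/-- The measure on `X` given by the fractional state `z`. -/
def measure (T : WTree X) (δ : ℝ) (k : ℕ) (z : T.Slot → ℝ) (x : X) : ℝ :=
  (if T.pos T.root = x then (k : ℝ) else 0) + ∑ v : {v : T.V // v ≠ T.root}, T.count δ k z v *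
    ((if T.pos v = x then 1 else 0) - (if T.pos (T.par v) = x then 1 else 0))

/-- The servers counted at u but at none of its children stay at `pos u`. This form shows
nonnegativity, whereas the definition displays the measure as a sum of moves along edges, as the
transport bound needs. -/
theorem measure_eq (z : T.Slot → ℝ) (x : X) : T.measure δ k z x =
    ∑ u : T.V, if T.pos u = x then T.count δ k z u -
      ∑ v : {v : T.V // v ≠ T.root}, (if T.par v = u then T.count δ k z v else 0) else 0 := by
  have h1 : ∑ u : T.V, (if T.pos u = x then
      ∑ v : {v : T.V // v ≠ T.root}, (if T.par v = u then T.count δ k z v else 0) else 0) =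
      ∑ v : {v : T.V // v ≠ T.root}, T.count δ k z v * if T.pos (T.par v) = x then 1 else 0 := by
    have : ∀ u : T.V, (if T.pos u = x then ∑ v : {v : T.V // v ≠ T.root},
        (if T.par v = u then T.count δ k z v else 0) else 0) =
        ∑ v : {v : T.V // v ≠ T.root}, if T.par v = u then
          (if T.pos u = x then T.count δ k z v else 0) else 0 := by
      intro u
      split_ifs <;> simp
    rw [Finset.sum_congr rfl fun u _ => this u, Finset.sum_comm]
    refine Finset.sum_congr rfl fun v _ => ?_
    rw [Finset.sum_ite_eq]
    simp
  have h2 : ∑ u : T.V, (if T.pos u = x then T.count δ k z u else 0) =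
      (if T.pos T.root = x then (k : ℝ) else 0) +
      ∑ v : {v : T.V // v ≠ T.root}, T.count δ k z v * if T.pos v = x then 1 else 0 := by
    rw [← Finset.add_sum_erase _ _ (Finset.mem_univ T.root), count_root]
    congr 1
    rw [← Finset.sum_subtype (p := fun v => v ≠ T.root) (Finset.univ.erase T.root) (by simp)
      fun v => T.count δ k z v * if T.pos v = x then 1 else 0]
    refine Finset.sum_congr rfl fun v _ => ?_
    simp
  have h3 : ∀ u : T.V, (if T.pos u = x then T.count δ k z u -
      ∑ v : {v : T.V // v ≠ T.root}, (if T.par v = u then T.count δ k z v else 0) else 0) =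
      (if T.pos u = x then T.count δ k z u else 0) - (if T.pos u = x then
      ∑ v : {v : T.V // v ≠ T.root}, (if T.par v = u then T.count δ k z v else 0) else 0) := by
    intro u
    split_ifs <;> simp
  rw [Finset.sum_congr rfl fun u _ => h3 u, Finset.sum_sub_distrib, h1, h2, measure, add_sub_assoc,
    ← Finset.sum_sub_distrib]
  congr 1
  exact Finset.sum_congr rfl fun v _ => by ring

theorem measure_nonneg (hδ0 : 0 < δ) (hδ : δ * (4 * k) ≤ 1) (hk : 1 ≤ k)
    (hkX : k ≤ Fintype.card X) {z : T.Slot → ℝ} (hz1 : ∀ p, z p ≤ 1) (hz : T.Feasible δ k z)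
    (x : X) : 0 ≤ T.measure δ k z x := by
  rw [measure_eq]
  refine Finset.sum_nonneg fun u _ => ?_
  split_ifs
  · exact sub_nonneg.2 (sum_count_le hδ0 hδ hk hkX hz1 hz u)
  · exact le_rfl

/-- The division by 1 - 2δ in `mass` is made for this: the first slot of the leaf alone contributes
mass 1, and a leaf has no children to pass it on to. -/
theorem one_le_measure (hδ0 : 0 < δ) (hδ : δ * (4 * k) ≤ 1) (hk : 1 ≤ k)
    (hkX : k ≤ Fintype.card X) {z : T.Slot → ℝ} (hz1 : ∀ p, z p ≤ 1) (hz : T.Feasible δ k z)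
    {x : X} (hx : z (T.leafSlot x) ≤ 2 * δ) : 1 ≤ T.measure δ k z x := by
  have hk' : (1 : ℝ) ≤ k := by exact_mod_cast hk
  have hδ4 : δ ≤ 1 / 4 := by nlinarith
  rw [measure_eq]
  refine le_trans ?_ (Finset.single_le_sum (fun u _ => ?_) (Finset.mem_univ (T.leaf x)))
  · rw [if_pos (T.pos_leaf x), Finset.sum_eq_zero, sub_zero, count_of_ne z ⟨_, T.leaf_ne_root x⟩]
    · have h1 : (1 : ℝ) ≤ T.mass δ z ⟨_, T.leaf_ne_root x⟩ := by
        rw [mass, one_le_div (by linarith)]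
        refine le_trans ?_ (Finset.single_le_sum (fun j _ => ?_) (Finset.mem_univ (T.leafSlot x).2))
        · have : z ⟨⟨T.leaf x, T.leaf_ne_root x⟩, (T.leafSlot x).2⟩ = z (T.leafSlot x) := rfl
          rw [this]
          linarith
        · linarith [hz1 ⟨⟨T.leaf x, T.leaf_ne_root x⟩, j⟩]
      refine le_trans ?_ (shrink_mono h1)
      simp [shrink]
    · intro v _
      exact if_neg (T.par_ne_leaf v v.2 x)
  · split_ifs
    · exact sub_nonneg.2 (sum_count_le hδ0 hδ hk hkX hz1 hz u)
    · exact le_rfl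

theorem sum_measure (z : T.Slot → ℝ) (c : Finset X) : ∑ x ∈ c, T.measure δ k z x =
    (if T.pos T.root ∈ c then (k : ℝ) else 0) + ∑ v : {v : T.V // v ≠ T.root}, T.count δ k z v *
    ((if T.pos v ∈ c then 1 else 0) - (if T.pos (T.par v) ∈ c then 1 else 0)) := by
  simp only [measure, Finset.sum_add_distrib]
  rw [Finset.sum_ite_eq, Finset.sum_comm]
  congr 1
  refine Finset.sum_congr rfl fun v _ => ?_
  rw [← Finset.mul_sum, Finset.sum_sub_distrib, Finset.sum_ite_eq, Finset.sum_ite_eq]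

/-- The 4 is the Lipschitz constant 2 of `shrink` times the bound 2 for 1 / (1 - 2δ). -/
theorem abs_count_sub_le (hδ : δ ≤ 1 / 4) (z z' : T.Slot → ℝ) (v : {v : T.V // v ≠ T.root}) :
    |T.count δ k z' v - T.count δ k z v| ≤ 4 * ∑ j, |z' ⟨v, j⟩ - z ⟨v, j⟩| := by
  rw [count_of_ne, count_of_ne]
  refine (abs_shrink_sub_le _ _).trans ?_
  rw [mass, mass, ← sub_div, ← Finset.sum_sub_distrib, abs_div, abs_of_pos (by linarith : 0 < 1 - 2 * δ),
    ← mul_div_assoc, div_le_iff₀ (by linarith)]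
  have h1 : |∑ j, ((1 - z' ⟨v, j⟩) - (1 - z ⟨v, j⟩))| ≤ ∑ j, |z' ⟨v, j⟩ - z ⟨v, j⟩| := by
    refine (Finset.abs_sum_le_sum_abs _ _).trans (le_of_eq ?_)
    refine Finset.sum_congr rfl fun j _ => ?_
    rw [← abs_neg]
    congr 1
    ring
  have h2 : 0 ≤ ∑ j, |z' ⟨v, j⟩ - z ⟨v, j⟩| := Finset.sum_nonneg fun j _ => abs_nonneg _
  nlinarith

end WTree
end KServer
end

noncomputable section
namespace KServer

open scoped Classical

/-! ### Ultrametrics and the rounding of server measures -/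

/-- `e` is an ultrametric with values in the natural numbers. -/
structure IsUltra {X : Type*} (e : X → X → ℕ) : Prop where
  self : ∀ a, e a a = 0
  eq_of : ∀ a b, e a b = 0 → a = b
  symm : ∀ a b, e a b = e b a
  tri : ∀ a b c, e a c ≤ max (e a b) (e b c)

section Ultra

variable {X : Type*} [Fintype X] {e : X → X → ℕ} {k : ℕ}

/-- The metric `2 ^ e - 1`. -/
def rho (e : X → X → ℕ) (a b : X) : ℝ := 2 ^ e a b - 1

/-- The closed ball of radius `i` around `a`. -/
def ball (e : X → X → ℕ) (i : ℕ) (a : X) : Finset X := Finset.univ.filter fun b => e a b ≤ i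

theorem mem_ball {i : ℕ} {a b : X} : b ∈ ball e i a ↔ e a b ≤ i := by simp [ball]

namespace IsUltra

variable (he : IsUltra e)
include he

theorem mem_ball_self (i : ℕ) (a : X) : a ∈ ball e i a := mem_ball.2 (by simp [he.self])

theorem ball_eq {i : ℕ} {a b : X} (h : e a b ≤ i) : ball e i b = ball e i a := by
  ext c
  rw [mem_ball, mem_ball]
  have h1 := he.tri a b c
  have h2 := he.tri b a c
  rw [he.symm b a] at h2
  omega

theorem ball_eq_iff {i : ℕ} {a b : X} : ball e i b = ball e i a ↔ e a b ≤ i :=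
  ⟨fun h => mem_ball.1 (h ▸ he.mem_ball_self i b), he.ball_eq⟩

theorem ball_zero (a : X) : ball e 0 a = {a} := by
  ext b
  rw [mem_ball, Finset.mem_singleton, Nat.le_zero]
  exact ⟨fun h => (he.eq_of a b h).symm, fun h => by rw [h, he.self]⟩

theorem mem_ball_iff_of_le {i j : ℕ} {x x' y : X} (h : e x x' ≤ i) (hij : i ≤ j) :
    x ∈ ball e j y ↔ x' ∈ ball e j y := by
  rw [mem_ball, mem_ball]
  have h1 := he.tri y x x'
  have h2 := he.tri y x' x
  rw [he.symm x' x] at h2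
  omega

omit [Fintype X] in
theorem rho_self (a : X) : rho e a a = 0 := by simp [rho, he.self]

omit [Fintype X] in
theorem rho_tri (a b c : X) : rho e a c ≤ rho e a b + rho e b c := by
  rw [rho, rho, rho]
  have h1 : (1 : ℝ) ≤ 2 ^ e a b := one_le_pow₀ (by norm_num)
  have h2 : (1 : ℝ) ≤ 2 ^ e b c := one_le_pow₀ (by norm_num)
  have h3 : (2 : ℝ) ^ e a c ≤ 2 ^ max (e a b) (e b c) :=
    pow_le_pow_right₀ (by norm_num) (he.tri a b c)
  rcases max_cases (e a b) (e b c) with ⟨h, -⟩ | ⟨h, -⟩ <;> rw [h] at h3 <;> linarith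

omit [Fintype X] he in
theorem rho_nonneg (e : X → X → ℕ) (a b : X) : 0 ≤ rho e a b :=
  sub_nonneg.2 (one_le_pow₀ (by norm_num))

omit [Fintype X] he in
theorem rho_le {a b : X} {i : ℕ} (h : e a b ≤ i) : rho e a b ≤ 2 ^ i - 1 :=
  sub_le_sub_right (pow_le_pow_right₀ (by norm_num) h) _

/-- A ball in which the sum of `f` is positive contains a point such that all smaller balls
around it have the same property. -/
theorem exists_sum_pos (f : X → ℤ) : ∀ (i : ℕ) (a : X), 0 < ∑ x ∈ ball e i a, f x →
    ∃ x ∈ ball e i a, ∀ j ≤ i, 0 < ∑ y ∈ ball e j x, f y := by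
  intro i
  induction i with
  | zero =>
    intro a ha
    refine ⟨a, he.mem_ball_self 0 a, fun j hj => ?_⟩
    rw [Nat.le_zero.1 hj]
    exact ha
  | succ i ih =>
    intro a ha
    have hsum : ∑ c ∈ (ball e (i + 1) a).image (ball e i), ∑ x ∈ c, f x =
        ∑ x ∈ ball e (i + 1) a, f x := by
      rw [← Finset.sum_fiberwise_of_maps_to (t := (ball e (i + 1) a).image (ball e i))
        (g := ball e i) (fun x hx => Finset.mem_image_of_mem _ hx)]
      refine Finset.sum_congr rfl fun c hc => ?_
      obtain ⟨b, hb, rfl⟩ := Finset.mem_image.1 hc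
      refine Finset.sum_congr ?_ fun _ _ => rfl
      ext x
      rw [Finset.mem_filter, he.ball_eq_iff, mem_ball]
      refine ⟨fun h => ⟨?_, h⟩, fun h => h.2⟩
      exact (he.mem_ball_iff_of_le (i := i) h (Nat.le_succ i)).1 hb
    obtain ⟨c, hc, hpos⟩ := Finset.exists_lt_of_sum_lt
      (s := (ball e (i + 1) a).image (ball e i)) (f := fun _ => (0 : ℤ))
      (g := fun c => ∑ x ∈ c, f x) (by rw [hsum]; simpa using ha)
    obtain ⟨b, hb, rfl⟩ := Finset.mem_image.1 hc
    obtain ⟨x, hx, hxj⟩ := ih b hpos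
    have hxb : x ∈ ball e (i + 1) a :=
      (he.mem_ball_iff_of_le (i := i) (mem_ball.1 hx) (Nat.le_succ i)).1 hb
    refine ⟨x, hxb, fun j hj => ?_⟩
    rcases Nat.le_succ_iff.1 hj with h | h
    · exact hxj j h
    · rw [h, he.ball_eq (mem_ball.1 hxb)]
      exact ha

end IsUltra

/-- The number of servers of the state `s` in `c`. -/
def num (s : Fin k → X) (c : Finset X) : ℤ := ((Finset.univ.filter fun i => s i ∈ c).card : ℕ)

/-- The total distance travelled by the servers from the state `s` to the state `t`. -/
def dist' (e : X → X → ℕ) (s t : Fin k → X) : ℝ := ∑ i, rho e (s i) (t i)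

omit [Fintype X] in
theorem num_eq_sum (s : Fin k → X) (c : Finset X) : num s c = ∑ x ∈ c, num s {x} := by
  simp only [num, ← Nat.cast_sum]
  congr 1
  rw [Finset.card_eq_sum_card_fiberwise (f := s) (t := c)]
  · refine Finset.sum_congr rfl fun x hx => ?_
    congr 1
    ext i
    simp only [Finset.mem_filter, Finset.mem_univ, true_and, Finset.mem_singleton]
    exact ⟨fun h => h.2, fun h => ⟨h ▸ hx, h⟩⟩
  · intro i hi
    simpa using hi

omit [Fintype X] in
theorem num_nonneg (s : Fin k → X) (c : Finset X) : 0 ≤ num s c := Nat.cast_nonneg _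

omit [Fintype X] in
/-- Moving a server from `x` to `y`. -/
theorem exists_move (he : IsUltra e) (s : Fin k → X) (x y : X) (h : x = y ∨ 0 < num s {x}) :
    ∃ t : Fin k → X, (∀ c, num t c = num s c + (if y ∈ c then 1 else 0) - if x ∈ c then 1 else 0) ∧
      dist' e s t ≤ rho e x y := by
  rcases h with rfl | h
  · exact ⟨s, fun c => by ring, by simp [dist', he.rho_self]⟩
  · obtain ⟨i, hi⟩ : ∃ i, s i = x := by
      rw [num, Nat.cast_pos, Finset.card_pos] at h
      obtain ⟨i, hi⟩ := h
      exact ⟨i, by simpa using hi⟩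
    refine ⟨Function.update s i y, fun c => ?_, ?_⟩
    · have : ∀ t : Fin k → X, num t c = ∑ j, if t j ∈ c then (1 : ℤ) else 0 := by
        intro t
        rw [num, Finset.sum_boole]
      rw [this, this, ← Finset.add_sum_erase _ _ (Finset.mem_univ i),
        ← Finset.add_sum_erase _ _ (Finset.mem_univ i), hi, Function.update_self]
      have : ∑ j ∈ Finset.univ.erase i, (if Function.update s i y j ∈ c then (1 : ℤ) else 0) =
          ∑ j ∈ Finset.univ.erase i, if s j ∈ c then (1 : ℤ) else 0 :=
        Finset.sum_congr rfl fun j hj => by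
          rw [Function.update_of_ne (Finset.ne_of_mem_erase hj)]
      rw [this]
      ring
    · rw [dist', Finset.sum_eq_single i]
      · rw [Function.update_self, hi]
      · intro j _ hj
        rw [Function.update_of_ne hj, he.rho_self]
      · simp

/-- All states that keep the number of servers in each ball within prescribed bounds. -/
def InBox (e : X → X → ℕ) (lo hi : Finset X → ℤ) (s : Fin k → X) : Prop :=
  ∀ i x, lo (ball e i x) ≤ num s (ball e i x) ∧ num s (ball e i x) ≤ hi (ball e i x)

/-- The total effect on the number of servers at `y` of a list of replacements of states. -/
def netEffect (M : List ((Fin k → X) × (Fin k → X))) (y : X) : ℤ :=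
  (M.map fun q => num q.2 {y} - num q.1 {y}).sum

/-- The total cost of a list of replacements of states. -/
def listCost (e : X → X → ℕ) (M : List ((Fin k → X) × (Fin k → X))) : ℝ :=
  (M.map fun q => dist' e q.1 q.2).sum

theorem inBox_move (he : IsUltra e) {lo hi : Finset X → ℤ} {s t : Fin k → X} (hs : InBox e lo hi s)
    {x y : X} {i : ℕ} (hxy : e x y ≤ i)
    (hnum : ∀ c, num t c = num s c + (if y ∈ c then 1 else 0) - if x ∈ c then 1 else 0)
    (hy : ∀ j < i, x ∉ ball e j y → num s (ball e j y) + 1 ≤ hi (ball e j y))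
    (hx : ∀ j < i, y ∉ ball e j x → lo (ball e j x) ≤ num s (ball e j x) - 1) :
    InBox e lo hi t := by
  intro j u
  rw [hnum]
  have h0 := hs j u
  by_cases hji : i ≤ j
  · have := he.mem_ball_iff_of_le (y := u) hxy hji
    by_cases h1 : x ∈ ball e j u
    · rw [if_pos h1, if_pos (this.1 h1)]
      constructor <;> linarith [h0.1, h0.2]
    · rw [if_neg h1, if_neg fun h => h1 (this.2 h)]
      constructor <;> linarith [h0.1, h0.2]
  · push Not at hji
    by_cases h1 : x ∈ ball e j u <;> by_cases h2 : y ∈ ball e j u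
    · rw [if_pos h1, if_pos h2]
      constructor <;> linarith [h0.1, h0.2]
    · rw [if_pos h1, if_neg h2]
      have hb := he.ball_eq (mem_ball.1 h1)
      have := hx j hji (by rw [hb]; exact h2)
      rw [hb] at this
      constructor <;> linarith [h0.1, h0.2]
    · rw [if_neg h1, if_pos h2]
      have hb := he.ball_eq (mem_ball.1 h2)
      have := hy j hji (by rw [hb]; exact h1)
      rw [hb] at this
      constructor <;> linarith [h0.1, h0.2]
    · rw [if_neg h1, if_neg h2]
      constructor <;> linarith [h0.1, h0.2]

/-! ### Exchanging servers between the states of a family -/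

section Exchange

variable (he : IsUltra e) {lo hi : Finset X → ℤ} {𝒮 : Finset (Fin k → X)}
  (h𝒮 : ∀ s ∈ 𝒮, InBox e lo hi s)
include he h𝒮

/-- Making room for an additional server near `b`. -/
theorem exists_insert (b : X) : ∀ i : ℕ,
    (∀ j ≤ i, ∃ s ∈ 𝒮, num s (ball e j b) + 1 ≤ hi (ball e j b)) →
    ∃ (M : List ((Fin k → X) × (Fin k → X))) (t : Fin k → X) (x : X),
      (∀ q ∈ M, q.1 ∈ 𝒮 ∧ InBox e lo hi q.2) ∧ t ∈ 𝒮 ∧ e b x ≤ i ∧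
      (∀ j ≤ i, num t (ball e j x) + 1 ≤ hi (ball e j x)) ∧
      (∀ y, netEffect M y = (if b = y then 1 else 0) - if x = y then 1 else 0) ∧
      listCost e M ≤ 2 ^ (i + 1) - 2 := by
  intro i
  induction i with
  | zero =>
    intro h
    obtain ⟨s, hs, hsb⟩ := h 0 le_rfl
    refine ⟨[], s, b, by simp, hs, by rw [he.self], fun j hj => ?_, fun y => ?_, by simp [listCost]⟩
    · rw [Nat.le_zero.1 hj]
      exact hsb
    · simp [netEffect]
  | succ i ih =>
    intro h
    obtain ⟨M, t, x, hM, ht, hbx, hroom, hnet, hcost⟩ := ih fun j hj => h j (by omega)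
    have hball : ball e (i + 1) x = ball e (i + 1) b := he.ball_eq (by omega)
    have hpow : (2 : ℝ) ^ (i + 1 + 1) = 2 * 2 ^ (i + 1) := by ring
    have hpow1 : (1 : ℝ) ≤ 2 ^ (i + 1) := one_le_pow₀ (by norm_num)
    by_cases hfull : num t (ball e (i + 1) b) + 1 ≤ hi (ball e (i + 1) b)
    · refine ⟨M, t, x, hM, ht, by omega, fun j hj => ?_, hnet, by linarith⟩
      rcases Nat.le_succ_iff.1 hj with hj | rfl
      · exact hroom j hj
      · rw [hball]
        exact hfull
    -- The insertion at `b` has been reduced to an insertion of `x` into `t`, which is full at level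
    -- i + 1, unlike `t₂`. So `t` with a server added at `x` exceeds `t₂` in this ball, and some
    -- `x'` has a surplus in all smaller balls around it. Moving a server of `t` from `x'` to `x`
    -- leaves the insertion of `x'` into `t₂`. The move costs at most 2 ^ (i + 1) - 1, so the total
    -- bound doubles with each level.
    · obtain ⟨t₂, ht₂, hroom₂⟩ := h (i + 1) le_rfl
      obtain ⟨x', hx', hpos⟩ := he.exists_sum_pos
        (fun y => num t {y} + (if x = y then 1 else 0) - num t₂ {y}) (i + 1) b (by
          rw [Finset.sum_sub_distrib, Finset.sum_add_distrib, ← num_eq_sum, ← num_eq_sum,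
            Finset.sum_ite_eq, if_pos (mem_ball.2 (by omega))]
          omega)
      have hpos' : ∀ j ≤ i + 1, num t₂ (ball e j x') <
          num t (ball e j x') + if x ∈ ball e j x' then 1 else 0 := by
        intro j hj
        have := hpos j hj
        rw [Finset.sum_sub_distrib, Finset.sum_add_distrib, ← num_eq_sum, ← num_eq_sum,
            Finset.sum_ite_eq] at this
        omega
      have hxx' : e x' x ≤ i + 1 := by
        have h1 := he.tri x' b x
        rw [he.symm x' b] at h1
        have := mem_ball.1 hx'
        omega
      obtain ⟨t', hnum, hdist⟩ := exists_move he t x' x (by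
        by_cases hxe : x' = x
        · exact Or.inl hxe
        · right
          have := hpos' 0 (Nat.zero_le _)
          rw [he.ball_zero, if_neg (by simpa using Ne.symm hxe)] at this
          linarith [num_nonneg t₂ {x'}])
      refine ⟨(t, t') :: M, t₂, x', ?_, ht₂, mem_ball.1 hx', ?_, ?_, ?_⟩
      · intro q hq
        rcases List.mem_cons.1 hq with rfl | hq
        · refine ⟨ht, inBox_move he (h𝒮 t ht) hxx' hnum (fun j hj _ => hroom j (by omega)) ?_⟩
          intro j hj hxj
          have h1 := hpos' j (by omega)
          rw [if_neg hxj] at h1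
          have h2 := (h𝒮 t₂ ht₂ j x').1
          omega
        · exact hM q hq
      · intro j hj
        rcases Nat.le_succ_iff.1 hj with hj | rfl
        · have h1 := hpos' j (by omega)
          by_cases hxj : x ∈ ball e j x'
          · rw [if_pos hxj] at h1
            have := hroom j hj
            rw [he.ball_eq (mem_ball.1 hxj)] at this
            omega
          · rw [if_neg hxj] at h1
            have h2 := (h𝒮 t ht j x').2
            omega
        · rw [he.ball_eq (mem_ball.1 hx')]
          exact hroom₂
      · intro y
        have := hnet y
        rw [netEffect] at this ⊢
        rw [List.map_cons, List.sum_cons, this, hnum]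
        simp only [Finset.mem_singleton]
        ring
      · have h1 := IsUltra.rho_le hxx'
        rw [listCost] at hcost ⊢
        rw [List.map_cons, List.sum_cons]
        simp only
        linarith

/-- Making it possible to remove a server near `a`. -/
theorem exists_remove (hlo : ∀ c, 0 ≤ lo c) (a : X) : ∀ i : ℕ,
    (∀ j ≤ i, ∃ s ∈ 𝒮, lo (ball e j a) ≤ num s (ball e j a) - 1) →
    ∃ (M : List ((Fin k → X) × (Fin k → X))) (t : Fin k → X) (x : X),
      (∀ q ∈ M, q.1 ∈ 𝒮 ∧ InBox e lo hi q.2) ∧ t ∈ 𝒮 ∧ e a x ≤ i ∧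
      (∀ j ≤ i, lo (ball e j x) ≤ num t (ball e j x) - 1) ∧
      (∀ y, netEffect M y = (if x = y then 1 else 0) - if a = y then 1 else 0) ∧
      listCost e M ≤ 2 ^ (i + 1) - 2 := by
  intro i
  induction i with
  | zero =>
    intro h
    obtain ⟨s, hs, hsb⟩ := h 0 le_rfl
    refine ⟨[], s, a, by simp, hs, by rw [he.self], fun j hj => ?_, fun y => ?_, by simp [listCost]⟩
    · rw [Nat.le_zero.1 hj]
      exact hsb
    · simp [netEffect]
  | succ i ih =>
    intro h
    obtain ⟨M, t, x, hM, ht, hbx, hroom, hnet, hcost⟩ := ih fun j hj => h j (by omega)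
    have hball : ball e (i + 1) x = ball e (i + 1) a := he.ball_eq (by omega)
    have hpow : (2 : ℝ) ^ (i + 1 + 1) = 2 * 2 ^ (i + 1) := by ring
    have hpow1 : (1 : ℝ) ≤ 2 ^ (i + 1) := one_le_pow₀ (by norm_num)
    by_cases hfull : lo (ball e (i + 1) a) ≤ num t (ball e (i + 1) a) - 1
    · refine ⟨M, t, x, hM, ht, by omega, fun j hj => ?_, hnet, by linarith⟩
      rcases Nat.le_succ_iff.1 hj with hj | rfl
      · exact hroom j hj
      · rw [hball]
        exact hfull
    -- Mirror image of the insertion: `t` can spare no server at level i + 1 but `t₂` can. The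
    -- server of `t` at `x` moves to a point `x'` where `t₂` together with `x` has a surplus, and
    -- the removal of `x'` from `t₂` remains.
    · obtain ⟨t₂, ht₂, hroom₂⟩ := h (i + 1) le_rfl
      obtain ⟨x', hx', hpos⟩ := he.exists_sum_pos
        (fun y => num t₂ {y} + (if x = y then 1 else 0) - num t {y}) (i + 1) a (by
          rw [Finset.sum_sub_distrib, Finset.sum_add_distrib, ← num_eq_sum, ← num_eq_sum,
            Finset.sum_ite_eq, if_pos (mem_ball.2 (by omega))]
          omega)
      have hpos' : ∀ j ≤ i + 1, num t (ball e j x') <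
          num t₂ (ball e j x') + if x ∈ ball e j x' then 1 else 0 := by
        intro j hj
        have := hpos j hj
        rw [Finset.sum_sub_distrib, Finset.sum_add_distrib, ← num_eq_sum, ← num_eq_sum,
            Finset.sum_ite_eq] at this
        omega
      have hxx' : e x x' ≤ i + 1 := by
        have h1 := he.tri x a x'
        rw [he.symm x a] at h1
        have := mem_ball.1 hx'
        omega
      obtain ⟨t', hnum, hdist⟩ := exists_move he t x x' (by
        right
        have := hroom 0 (Nat.zero_le _)
        rw [he.ball_zero] at this
        linarith [hlo {x}])
      refine ⟨(t, t') :: M, t₂, x', ?_, ht₂, mem_ball.1 hx', ?_, ?_, ?_⟩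
      · intro q hq
        rcases List.mem_cons.1 hq with rfl | hq
        · refine ⟨ht, inBox_move he (h𝒮 t ht) hxx' hnum ?_ (fun j hj _ => hroom j (by omega))⟩
          intro j hj hxj
          have h1 := hpos' j (by omega)
          rw [if_neg hxj] at h1
          have h2 := (h𝒮 t₂ ht₂ j x').2
          omega
        · exact hM q hq
      · intro j hj
        rcases Nat.le_succ_iff.1 hj with hj | rfl
        · have h1 := hpos' j (by omega)
          by_cases hxj : x ∈ ball e j x'
          · rw [if_pos hxj] at h1
            have := hroom j hj
            rw [he.ball_eq (mem_ball.1 hxj)] at this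
            omega
          · rw [if_neg hxj] at h1
            have h2 := (h𝒮 t ht j x').1
            omega
        · rw [he.ball_eq (mem_ball.1 hx')]
          exact hroom₂
      · intro y
        have := hnet y
        rw [netEffect] at this ⊢
        rw [List.map_cons, List.sum_cons, this, hnum]
        simp only [Finset.mem_singleton]
        ring
      · have h1 := IsUltra.rho_le hxx'
        rw [listCost] at hcost ⊢
        rw [List.map_cons, List.sum_cons]
        simp only
        linarith

/-- Replacements of states whose total effect is to move a server from `a` to `b`. -/
theorem exists_exchange (hlo : ∀ c, 0 ≤ lo c) (hbox : ∀ c, hi c ≤ lo c + 1) {a b : X} (hab : a ≠ b)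
    (hb : ∀ j < e a b, ∃ s ∈ 𝒮, num s (ball e j b) + 1 ≤ hi (ball e j b))
    (ha : ∀ j < e a b, ∃ s ∈ 𝒮, lo (ball e j a) ≤ num s (ball e j a) - 1) :
    ∃ M : List ((Fin k → X) × (Fin k → X)), (∀ q ∈ M, q.1 ∈ 𝒮 ∧ InBox e lo hi q.2) ∧
      (∀ y, netEffect M y = (if b = y then 1 else 0) - if a = y then 1 else 0) ∧
      listCost e M ≤ 4 * rho e a b := by
  obtain ⟨i, hi'⟩ : ∃ i, e a b = i + 1 :=
    ⟨e a b - 1, by have : e a b ≠ 0 := fun h => hab (he.eq_of a b h); omega⟩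
  rw [hi'] at ha hb
  obtain ⟨M₁, t₁, x₁, hM₁, ht₁, hx₁, hroom₁, hnet₁, hcost₁⟩ :=
    exists_insert he h𝒮 b i fun j hj => hb j (by omega)
  obtain ⟨M₂, t₂, x₂, hM₂, ht₂, hx₂, hroom₂, hnet₂, hcost₂⟩ :=
    exists_remove he h𝒮 hlo a i fun j hj => ha j (by omega)
  have hax₁ : e a x₁ ≤ i + 1 := by
    have := he.tri a b x₁
    omega
  have hx₂pos : 0 < num t₂ {x₂} := by
    have := hroom₂ 0 (Nat.zero_le _)
    rw [he.ball_zero] at this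
    linarith [hlo {x₂}]
  -- It remains to insert `x₁` into `t₁` and to remove `x₂` from `t₂`. As hi ≤ lo + 1, in the ball
  -- of radius e a b the state `t₁` plus `x₁` has more servers than `t₂` minus `x₂`. At a point `x'`
  -- of surplus, `t₁` moves a server from `x'` to `x₁` and `t₂` moves one from `x₂` to `x'`. Balls
  -- of radius at least e a b do not notice these moves.
  obtain ⟨x', hx', hpos⟩ := he.exists_sum_pos
    (fun y => num t₁ {y} + (if x₁ = y then 1 else 0) - (num t₂ {y} - if x₂ = y then 1 else 0))
    (i + 1) a (by
      rw [Finset.sum_sub_distrib, Finset.sum_add_distrib, Finset.sum_sub_distrib, ← num_eq_sum,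
        ← num_eq_sum, Finset.sum_ite_eq, Finset.sum_ite_eq, if_pos (mem_ball.2 hax₁),
        if_pos (mem_ball.2 (by omega))]
      have h1 := (h𝒮 t₁ ht₁ (i + 1) a).1
      have h2 := (h𝒮 t₂ ht₂ (i + 1) a).2
      have h3 := hbox (ball e (i + 1) a)
      omega)
  have hpos' : ∀ j ≤ i + 1, num t₂ (ball e j x') - (if x₂ ∈ ball e j x' then 1 else 0) <
      num t₁ (ball e j x') + if x₁ ∈ ball e j x' then 1 else 0 := by
    intro j hj
    have := hpos j hj
    rw [Finset.sum_sub_distrib, Finset.sum_add_distrib, Finset.sum_sub_distrib, ← num_eq_sum,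
        ← num_eq_sum, Finset.sum_ite_eq, Finset.sum_ite_eq] at this
    omega
  have hx'a := mem_ball.1 hx'
  have hd₁ : e x' x₁ ≤ i + 1 := by
    have h1 := he.tri x' a x₁
    rw [he.symm x' a] at h1
    omega
  have hd₂ : e x₂ x' ≤ i + 1 := by
    have h1 := he.tri x₂ a x'
    rw [he.symm x₂ a] at h1
    omega
  obtain ⟨t₁', hnum₁, hdist₁⟩ := exists_move he t₁ x' x₁ (by
    by_cases hxe : x' = x₁
    · exact Or.inl hxe
    · right
      have := hpos' 0 (Nat.zero_le _)
      rw [he.ball_zero, if_neg (c := x₁ ∈ _) (by simpa using Ne.symm hxe)] at this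
      by_cases hx₂e : x₂ = x'
      · rw [if_pos (by simpa using hx₂e), ← hx₂e] at this
        rw [← hx₂e]
        linarith
      · rw [if_neg (by simpa using hx₂e)] at this
        linarith [num_nonneg t₂ {x'}])
  obtain ⟨t₂', hnum₂, hdist₂⟩ := exists_move he t₂ x₂ x' (Or.inr hx₂pos)
  refine ⟨(t₁, t₁') :: (t₂, t₂') :: (M₁ ++ M₂), ?_, ?_, ?_⟩
  · intro q hq
    rcases List.mem_cons.1 hq with rfl | hq
    · refine ⟨ht₁, inBox_move he (h𝒮 t₁ ht₁) hd₁ hnum₁ (fun j hj _ => hroom₁ j (by omega)) ?_⟩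
      intro j hj hxj
      have h1 := hpos' j (by omega)
      rw [if_neg hxj] at h1
      by_cases hx₂j : x₂ ∈ ball e j x'
      · rw [if_pos hx₂j] at h1
        have h2 := hroom₂ j (by omega)
        rw [he.ball_eq (mem_ball.1 hx₂j)] at h2
        omega
      · rw [if_neg hx₂j] at h1
        have h2 := (h𝒮 t₂ ht₂ j x').1
        omega
    rcases List.mem_cons.1 hq with rfl | hq
    · refine ⟨ht₂, inBox_move he (h𝒮 t₂ ht₂) hd₂ hnum₂ ?_ (fun j hj _ => hroom₂ j (by omega))⟩
      intro j hj hxj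
      have h1 := hpos' j (by omega)
      rw [if_neg hxj] at h1
      by_cases hx₁j : x₁ ∈ ball e j x'
      · rw [if_pos hx₁j] at h1
        have h2 := hroom₁ j (by omega)
        rw [he.ball_eq (mem_ball.1 hx₁j)] at h2
        omega
      · rw [if_neg hx₁j] at h1
        have h2 := (h𝒮 t₁ ht₁ j x').2
        omega
    rcases List.mem_append.1 hq with hq | hq
    · exact hM₁ q hq
    · exact hM₂ q hq
  · intro y
    have h1 := hnet₁ y
    have h2 := hnet₂ y
    rw [netEffect] at h1 h2 ⊢
    rw [List.map_cons, List.sum_cons, List.map_cons, List.sum_cons, List.map_append,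
      List.sum_append, h1, h2, hnum₁, hnum₂]
    simp only [Finset.mem_singleton]
    ring
  · have h1 := IsUltra.rho_le hd₁
    have h2 := IsUltra.rho_le hd₂
    rw [listCost] at hcost₁ hcost₂ ⊢
    rw [List.map_cons, List.sum_cons, List.map_cons, List.sum_cons, List.map_append,
      List.sum_append, rho, hi']
    simp only
    linarith

end Exchange

end Ultra

end KServer
end

noncomputable section
namespace KServer

open scoped Classical

/-! ### Moving a random state along with a measure -/

section Rounding

variable {X : Type*} [Fintype X] {e : X → X → ℕ} {k : ℕ}

omit [Fintype X] in
theorem dist'_self (he : IsUltra e) (s : Fin k → X) : dist' e s s = 0 := by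
  simp [dist', he.rho_self]

omit [Fintype X] in
theorem dist'_nonneg (e : X → X → ℕ) (s t : Fin k → X) : 0 ≤ dist' e s t :=
  Finset.sum_nonneg fun _ _ => IsUltra.rho_nonneg e _ _

omit [Fintype X] in
theorem dist'_tri (he : IsUltra e) (s t u : Fin k → X) : dist' e s u ≤ dist' e s t + dist' e t u := by
  rw [dist', dist', dist', ← Finset.sum_add_distrib]
  exact Finset.sum_le_sum fun i _ => he.rho_tri _ _ _

/-- The distribution `μ` on states is a balanced rounding of the measure `m`: the expected number
of servers in each ball is its measure, and almost surely it is the measure rounded up or down. -/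
structure Balanced (e : X → X → ℕ) (m : X → ℝ) (μ : (Fin k → X) → ℝ) : Prop where
  nonneg : ∀ s, 0 ≤ μ s
  sum_eq : ∑ s, μ s = 1
  mean : ∀ x, ∑ s, μ s * num s {x} = m x
  dev : ∀ i x (j : ℤ), ∑ s, μ s * |(num s (ball e i x) : ℝ) - j| = |∑ y ∈ ball e i x, m y - j|

namespace Balanced

variable {m : X → ℝ} {μ : (Fin k → X) → ℝ}

theorem sum_mul_num (hmean : ∀ x, ∑ s, μ s * num s {x} = m x) (c : Finset X) :
    ∑ s, μ s * num s c = ∑ y ∈ c, m y := by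
  simp_rw [← hmean]
  rw [Finset.sum_comm]
  refine Finset.sum_congr rfl fun s _ => ?_
  rw [num_eq_sum, Int.cast_sum, Finset.mul_sum]

theorem measure_nonneg (h : Balanced e m μ) (x : X) : 0 ≤ m x := by
  rw [← h.mean]
  exact Finset.sum_nonneg fun s _ => mul_nonneg (h.nonneg s) (Int.cast_nonneg (num_nonneg _ _))

/-- The deviation identity at the floor says that the number minus the floor has the same mean as
its absolute value, so it is almost surely nonnegative. -/
theorem floor_le (h : Balanced e m μ) {s : Fin k → X} (hs : 0 < μ s) (i : ℕ) (x : X) :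
    ⌊∑ y ∈ ball e i x, m y⌋ ≤ num s (ball e i x) := by
  have h1 := h.dev i x ⌊∑ y ∈ ball e i x, m y⌋
  have hm := sum_mul_num h.mean (ball e i x)
  rw [abs_of_nonneg (sub_nonneg.2 (Int.floor_le _))] at h1
  have h2 : ∑ s, μ s * (|(num s (ball e i x) : ℝ) - ⌊∑ y ∈ ball e i x, m y⌋| -
      ((num s (ball e i x) : ℝ) - ⌊∑ y ∈ ball e i x, m y⌋)) = 0 := by
    simp_rw [mul_sub, Finset.sum_sub_distrib, ← Finset.sum_mul, h.sum_eq, hm, h1]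
    ring
  rw [Finset.sum_eq_zero_iff_of_nonneg fun s _ =>
    mul_nonneg (h.nonneg s) (sub_nonneg.2 (le_abs_self _))] at h2
  have h3 := (mul_eq_zero.1 (h2 s (Finset.mem_univ s))).resolve_left hs.ne'
  have h4 := abs_nonneg ((num s (ball e i x) : ℝ) - ⌊∑ y ∈ ball e i x, m y⌋)
  exact_mod_cast (by linarith : (⌊∑ y ∈ ball e i x, m y⌋ : ℝ) ≤ num s (ball e i x))

theorem le_ceil (h : Balanced e m μ) {s : Fin k → X} (hs : 0 < μ s) (i : ℕ) (x : X) :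
    num s (ball e i x) ≤ ⌈∑ y ∈ ball e i x, m y⌉ := by
  have h1 := h.dev i x ⌈∑ y ∈ ball e i x, m y⌉
  have hm := sum_mul_num h.mean (ball e i x)
  rw [abs_of_nonpos (sub_nonpos.2 (Int.le_ceil _))] at h1
  have h2 : ∑ s, μ s * (|(num s (ball e i x) : ℝ) - ⌈∑ y ∈ ball e i x, m y⌉| +
      ((num s (ball e i x) : ℝ) - ⌈∑ y ∈ ball e i x, m y⌉)) = 0 := by
    simp_rw [mul_add, Finset.sum_add_distrib, mul_sub, Finset.sum_sub_distrib, ← Finset.sum_mul,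
      h.sum_eq, hm]
    linarith
  rw [Finset.sum_eq_zero_iff_of_nonneg fun s _ =>
    mul_nonneg (h.nonneg s) (by linarith [neg_abs_le ((num s (ball e i x) : ℝ) -
      ⌈∑ y ∈ ball e i x, m y⌉)])] at h2
  have h3 := (mul_eq_zero.1 (h2 s (Finset.mem_univ s))).resolve_left hs.ne'
  have h4 := abs_nonneg ((num s (ball e i x) : ℝ) - ⌈∑ y ∈ ball e i x, m y⌉)
  exact_mod_cast (by linarith : (num s (ball e i x) : ℝ) ≤ ⌈∑ y ∈ ball e i x, m y⌉)

/-- No integer lies strictly between the two bounds of the box. The number minus j therefore has a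
constant sign, and the absolute value commutes with the mean. -/
theorem of_box {lo hi : Finset X → ℤ} (hbox : ∀ c, hi c ≤ lo c + 1) (h0 : ∀ s, 0 ≤ μ s)
    (h1 : ∑ s, μ s = 1) (hmean : ∀ x, ∑ s, μ s * num s {x} = m x)
    (hμ : ∀ s, 0 < μ s → InBox e lo hi s) : Balanced e m μ := by
  refine ⟨h0, h1, hmean, fun i x j => ?_⟩
  rw [← sum_mul_num hmean]
  have key : ∀ σ : ℝ, (∀ s, 0 < μ s → 0 ≤ σ * ((num s (ball e i x) : ℝ) - j)) → |σ| = 1 →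
      ∑ s, μ s * |(num s (ball e i x) : ℝ) - j| = |∑ s, μ s * num s (ball e i x) - j| := by
    intro σ hσ hσ1
    have h2 : ∑ s, μ s * num s (ball e i x) - j = ∑ s, μ s * ((num s (ball e i x) : ℝ) - j) := by
      simp_rw [mul_sub, Finset.sum_sub_distrib, ← Finset.sum_mul, h1, one_mul]
    have h3 : ∀ s, μ s * |(num s (ball e i x) : ℝ) - j| =
        σ * (μ s * ((num s (ball e i x) : ℝ) - j)) := by
      intro s
      rcases (h0 s).eq_or_lt with h | h
      · rw [← h]; ring
      · have := abs_of_nonneg (hσ s h)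
        rw [abs_mul, hσ1, one_mul] at this
        rw [this]; ring
    have h4 : 0 ≤ σ * ∑ s, μ s * ((num s (ball e i x) : ℝ) - j) := by
      rw [Finset.mul_sum]
      refine Finset.sum_nonneg fun s _ => ?_
      rw [← h3]
      exact mul_nonneg (h0 s) (abs_nonneg _)
    have h5 := abs_of_nonneg h4
    rw [abs_mul, hσ1, one_mul] at h5
    rw [h2, h5, Finset.mul_sum]
    exact Finset.sum_congr rfl fun s _ => h3 s
  by_cases hj : j ≤ lo (ball e i x)
  · refine key 1 (fun s hs => ?_) (by simp)
    rw [one_mul, sub_nonneg]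
    exact_mod_cast hj.trans (hμ s hs i x).1
  · refine key (-1) (fun s hs => ?_) (by simp)
    have h2 := (hμ s hs i x).2
    have h3 := hbox (ball e i x)
    have h4 : (num s (ball e i x) : ℝ) ≤ j := by exact_mod_cast (by omega)
    linarith

theorem exists_num_le (h : Balanced e m μ) (c : Finset X) :
    ∃ s, 0 < μ s ∧ num s c ≤ ⌊∑ y ∈ c, m y⌋ := by
  by_contra! hc
  have h1 : ∑ s, μ s * (⌊∑ y ∈ c, m y⌋ + 1) ≤ ∑ s, μ s * (num s c : ℝ) := by
    refine Finset.sum_le_sum fun s _ => ?_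
    rcases (h.nonneg s).eq_or_lt with h0 | h0
    · simp [← h0]
    · exact mul_le_mul_of_nonneg_left (by exact_mod_cast hc s h0) h0.le
  rw [← Finset.sum_mul, h.sum_eq, one_mul, sum_mul_num h.mean] at h1
  linarith [Int.lt_floor_add_one (∑ y ∈ c, m y)]

theorem exists_le_num (h : Balanced e m μ) (c : Finset X) :
    ∃ s, 0 < μ s ∧ ⌈∑ y ∈ c, m y⌉ ≤ num s c := by
  by_contra! hc
  have h1 : ∑ s, μ s * (num s c : ℝ) ≤ ∑ s, μ s * ((⌈∑ y ∈ c, m y⌉ : ℝ) - 1) := by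
    refine Finset.sum_le_sum fun s _ => ?_
    rcases (h.nonneg s).eq_or_lt with h0 | h0
    · simp [← h0]
    · refine mul_le_mul_of_nonneg_left ?_ h0.le
      rw [le_sub_iff_add_le]
      exact_mod_cast hc s h0
  rw [← Finset.sum_mul, h.sum_eq, one_mul, sum_mul_num h.mean] at h1
  linarith [Int.ceil_lt_add_one (∑ y ∈ c, m y)]

end Balanced

/-- `K` moves the distribution `μ` on states to `μ'` at expected cost at most `C`. -/
structure IsStep (e : X → X → ℕ) (K : (Fin k → X) → (Fin k → X) → ℝ) (μ μ' : (Fin k → X) → ℝ)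
    (C : ℝ) : Prop where
  nonneg : ∀ s s', 0 ≤ K s s'
  sum_eq : ∀ s, ∑ s', K s s' = 1
  push : ∀ s', ∑ s, μ s * K s s' = μ' s'
  cost : ∑ s, ∑ s', μ s * K s s' * dist' e s s' ≤ C

theorem IsStep.refl (he : IsUltra e) (μ : (Fin k → X) → ℝ) :
    IsStep e (fun s s' => if s = s' then 1 else 0) μ μ 0 where
  nonneg s s' := by positivity
  sum_eq s := by simp
  push s' := by simp
  cost := by simp [dist'_self he]

theorem IsStep.trans (he : IsUltra e) {K K' : (Fin k → X) → (Fin k → X) → ℝ}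
    {μ μ' μ'' : (Fin k → X) → ℝ} {C C' : ℝ} (hμ : ∀ s, 0 ≤ μ s)
    (h : IsStep e K μ μ' C) (h' : IsStep e K' μ' μ'' C') :
    IsStep e (fun s u => ∑ t, K s t * K' t u) μ μ'' (C + C') where
  nonneg s s' := Finset.sum_nonneg fun t _ => mul_nonneg (h.nonneg _ _) (h'.nonneg _ _)
  sum_eq s := by
    rw [Finset.sum_comm]
    simp_rw [← Finset.mul_sum, h'.sum_eq, mul_one, h.sum_eq]
  push u := by
    simp_rw [Finset.mul_sum]
    rw [Finset.sum_comm, ← h'.push]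
    refine Finset.sum_congr rfl fun t _ => ?_
    rw [← h.push, Finset.sum_mul]
    exact Finset.sum_congr rfl fun s _ => by ring
  cost := by
    have h1 : ∑ s, ∑ u, μ s * (∑ t, K s t * K' t u) * dist' e s u ≤
        ∑ s, ∑ u, ∑ t, (μ s * K s t * dist' e s t * K' t u + μ s * K s t * (K' t u * dist' e t u)) := by
      refine Finset.sum_le_sum fun s _ => Finset.sum_le_sum fun u _ => ?_
      rw [Finset.mul_sum, Finset.sum_mul]
      refine Finset.sum_le_sum fun t _ => ?_
      have h2 := mul_le_mul_of_nonneg_left (dist'_tri he s t u)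
        (mul_nonneg (hμ s) (mul_nonneg (h.nonneg s t) (h'.nonneg t u)))
      linarith
    have h2 : ∑ s, ∑ u, ∑ t, μ s * K s t * dist' e s t * K' t u ≤ C := by
      refine le_of_eq_of_le (Finset.sum_congr rfl fun s _ => ?_) h.cost
      rw [Finset.sum_comm]
      refine Finset.sum_congr rfl fun t _ => ?_
      rw [← Finset.mul_sum, h'.sum_eq, mul_one]
    have h3 : ∑ s, ∑ u, ∑ t, μ s * K s t * (K' t u * dist' e t u) ≤ C' := by
      refine le_of_eq_of_le ?_ h'.cost
      calc ∑ s, ∑ u, ∑ t, μ s * K s t * (K' t u * dist' e t u)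
          = ∑ s, ∑ t, ∑ u, μ s * K s t * (K' t u * dist' e t u) :=
            Finset.sum_congr rfl fun s _ => Finset.sum_comm
        _ = ∑ t, ∑ s, ∑ u, μ s * K s t * (K' t u * dist' e t u) := Finset.sum_comm
        _ = ∑ t, ∑ u, μ' t * K' t u * dist' e t u := by
            refine Finset.sum_congr rfl fun t _ => ?_
            rw [Finset.sum_comm]
            refine Finset.sum_congr rfl fun u _ => ?_
            rw [← Finset.sum_mul, h.push]
            ring
    simp_rw [Finset.sum_add_distrib] at h1
    linarith

theorem IsStep.mono {K : (Fin k → X) → (Fin k → X) → ℝ} {μ μ' : (Fin k → X) → ℝ} {C C' : ℝ}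
    (h : IsStep e K μ μ' C) (hC : C ≤ C') : IsStep e K μ μ' C' :=
  ⟨h.nonneg, h.sum_eq, h.push, h.cost.trans hC⟩

/-- The kernel that performs each of the replacements `p i → q i` with total probability `t`. -/
def replaceKernel {N : ℕ} (p q : Fin N → Fin k → X) (μ : (Fin k → X) → ℝ) (t : ℝ)
    (s s' : Fin k → X) : ℝ :=
  (if s = s' then 1 else 0) +
    ∑ i, if p i = s then t / μ s * ((if q i = s' then 1 else 0) - if s = s' then 1 else 0) else 0

/-- With F depending on the target only, this computes the new law; with F = `dist'` it computes the
cost. -/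
theorem sum_replaceKernel {N : ℕ} {p q : Fin N → Fin k → X} {μ : (Fin k → X) → ℝ} {t : ℝ}
    (hp : ∀ i, 0 < μ (p i)) (F : (Fin k → X) → (Fin k → X) → ℝ) :
    ∑ s, ∑ s', μ s * replaceKernel p q μ t s s' * F s s' =
      ∑ s, μ s * F s s + t * ∑ i, (F (p i) (q i) - F (p i) (p i)) := by
  have h1 : ∀ s, ∑ s', μ s * replaceKernel p q μ t s s' * F s s' =
      μ s * F s s + ∑ i, if p i = s then t * (F s (q i) - F s s) else 0 := by
    intro s
    simp_rw [replaceKernel, mul_add, add_mul, Finset.sum_add_distrib]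
    congr 1
    · simp
    · simp_rw [Finset.mul_sum, Finset.sum_mul]
      rw [Finset.sum_comm]
      refine Finset.sum_congr rfl fun i _ => ?_
      by_cases h : p i = s
      · simp_rw [if_pos h]
        have hs : μ s ≠ 0 := h ▸ (hp i).ne'
        have h2 : ∀ s', μ s * (t / μ s * ((if q i = s' then 1 else 0) - if s = s' then 1 else 0)) *
            F s s' = t * ((if q i = s' then F s s' else 0) - if s = s' then F s s' else 0) := by
          intro s'
          rw [← mul_assoc, mul_div_cancel₀ _ hs, mul_assoc, sub_mul]
          simp only [ite_mul, one_mul, zero_mul]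
        simp_rw [h2, ← Finset.mul_sum, Finset.sum_sub_distrib]
        simp
      · simp [h]
  simp_rw [h1, Finset.sum_add_distrib]
  congr 1
  rw [Finset.sum_comm, Finset.mul_sum]
  exact Finset.sum_congr rfl fun i _ => by simp

/-- The measure `m` after moving a mass `t` from `a` to `b`. -/
def moveMass (m : X → ℝ) (a b : X) (t : ℝ) (x : X) : ℝ :=
  m x + t * ((if b = x then 1 else 0) - if a = x then 1 else 0)

omit [Fintype X] in
theorem moveMass_moveMass (m : X → ℝ) (a b : X) (t u : ℝ) :
    moveMass (moveMass m a b t) a b u = moveMass m a b (t + u) := by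
  funext x
  simp only [moveMass]
  ring

/-- The replacements of `exists_exchange`, each performed with total probability t, move the mass t
from a to b in the mean. Here t must be small enough for the states being replaced to have that much
probability. -/
theorem exists_isStep_local (he : IsUltra e) {m : X → ℝ} {μ : (Fin k → X) → ℝ} (h : Balanced e m μ)
    {a b : X} (hab : a ≠ b) (ha : 0 < m a) :
    ∃ ε > 0, ∀ t, 0 ≤ t → t ≤ ε → ∃ K μ', Balanced e (moveMass m a b t) μ' ∧
      IsStep e K μ μ' (4 * rho e a b * t) := by
  set M : Finset X → ℝ := fun c => ∑ y ∈ c, m y with hM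
  -- Balls that contain only `a` lose mass and balls that contain only `b` gain mass. At an integer
  -- `M c` the box has to open on that side; otherwise `⌈M c⌉ - 1` and `⌊M c⌋ + 1` are just the
  -- floor and the ceiling.
  set lo : Finset X → ℤ := fun c => if a ∈ c ∧ b ∉ c then ⌈M c⌉ - 1 else ⌊M c⌋ with hlo
  set hi : Finset X → ℤ := fun c => if b ∈ c ∧ a ∉ c then ⌊M c⌋ + 1 else ⌈M c⌉ with hhi
  have hfc : ∀ c, ⌊M c⌋ ≤ ⌈M c⌉ ∧ ⌈M c⌉ ≤ ⌊M c⌋ + 1 := fun c =>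
    ⟨Int.floor_le_ceil _, Int.ceil_le_floor_add_one _⟩
  have hbox : ∀ c, hi c ≤ lo c + 1 := by
    intro c
    have := hfc c
    simp only [hlo, hhi]
    split_ifs with h1 h2 <;> first | (exfalso; tauto) | omega
  have hlo0 : ∀ c, 0 ≤ lo c := by
    intro c
    simp only [hlo]
    split_ifs with h1
    · have : 0 < M c := ha.trans_le (Finset.single_le_sum (f := m)
        (fun x _ => h.measure_nonneg x) h1.1)
      have := Int.ceil_pos.2 this
      omega
    · exact Int.floor_nonneg.2 (Finset.sum_nonneg fun x _ => h.measure_nonneg x)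
  have hS : ∀ s ∈ Finset.univ.filter (fun s => 0 < μ s), InBox e lo hi s := by
    intro s hs i x
    rw [Finset.mem_filter] at hs
    have h1 := h.floor_le hs.2 i x
    have h2 := h.le_ceil hs.2 i x
    have h3 := hfc (ball e i x)
    simp only [hM] at h3
    simp only [hlo, hhi]
    constructor <;> split_ifs <;> simp only [hM] <;> omega
  obtain ⟨L, hL, hnet, hcost⟩ := exists_exchange he hS hlo0 hbox hab
    (fun j hj => by
      obtain ⟨s, hs, hsn⟩ := h.exists_num_le (ball e j b)
      refine ⟨s, by simpa using hs, ?_⟩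
      have h1 : a ∉ ball e j b := by rw [mem_ball, he.symm]; omega
      simp only [hhi, if_pos (show b ∈ ball e j b ∧ a ∉ ball e j b from ⟨he.mem_ball_self j b, h1⟩)]
      simp only [hM]
      omega)
    (fun j hj => by
      obtain ⟨s, hs, hsn⟩ := h.exists_le_num (ball e j a)
      refine ⟨s, by simpa using hs, ?_⟩
      have h1 : b ∉ ball e j a := by rw [mem_ball]; omega
      simp only [hlo, if_pos (show a ∈ ball e j a ∧ b ∉ ball e j a from ⟨he.mem_ball_self j a, h1⟩)]
      simp only [hM]
      omega)
  set p : Fin L.length → Fin k → X := fun i => L[i].1 with hp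
  set q : Fin L.length → Fin k → X := fun i => L[i].2 with hq
  have hp0 : ∀ i, 0 < μ (p i) := fun i =>
    (Finset.mem_filter.1 (hL _ (List.getElem_mem (l := L) i.2)).1).2
  have hqbox : ∀ i, InBox e lo hi (q i) := fun i => (hL _ (List.getElem_mem (l := L) i.2)).2
  -- One state may be the source of up to `L.length` replacements, each of which takes the
  -- probability t from it.
  obtain ⟨ε, hε, hεμ⟩ : ∃ ε > 0, ∀ s, 0 < μ s → ε * L.length ≤ μ s := by
    obtain ⟨s₀, hs₀, -⟩ := h.exists_num_le ∅
    obtain ⟨s₁, hs₁, hmin⟩ := Finset.exists_min_image (Finset.univ.filter (fun s => 0 < μ s)) μ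
      ⟨s₀, by simpa using hs₀⟩
    rw [Finset.mem_filter] at hs₁
    refine ⟨μ s₁ / (L.length + 1), div_pos hs₁.2 (by positivity), fun s hs => ?_⟩
    refine le_trans ?_ (hmin s (by simpa using hs))
    rw [div_mul_eq_mul_div, div_le_iff₀ (by positivity)]
    nlinarith [hs₁.2]
  refine ⟨ε, hε, fun t ht0 htε => ?_⟩
  set K := replaceKernel p q μ t with hK
  have hK0 : ∀ s s', 0 ≤ K s s' := by
    intro s s'
    by_cases hss : s = s'
    · subst hss
      rcases (h.nonneg s).eq_or_lt with hμs | hμs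
      · rw [hK, replaceKernel, ← hμs]
        simp
      · have : ∑ i : Fin L.length, -(t / μ s) ≤ ∑ i, if p i = s then t / μ s *
            ((if q i = s then 1 else 0) - if s = s then 1 else 0) else 0 := by
          refine Finset.sum_le_sum fun i _ => ?_
          have := div_nonneg ht0 hμs.le
          rw [if_pos rfl]
          split_ifs <;> linarith
        rw [Finset.sum_const, Finset.card_univ, Fintype.card_fin, nsmul_eq_mul] at this
        rw [hK, replaceKernel, if_pos rfl]
        rw [if_pos rfl] at this
        have h2 : (L.length : ℝ) * (t / μ s) ≤ 1 := by
          rw [← mul_div_assoc, div_le_one hμs]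
          have := hεμ s hμs
          have h3 : t * L.length ≤ ε * L.length :=
            mul_le_mul_of_nonneg_right htε (Nat.cast_nonneg _)
          linarith
        linarith
    · rw [hK, replaceKernel, if_neg hss]
      refine add_nonneg le_rfl (Finset.sum_nonneg fun i _ => ?_)
      have := div_nonneg ht0 (h.nonneg s)
      split_ifs <;> simp [this]
  have hrow : ∀ s, ∑ s', K s s' = 1 := by
    intro s
    simp only [hK, replaceKernel, Finset.sum_add_distrib]
    rw [Finset.sum_comm]
    simp only [Finset.sum_ite_eq, Finset.mem_univ, if_true, add_eq_left]
    refine Finset.sum_eq_zero fun i _ => ?_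
    by_cases hi' : p i = s
    · simp_rw [if_pos hi', ← Finset.mul_sum, Finset.sum_sub_distrib]
      simp
    · simp [hi']
  set μ' : (Fin k → X) → ℝ := fun s' => ∑ s, μ s * K s s' with hμ'
  have hμ'0 : ∀ s, 0 ≤ μ' s := fun s' =>
    Finset.sum_nonneg fun s _ => mul_nonneg (h.nonneg s) (hK0 s s')
  have hgen : ∀ f : (Fin k → X) → ℝ, ∑ s', μ' s' * f s' =
      ∑ s, μ s * f s + t * ∑ i, (f (q i) - f (p i)) := by
    intro f
    have := sum_replaceKernel (q := q) (t := t) hp0 fun _ s' => f s'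
    rw [← this, Finset.sum_comm]
    simp only [hμ', Finset.sum_mul]
    rfl
  refine ⟨K, μ', ?_, ⟨hK0, hrow, fun _ => rfl, ?_⟩⟩
  · refine Balanced.of_box (lo := lo) (hi := hi) hbox hμ'0 ?_ ?_ ?_
    · have := hgen fun _ => 1
      simpa [h.sum_eq] using this
    · intro x
      rw [hgen, h.mean, moveMass]
      congr 2
      have h1 := hnet x
      rw [netEffect, ← Fin.sum_univ_fun_getElem] at h1
      have h2 : ((∑ i : Fin L.length, (num L[i].2 {x} - num L[i].1 {x}) : ℤ) : ℝ) =
          ((if b = x then 1 else 0) - if a = x then 1 else 0 : ℤ) := by rw [← h1]; rfl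
      push_cast at h2
      exact h2
    · intro s hs
      by_contra hbad
      have hs0 : μ s = 0 := by
        by_contra hne
        exact hbad (hS s (by simpa using lt_of_le_of_ne (h.nonneg s) (Ne.symm hne)))
      have := hgen fun u => if u = s then 1 else 0
      simp only [mul_ite, mul_one, mul_zero, Finset.sum_ite_eq', Finset.mem_univ, if_true, hs0,
        zero_add] at this
      rw [this] at hs
      have h3 : ∑ i, (((if q i = s then 1 else 0) : ℝ) - if p i = s then 1 else 0) ≤ 0 := by
        refine Finset.sum_nonpos fun i _ => ?_
        rw [if_neg fun hq' : q i = s => hbad (hq' ▸ hqbox i)]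
        split_ifs <;> norm_num
      linarith [mul_nonneg ht0 (neg_nonneg.2 h3)]
  · have := sum_replaceKernel (q := q) (t := t) hp0 (dist' e)
    simp only [dist'_self he, mul_zero, Finset.sum_const_zero, zero_add, sub_zero] at this
    rw [hK, this, mul_comm]
    refine mul_le_mul_of_nonneg_right ?_ ht0
    rw [listCost, ← Fin.sum_univ_fun_getElem] at hcost
    exact hcost

/-- The kernels form a compact set, and all conditions are equalities or weak inequalities between
continuous functions of the kernel and t. For this reason `Balanced` speaks of deviations from
integers and not of floors and ceilings, which jump. -/
theorem isClosed_reachable {m : X → ℝ} {μ : (Fin k → X) → ℝ} (a b : X) (C θ : ℝ) :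
    IsClosed ({t | ∃ K μ', Balanced e (moveMass m a b t) μ' ∧ IsStep e K μ μ' (C * t)} ∩
      Set.Icc 0 θ) := by
  set A : Set (((Fin k → X) → (Fin k → X) → ℝ) × ℝ) :=
    {p | p.1 ∈ Set.Icc 0 1 ∧ p.2 ∈ Set.Icc 0 θ ∧
      Balanced e (moveMass m a b p.2) (fun s' => ∑ s, μ s * p.1 s s') ∧
      IsStep e p.1 μ (fun s' => ∑ s, μ s * p.1 s s') (C * p.2)} with hA
  have hAimage : {t | ∃ K μ', Balanced e (moveMass m a b t) μ' ∧ IsStep e K μ μ' (C * t)} ∩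
      Set.Icc 0 θ = Prod.snd '' A := by
    ext t
    constructor
    · rintro ⟨⟨K, μ', hb, hs⟩, ht⟩
      have : μ' = fun s' => ∑ s, μ s * K s s' := funext fun s' => (hs.push s').symm
      subst this
      refine ⟨(K, t), ⟨⟨fun s s' => hs.nonneg s s', fun s s' => ?_⟩, ht, hb, hs⟩, rfl⟩
      exact (Finset.single_le_sum (f := K s) (fun u _ => hs.nonneg s u)
        (Finset.mem_univ s')).trans (hs.sum_eq s).le
    · rintro ⟨⟨K, t'⟩, ⟨-, ht, hb, hs⟩, rfl⟩
      exact ⟨⟨K, _, hb, hs⟩, ht⟩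
  have hev : ∀ s s' : Fin k → X, Continuous
      fun p : ((Fin k → X) → (Fin k → X) → ℝ) × ℝ => p.1 s s' := fun s s' =>
    (continuous_apply s').comp ((continuous_apply s).comp continuous_fst)
  have hmv : ∀ x, Continuous
      fun p : ((Fin k → X) → (Fin k → X) → ℝ) × ℝ => moveMass m a b p.2 x := fun x => by
    unfold moveMass
    fun_prop
  have hclosed : IsClosed A := by
    have h1 : ∀ p : ((Fin k → X) → (Fin k → X) → ℝ) × ℝ, p ∈ A ↔
      p ∈ Set.Icc 0 1 ×ˢ Set.Icc 0 θ ∧ (∀ s', 0 ≤ ∑ s, μ s * p.1 s s') ∧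
      ∑ s', ∑ s, μ s * p.1 s s' = 1 ∧
      (∀ x, ∑ s', (∑ s, μ s * p.1 s s') * num s' {x} = moveMass m a b p.2 x) ∧
      (∀ i x (j : ℤ), ∑ s', (∑ s, μ s * p.1 s s') * |(num s' (ball e i x) : ℝ) - j| =
        |∑ y ∈ ball e i x, moveMass m a b p.2 y - j|) ∧
      (∀ s s', 0 ≤ p.1 s s') ∧ (∀ s, ∑ s', p.1 s s' = 1) ∧
      ∑ s, ∑ s', μ s * p.1 s s' * dist' e s s' ≤ C * p.2 := by
      intro p
      constructor
      · rintro ⟨h1, h2, ⟨h3, h4, h5, h6⟩, ⟨h7, h8, -, h9⟩⟩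
        exact ⟨⟨h1, h2⟩, h3, h4, h5, h6, h7, h8, h9⟩
      · rintro ⟨⟨h1, h2⟩, h3, h4, h5, h6, h7, h8, h9⟩
        exact ⟨h1, h2, ⟨h3, h4, h5, h6⟩, ⟨h7, h8, fun _ => rfl, h9⟩⟩
    have h2 : A = {p | p ∈ A} := rfl
    rw [h2]
    simp_rw [h1]
    have hsum : ∀ s' : Fin k → X, Continuous
      fun p : ((Fin k → X) → (Fin k → X) → ℝ) × ℝ => ∑ s, μ s * p.1 s s' := fun s' =>
      continuous_finsetSum _ fun s _ => continuous_const.mul (hev s s')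
    refine IsClosed.and (isClosed_Icc.prod isClosed_Icc) ?_
    refine IsClosed.and ?_ ?_
    · simp_rw [Set.ofPred_forall]
      exact isClosed_iInter fun s' => isClosed_le continuous_const (hsum s')
    refine IsClosed.and (isClosed_eq (continuous_finsetSum _ fun s' _ => hsum s') continuous_const) ?_
    refine IsClosed.and ?_ ?_
    · simp_rw [Set.ofPred_forall]
      exact isClosed_iInter fun x => isClosed_eq
        (continuous_finsetSum _ fun s' _ => (hsum s').mul continuous_const) (hmv x)
    refine IsClosed.and ?_ ?_
    · simp_rw [Set.ofPred_forall]
      exact isClosed_iInter fun i => isClosed_iInter fun x => isClosed_iInter fun j => isClosed_eq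
        (continuous_finsetSum _ fun s' _ => (hsum s').mul continuous_const)
        ((continuous_finsetSum _ fun y _ => hmv y).sub continuous_const).abs
    refine IsClosed.and ?_ ?_
    · simp_rw [Set.ofPred_forall]
      exact isClosed_iInter fun s => isClosed_iInter fun s' => isClosed_le continuous_const (hev s s')
    refine IsClosed.and ?_ ?_
    · simp_rw [Set.ofPred_forall]
      exact isClosed_iInter fun s => isClosed_eq (continuous_finsetSum _ fun s' _ => hev s s')
        continuous_const
    exact isClosed_le (continuous_finsetSum _ fun s _ => continuous_finsetSum _ fun s' _ =>
      (continuous_const.mul (hev s s')).mul continuous_const) (continuous_const.mul continuous_snd)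
  have hcompact : IsCompact A := (isCompact_Icc.prod (isCompact_Icc (a := (0 : ℝ)) (b := θ))).of_isClosed_subset
    hclosed fun p hp => ⟨hp.1, hp.2.1⟩
  rw [hAimage]
  exact (hcompact.image continuous_snd).isClosed

/-- Continuous induction on the moved mass: the reachable amounts are closed, and a reachable t < θ
can be increased since mass is left at a. The local step size depends on the current law, so
iterating alone would not suffice. -/
theorem exists_isStep_move (he : IsUltra e) {m : X → ℝ} {μ : (Fin k → X) → ℝ} (h : Balanced e m μ)
    {a b : X} (hab : a ≠ b) {θ : ℝ} (hθ0 : 0 ≤ θ) (hθ : θ ≤ m a) :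
    ∃ K μ', Balanced e (moveMass m a b θ) μ' ∧ IsStep e K μ μ' (4 * rho e a b * θ) := by
  refine IsClosed.Icc_subset_of_forall_exists_gt
    (isClosed_reachable (e := e) (m := m) (μ := μ) a b (4 * rho e a b) θ) ?_ ?_ ⟨hθ0, le_rfl⟩
  · refine ⟨_, μ, ?_, (IsStep.refl he μ).mono (by simp)⟩
    have : moveMass m a b 0 = m := by
      funext x
      simp [moveMass]
    rw [this]
    exact h
  · rintro t ⟨⟨K, μ', hb, hs⟩, ht0, htθ⟩ y hy
    obtain ⟨ε, hε, hstep⟩ := exists_isStep_local he hb hab (by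
      rw [moveMass, if_neg hab.symm, if_pos rfl]
      linarith)
    obtain ⟨K', μ'', hb', hs'⟩ := hstep (min ε (y - t))
      (le_min hε.le (sub_nonneg.2 (le_of_lt hy))) (min_le_left _ _)
    rw [moveMass_moveMass] at hb'
    refine ⟨t + min ε (y - t), ⟨_, μ'', hb', (hs.trans he h.nonneg hs').mono (by linarith)⟩, ?_, ?_⟩
    · have : 0 < min ε (y - t) := lt_min hε (sub_pos.2 hy)
      linarith
    · linarith [min_le_right ε (y - t)]

end Rounding

end KServer
end

/-! ### Transport in an ultrametric -/

noncomputable section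
namespace KServer

open scoped Classical

section Transport

variable {X : Type*} [Fintype X] {e : X → X → ℕ} {k : ℕ}

/-- The balls of radius `i`. -/
def balls (e : X → X → ℕ) (i : ℕ) : Finset (Finset X) := Finset.univ.image (ball e i)

/-- The cost of moving the negative part of `v` to the positive part. -/
def treeCost (e : X → X → ℕ) (L : ℕ) (v : X → ℝ) : ℝ :=
  ∑ i ∈ Finset.range L, 2 ^ i * ∑ c ∈ balls e i, |∑ x ∈ c, v x|

theorem IsUltra.sum_balls_ite (he : IsUltra e) (i : ℕ) (a : X) :
    ∑ c ∈ balls e i, (if a ∈ c then (1 : ℝ) else 0) = 1 := by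
  rw [Finset.sum_eq_single (ball e i a), if_pos (he.mem_ball_self i a)]
  · intro c hc hca
    obtain ⟨b, -, rfl⟩ := Finset.mem_image.1 hc
    exact if_neg fun h => hca (he.ball_eq (mem_ball.1 h)).symm
  · intro h
    exact absurd (Finset.mem_image_of_mem _ (Finset.mem_univ a)) h

omit [Fintype X] in
theorem sum_moveMass (m : X → ℝ) (a b : X) (t : ℝ) (c : Finset X) :
    ∑ x ∈ c, moveMass m a b t x =
      ∑ x ∈ c, m x + t * ((if b ∈ c then 1 else 0) - if a ∈ c then 1 else 0) := by
  simp only [moveMass, Finset.sum_add_distrib, ← Finset.mul_sum, Finset.sum_sub_distrib,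
    Finset.sum_ite_eq]

theorem sum_range_two_pow (n : ℕ) : ∑ i ∈ Finset.range n, (2 : ℝ) ^ i = 2 ^ n - 1 := by
  have := geom_sum_mul (2 : ℝ) n
  linarith

/-- In balls of radius less than e a b the signs do not cancel: around a all values are ≤ 0 and
around b all are ≥ 0. So the absolute sums of one ball at a and one at b drop by t at each such
radius i, and the terms 2t * 2 ^ i add up to 2t * `rho e a b`. Larger balls contain both points or
neither. -/
theorem treeCost_moveMass_le (he : IsUltra e) {L : ℕ} {v : X → ℝ} {a b : X} {t : ℝ}
    (hL : e a b ≤ L) (ht : 0 ≤ t) (ha : ∀ x, e a x < e a b → v x ≤ 0)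
    (hb : ∀ x, e b x < e a b → 0 ≤ v x) (hta : t ≤ -v a) (htb : t ≤ v b) :
    treeCost e L (moveMass v b a t) + 2 * t * rho e a b ≤ treeCost e L v := by
  have h1 : ∀ i ∈ Finset.range L,
      2 ^ i * ∑ c ∈ balls e i, |∑ x ∈ c, moveMass v b a t x| +
        (if i < e a b then 2 * t * 2 ^ i else 0) ≤ 2 ^ i * ∑ c ∈ balls e i, |∑ x ∈ c, v x| := by
    intro i _
    by_cases hi : i < e a b
    · rw [if_pos hi]
      have h2 : ∀ c ∈ balls e i, |∑ x ∈ c, moveMass v b a t x| +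
          (t * (if a ∈ c then 1 else 0) + t * if b ∈ c then 1 else 0) ≤ |∑ x ∈ c, v x| := by
        intro c hc
        obtain ⟨y, -, rfl⟩ := Finset.mem_image.1 hc
        rw [sum_moveMass]
        by_cases h3 : a ∈ ball e i y
        · have hab : b ∉ ball e i y := by
            rw [← he.ball_eq (mem_ball.1 h3), mem_ball]
            omega
          have h4 : ∑ x ∈ ball e i y, v x ≤ -t := by
            have h5 := Finset.sum_erase_add (f := v) _ h3
            have h6 : ∑ x ∈ (ball e i y).erase a, v x ≤ 0 := by
              refine Finset.sum_nonpos fun x hx => ha x (lt_of_le_of_lt ?_ hi)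
              have := Finset.mem_of_mem_erase hx
              rwa [← he.ball_eq (mem_ball.1 h3), mem_ball] at this
            linarith
          simp only [if_pos h3, if_neg hab]
          rw [abs_of_nonpos (by linarith : ∑ x ∈ ball e i y, v x ≤ 0), abs_of_nonpos (by linarith)]
          linarith
        · by_cases h7 : b ∈ ball e i y
          · have h4 : t ≤ ∑ x ∈ ball e i y, v x := by
              have h5 := Finset.sum_erase_add (f := v) _ h7
              have h6 : 0 ≤ ∑ x ∈ (ball e i y).erase b, v x := by
                refine Finset.sum_nonneg fun x hx => hb x (lt_of_le_of_lt ?_ hi)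
                have := Finset.mem_of_mem_erase hx
                rwa [← he.ball_eq (mem_ball.1 h7), mem_ball] at this
              linarith
            simp only [if_pos h7, if_neg h3]
            rw [abs_of_nonneg (by linarith : 0 ≤ ∑ x ∈ ball e i y, v x),
              abs_of_nonneg (by linarith)]
            linarith
          · simp [if_neg h3, if_neg h7]
      have h3 := Finset.sum_le_sum h2
      rw [Finset.sum_add_distrib, Finset.sum_add_distrib, ← Finset.mul_sum, ← Finset.mul_sum,
        he.sum_balls_ite, he.sum_balls_ite] at h3
      have h4 : (0 : ℝ) ≤ 2 ^ i := by positivity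
      nlinarith [mul_le_mul_of_nonneg_left h3 h4]
    · rw [if_neg hi, add_zero]
      refine mul_le_mul_of_nonneg_left (Finset.sum_le_sum fun c hc => ?_) (by positivity)
      obtain ⟨y, -, rfl⟩ := Finset.mem_image.1 hc
      have h2 := he.mem_ball_iff_of_le (x := a) (x' := b) (y := y) le_rfl (not_lt.1 hi)
      rw [sum_moveMass]
      simp only [h2, sub_self, mul_zero, add_zero, le_refl]
  have h2 := Finset.sum_le_sum h1
  rw [Finset.sum_add_distrib, ← Finset.sum_filter, ← Finset.mul_sum] at h2
  have h3 : (Finset.range L).filter (fun i => i < e a b) = Finset.range (e a b) := by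
    ext i
    simp only [Finset.mem_filter, Finset.mem_range]
    omega
  rw [h3, sum_range_two_pow] at h2
  exact h2

theorem treeCost_nonneg (e : X → X → ℕ) (L : ℕ) (v : X → ℝ) : 0 ≤ treeCost e L v :=
  Finset.sum_nonneg fun _ _ => mul_nonneg (by positivity)
    (Finset.sum_nonneg fun _ _ => abs_nonneg _)

/-- A balanced random state can follow any change of the measure at a cost that is proportional to
the transportation cost. -/
theorem exists_isStep (he : IsUltra e) {L : ℕ} (hL : ∀ a b, e a b ≤ L) {m' : X → ℝ}
    (hm' : ∀ x, 0 ≤ m' x) : ∀ (N : ℕ) (m : X → ℝ) (μ : (Fin k → X) → ℝ), Balanced e m μ →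
    ∑ x, m x = ∑ x, m' x → (Finset.univ.filter fun x => m' x - m x ≠ 0).card ≤ N →
    ∃ K μ', Balanced e m' μ' ∧ IsStep e K μ μ' (2 * treeCost e L fun x => m' x - m x) := by
  intro N
  induction N with
  | zero =>
    intro m μ hb _ hN
    have : m = m' := by
      funext x
      by_contra hx
      have : x ∈ Finset.univ.filter fun x => m' x - m x ≠ 0 := by
        rw [Finset.mem_filter]
        exact ⟨Finset.mem_univ x, fun h => hx (by linarith)⟩
      rw [Finset.card_eq_zero.1 (Nat.le_zero.1 hN)] at this
      simp at this
    subst this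
    exact ⟨_, μ, hb, (IsStep.refl he μ).mono (mul_nonneg (by norm_num) (treeCost_nonneg _ _ _))⟩
  | succ N ih =>
    intro m μ hb hsum hN
    by_cases hmm : m = m'
    · subst hmm
      exact ⟨_, μ, hb, (IsStep.refl he μ).mono (mul_nonneg (by norm_num) (treeCost_nonneg _ _ _))⟩
    set v : X → ℝ := fun x => m' x - m x with hv
    have hv0 : ∑ x, v x = 0 := by simp [hv, hsum]
    obtain ⟨x₀, hx₀⟩ : ∃ x, v x ≠ 0 := by
      by_contra! h
      exact hmm (funext fun x => by linarith [h x])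
    have hneg : ∃ a, v a < 0 := by
      by_contra! h
      exact hx₀ ((Finset.sum_eq_zero_iff_of_nonneg fun x _ => h x).1 hv0 x₀ (Finset.mem_univ _))
    have hpos : ∃ a, 0 < v a := by
      by_contra! h
      exact hx₀ ((Finset.sum_eq_zero_iff_of_nonpos fun x _ => h x).1 hv0 x₀ (Finset.mem_univ _))
    obtain ⟨a₀, ha₀⟩ := hneg
    obtain ⟨b₀, hb₀⟩ := hpos
    -- For a closest pair of opposite signs, smaller balls around `a` or `b` contain no point of the
    -- other sign. Moving the smaller of the two amounts settles `a` or `b`, so the support of the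
    -- difference shrinks.
    obtain ⟨⟨a, b⟩, hab, hmin⟩ := Finset.exists_min_image
      (Finset.univ.filter fun p : X × X => v p.1 < 0 ∧ 0 < v p.2) (fun p => e p.1 p.2)
      ⟨(a₀, b₀), by simpa using ⟨ha₀, hb₀⟩⟩
    simp only [Finset.mem_filter, Finset.mem_univ, true_and, Prod.forall] at hab hmin
    have hne : a ≠ b := by
      rintro rfl
      linarith [hab.1, hab.2]
    set t := min (-v a) (v b) with ht
    have ht0 : 0 < t := lt_min (by linarith [hab.1]) hab.2
    have hta : t ≤ -v a := min_le_left _ _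
    have htb : t ≤ v b := min_le_right _ _
    obtain ⟨K, μ', hb', hs⟩ := exists_isStep_move he hb hne ht0.le
      (by have := hm' a; simp only [hv] at hta; linarith : t ≤ m a)
    have hv' : (fun x => m' x - moveMass m a b t x) = moveMass v b a t := by
      funext x
      simp only [moveMass, hv]
      ring
    obtain ⟨K', μ'', hb'', hs'⟩ := ih (moveMass m a b t) μ' hb'
      (by rw [sum_moveMass, ← hsum]; simp) (by
        have h1 : ∀ x, m' x - moveMass m a b t x = moveMass v b a t x := congrFun hv'
        simp_rw [h1]
        refine Nat.le_of_lt_succ (lt_of_lt_of_le (Finset.card_lt_card ?_) hN)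
        refine ⟨fun x hx => ?_, ?_⟩
        · simp only [Finset.mem_filter, Finset.mem_univ, true_and] at hx ⊢
          intro h0
          have h0' : v x = 0 := h0
          have hax : a ≠ x := fun h => by rw [← h] at h0'; linarith [hab.1]
          have hbx : b ≠ x := fun h => by rw [← h] at h0'; linarith [hab.2]
          exact hx (by rw [moveMass, if_neg hax, if_neg hbx, h0']; ring)
        · intro hsub
          rcases min_choice (-v a) (v b) with hc | hc
          · have h2 := (Finset.mem_filter.1 (hsub (Finset.mem_filter.2
              ⟨Finset.mem_univ a, hab.1.ne⟩))).2
            exact h2 (by rw [moveMass, if_neg hne.symm, if_pos rfl, ht, hc]; ring)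
          · have h2 := (Finset.mem_filter.1 (hsub (Finset.mem_filter.2
              ⟨Finset.mem_univ b, hab.2.ne'⟩))).2
            exact h2 (by rw [moveMass, if_neg hne, if_pos rfl, ht, hc]; ring))
    refine ⟨_, μ'', hb'', (hs.trans he hb.nonneg hs').mono ?_⟩
    have h1 := treeCost_moveMass_le he (hL a b) ht0.le (v := v)
      (fun x hx => by
        by_contra! h
        exact absurd (hmin a x ⟨hab.1, h⟩) (by omega))
      (fun x hx => by
        by_contra! h
        have := hmin x b ⟨h, hab.2⟩
        rw [he.symm x b] at this
        omega) hta htb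
    rw [hv']
    linarith

/-- A unit moved from q to p affects at most two balls of each radius below e p q and none of larger
radius. The weights form a geometric sum. -/
theorem treeCost_le (he : IsUltra e) {ι : Type*} [Fintype ι] (L : ℕ) {v : X → ℝ} (f : ι → ℝ)
    (p q : ι → X) (hv : ∀ c : Finset X, c.Nonempty → ∑ x ∈ c, v x =
      ∑ i, f i * ((if p i ∈ c then 1 else 0) - if q i ∈ c then 1 else 0)) :
    treeCost e L v ≤ 2 * ∑ i, |f i| * rho e (p i) (q i) := by
  have h1 : ∀ j ∈ Finset.range L, (2 : ℝ) ^ j * ∑ c ∈ balls e j, |∑ x ∈ c, v x| ≤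
      ∑ i, |f i| * if j < e (p i) (q i) then 2 * 2 ^ j else 0 := by
    intro j _
    have h2 : ∑ c ∈ balls e j, |∑ x ∈ c, v x| ≤ ∑ i, |f i| * if j < e (p i) (q i) then 2 else 0 := by
      calc ∑ c ∈ balls e j, |∑ x ∈ c, v x|
          ≤ ∑ c ∈ balls e j, ∑ i, |f i| *
            |((if p i ∈ c then 1 else 0) - if q i ∈ c then 1 else 0 : ℝ)| := by
            refine Finset.sum_le_sum fun c hc => ?_
            obtain ⟨y, -, rfl⟩ := Finset.mem_image.1 hc
            rw [hv _ ⟨y, he.mem_ball_self j y⟩]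
            refine (Finset.abs_sum_le_sum_abs _ _).trans_eq ?_
            exact Finset.sum_congr rfl fun i _ => abs_mul _ _
        _ = ∑ i, |f i| * ∑ c ∈ balls e j,
            |((if p i ∈ c then 1 else 0) - if q i ∈ c then 1 else 0 : ℝ)| := by
            rw [Finset.sum_comm]
            simp_rw [Finset.mul_sum]
        _ ≤ _ := by
            refine Finset.sum_le_sum fun i _ => mul_le_mul_of_nonneg_left ?_ (abs_nonneg _)
            by_cases hj : j < e (p i) (q i)
            · rw [if_pos hj]
              calc _ ≤ ∑ c ∈ balls e j, ((if p i ∈ c then (1 : ℝ) else 0) +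
                    if q i ∈ c then (1 : ℝ) else 0) := by
                    refine Finset.sum_le_sum fun c _ => ?_
                    split_ifs <;> norm_num
                _ = 2 := by
                    rw [Finset.sum_add_distrib, he.sum_balls_ite, he.sum_balls_ite]
                    norm_num
            · rw [if_neg hj]
              refine Finset.sum_nonpos fun c hc => ?_
              obtain ⟨y, -, rfl⟩ := Finset.mem_image.1 hc
              have h2 := he.mem_ball_iff_of_le (x := p i) (x' := q i) (y := y) le_rfl (not_lt.1 hj)
              simp [h2]
    refine (mul_le_mul_of_nonneg_left h2 (by positivity)).trans_eq ?_
    rw [Finset.mul_sum]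
    refine Finset.sum_congr rfl fun i _ => ?_
    split_ifs <;> ring
  refine (Finset.sum_le_sum h1).trans ?_
  rw [Finset.sum_comm, Finset.mul_sum]
  refine Finset.sum_le_sum fun i _ => ?_
  rw [← Finset.mul_sum, mul_left_comm]
  refine mul_le_mul_of_nonneg_left ?_ (abs_nonneg _)
  rw [← Finset.sum_filter, ← Finset.mul_sum, rho, ← sum_range_two_pow]
  refine mul_le_mul_of_nonneg_left (Finset.sum_le_sum_of_subset_of_nonneg ?_ ?_) (by norm_num)
  · intro j hj
    rw [Finset.mem_filter] at hj
    exact Finset.mem_range.2 hj.2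
  · intros
    positivity

end Transport

end KServer
end

noncomputable section
namespace KServer

open scoped Classical

/-! ### A tree of logarithmic height for an ultrametric -/

section Cluster

variable {X : Type*} [Fintype X] {e : X → X → ℕ}

/-- Take the least radius at which some ball contains more than half of Y, with centre h. For a ≠ h,
the points closer to a than h either form a ball of smaller radius or avoid the majority ball around
h. -/
theorem IsUltra.exists_core (he : IsUltra e) {Y : Finset X} (hY : Y.Nonempty) :
    ∃ h ∈ Y, ∀ a ∈ Y, a ≠ h → 2 * (Y.filter fun b => e a b < e a h).card ≤ Y.card := by
  have hex : ∃ i, ∃ a ∈ Y, Y.card < 2 * (Y.filter fun b => e a b ≤ i).card := by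
    obtain ⟨a, ha⟩ := hY
    refine ⟨∑ b, e a b, a, ha, ?_⟩
    rw [Finset.filter_true_of_mem fun b _ => Finset.single_le_sum (f := e a)
      (fun _ _ => Nat.zero_le _) (Finset.mem_univ b)]
    have := Finset.card_pos.2 ⟨a, ha⟩
    omega
  obtain ⟨h, hh, hcard⟩ := Nat.find_spec hex
  refine ⟨h, hh, fun a ha hah => ?_⟩
  by_cases hi : e a h ≤ Nat.find hex
  · have h0 : e a h ≠ 0 := fun h0 => hah (he.eq_of _ _ h0)
    have h1 := Nat.find_min hex (m := e a h - 1) (by omega)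
    push Not at h1
    have h2 : (Y.filter fun b => e a b < e a h) = Y.filter fun b => e a b ≤ e a h - 1 :=
      Finset.filter_congr fun b _ => by omega
    rw [h2]
    exact h1 a ha
  · have h1 : (Y.filter fun b => e a b < e a h) ⊆ Y.filter fun b => ¬ e h b ≤ Nat.find hex := by
      intro b hb
      rw [Finset.mem_filter] at hb ⊢
      refine ⟨hb.1, fun hb' => ?_⟩
      have := he.tri a b h
      rw [he.symm b h] at this
      omega
    have h2 := Finset.card_le_card h1
    have h3 := Finset.card_filter_add_card_filter_not (s := Y) fun b => e h b ≤ Nat.find hex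
    omega

/-- A point of `Y` such that every other point has at most half of `Y` closer to it. -/
def core (e : X → X → ℕ) (Y : Finset X) : X → X := fun x =>
  if h : ∃ h ∈ Y, ∀ a ∈ Y, a ≠ h → 2 * (Y.filter fun b => e a b < e a h).card ≤ Y.card then h.choose
  else x

/-- The cluster of level `l` that contains `a`. -/
def cluster (e : X → X → ℕ) : ℕ → X → Finset X
  | 0, _ => Finset.univ
  | l + 1, a => if a = core e (cluster e l a) a then {a} else
      (cluster e l a).filter fun b => e a b < e a (core e (cluster e l a) a)

/-- The core of the cluster of level `l` that contains `a`. -/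
def rep (e : X → X → ℕ) (l : ℕ) (a : X) : X := core e (cluster e l a) a

theorem cluster_succ (e : X → X → ℕ) (l : ℕ) (a : X) : cluster e (l + 1) a =
    if a = rep e l a then {a} else (cluster e l a).filter fun b => e a b < e a (rep e l a) := rfl

namespace IsUltra

variable (he : IsUltra e)
include he

theorem core_spec {Y : Finset X} (hY : Y.Nonempty) (x : X) : core e Y x ∈ Y ∧
    ∀ a ∈ Y, a ≠ core e Y x → 2 * (Y.filter fun b => e a b < e a (core e Y x)).card ≤ Y.card := by
  rw [core, dif_pos (he.exists_core hY)]
  exact (he.exists_core hY).choose_spec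

theorem core_eq {Y : Finset X} (hY : Y.Nonempty) (x y : X) : core e Y x = core e Y y := by
  rw [core, core, dif_pos (he.exists_core hY), dif_pos (he.exists_core hY)]

theorem mem_cluster_self (l : ℕ) (a : X) : a ∈ cluster e l a := by
  induction l with
  | zero => exact Finset.mem_univ a
  | succ l ih =>
    rw [cluster_succ]
    split_ifs with h
    · exact Finset.mem_singleton_self a
    · refine Finset.mem_filter.2 ⟨ih, ?_⟩
      rw [he.self]
      exact Nat.pos_of_ne_zero fun h0 => h (he.eq_of _ _ h0)

theorem cluster_subset (l : ℕ) (a : X) : cluster e (l + 1) a ⊆ cluster e l a := by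
  rw [cluster_succ]
  split_ifs with h
  · exact Finset.singleton_subset_iff.2 (he.mem_cluster_self l a)
  · exact Finset.filter_subset _ _

theorem rep_mem (l : ℕ) (a : X) : rep e l a ∈ cluster e l a :=
  (he.core_spec ⟨a, he.mem_cluster_self l a⟩ a).1

theorem cluster_eq : ∀ (l : ℕ) {a b : X}, b ∈ cluster e l a → cluster e l b = cluster e l a := by
  intro l
  induction l with
  | zero => intros; rfl
  | succ l ih =>
    intro a b hb
    have hb' := he.cluster_subset l a hb
    have hY := ih hb'
    have hrep : rep e l b = rep e l a := by
      rw [rep, rep, hY]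
      exact he.core_eq ⟨b, hb'⟩ _ _
    rw [cluster_succ] at hb
    rw [cluster_succ, cluster_succ, hrep, hY]
    split_ifs at hb with h
    · rw [Finset.mem_singleton.1 hb]
    · rw [if_neg h]
      rw [Finset.mem_filter] at hb
      have hbh : b ≠ rep e l a := fun h' => by rw [← h'] at hb; exact lt_irrefl _ hb.2
      rw [if_neg hbh]
      refine Finset.filter_congr fun c _ => ?_
      have h1 := he.tri a b c
      have h2 := he.tri b a c
      have h3 := he.tri a b (rep e l a)
      have h4 := he.tri b a (rep e l a)
      rw [he.symm b a] at h2 h4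
      omega

theorem rep_eq {l : ℕ} {a b : X} (h : b ∈ cluster e l a) : rep e l b = rep e l a := by
  rw [rep, rep, he.cluster_eq l h]
  exact he.core_eq ⟨b, h⟩ _ _

theorem rep_rep (l : ℕ) (a : X) : rep e l (rep e l a) = rep e l a := he.rep_eq (he.rep_mem l a)

theorem card_cluster_le (l : ℕ) (a : X) :
    (cluster e l a).card ≤ max 1 (Fintype.card X / 2 ^ l) := by
  induction l with
  | zero => simp [cluster]
  | succ l ih =>
    rw [cluster_succ]
    split_ifs with h
    · simp
    · have h1 := (he.core_spec ⟨a, he.mem_cluster_self l a⟩ a).2 a (he.mem_cluster_self l a) h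
      rw [← rep] at h1
      rw [pow_succ, ← Nat.div_div_eq_div_mul]
      omega

theorem cluster_log (a : X) :
    cluster e (Nat.log 2 (Fintype.card X)) a = {a} := by
  have h1 := he.card_cluster_le (Nat.log 2 (Fintype.card X)) a
  have h2 : Fintype.card X / 2 ^ Nat.log 2 (Fintype.card X) < 2 := by
    rw [Nat.div_lt_iff_lt_mul (by positivity), mul_comm, ← pow_succ]
    exact Nat.lt_pow_succ_log_self (by norm_num) _
  have h3 : (cluster e (Nat.log 2 (Fintype.card X)) a).card ≤ 1 := by omega
  exact Finset.eq_singleton_iff_unique_mem.2 ⟨he.mem_cluster_self _ a, fun b hb =>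
    Finset.card_le_one.1 h3 b hb a (he.mem_cluster_self _ a)⟩

end IsUltra

/-- The length of the edge above the cluster of level `l + 1` that contains `a`. -/
def clusterWeight (e : X → X → ℕ) (l : ℕ) (a : X) : ℝ :=
  if a = rep e l a then (1 / 2) ^ l else 2 ^ e a (rep e l a)

theorem clusterWeight_pos (e : X → X → ℕ) (l : ℕ) (a : X) : 0 < clusterWeight e l a := by
  unfold clusterWeight
  positivity

namespace IsUltra

variable (he : IsUltra e)
include he

theorem clusterWeight_eq {l : ℕ} {a b : X} (h : b ∈ cluster e (l + 1) a) :
    clusterWeight e l b = clusterWeight e l a := by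
  have h1 := he.rep_eq (he.cluster_subset l a h)
  rw [cluster_succ] at h
  split_ifs at h with h2
  · rw [Finset.mem_singleton.1 h]
  · rw [Finset.mem_filter] at h
    have h3 := he.tri a b (rep e l a)
    have h4 := he.tri b a (rep e l a)
    rw [he.symm b a] at h4
    have hbh : b ≠ rep e l a := fun h' => by rw [← h'] at h; exact lt_irrefl _ h.2
    rw [clusterWeight, clusterWeight, h1, if_neg h2, if_neg hbh]
    congr 1
    omega

/-- The exponents e a (rep e l a) strictly decrease with the level until a becomes a core, so the
first one dominates. The weights (1 / 2) ^ l at cores are there only to be positive and summable. -/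
theorem sum_clusterWeight_le (a : X) (m : ℕ) : ∀ l,
    ∑ i ∈ Finset.range m, clusterWeight e (l + i) a ≤
      2 * (if a = rep e l a then 0 else 2 ^ e a (rep e l a)) + 2 * (1 / 2) ^ l := by
  induction m with
  | zero =>
    intro l
    rw [Finset.sum_range_zero]
    positivity
  | succ m ih =>
    intro l
    rw [Finset.sum_range_succ', add_zero]
    have h1 := ih (l + 1)
    have h2 : ∀ i, l + 1 + i = l + (i + 1) := fun i => by ring
    simp_rw [h2] at h1
    have h3 := he.rep_mem (l + 1) a
    have h4 : (0 : ℝ) ≤ (1 / 2) ^ l := by positivity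
    rw [pow_succ] at h1
    rw [cluster_succ] at h3
    rw [clusterWeight]
    split_ifs at h3 ⊢ with h5
    · rw [Finset.mem_singleton] at h3
      rw [if_pos h3.symm] at h1
      linarith
    · rw [Finset.mem_filter] at h3
      have h6 : 2 * (2 : ℝ) ^ e a (rep e (l + 1) a) ≤ 2 ^ e a (rep e l a) := by
        rw [← pow_succ']
        exact pow_le_pow_right₀ (by norm_num) (by omega)
      have h7 : (0 : ℝ) ≤ 2 ^ e a (rep e (l + 1) a) := by positivity
      split_ifs at h1 <;> linarith

/-- At the first level that separates b from a, either a is the core or the core is no farther from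
a than b is. The weights from there on are bounded by `sum_clusterWeight_le`. -/
theorem sum_clusterWeight_separating_le {a b : X} (m : ℕ) : ∀ l, b ∈ cluster e l a →
    ∑ i ∈ Finset.range m, (if b ∈ cluster e (l + i + 1) a then 0 else clusterWeight e (l + i) a) ≤
      2 * 2 ^ e a b + 2 := by
  induction m with
  | zero =>
    intro l _
    rw [Finset.sum_range_zero]
    positivity
  | succ m ih =>
    intro l hb
    by_cases hb' : b ∈ cluster e (l + 1) a
    · rw [Finset.sum_range_succ', add_zero, if_pos hb', add_zero]
      have h1 := ih (l + 1) hb'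
      have h2 : ∀ i, l + 1 + i = l + (i + 1) := fun i => by ring
      simp_rw [h2] at h1
      exact h1
    · have h1 : ∑ i ∈ Finset.range (m + 1),
          (if b ∈ cluster e (l + i + 1) a then 0 else clusterWeight e (l + i) a) ≤
          ∑ i ∈ Finset.range (m + 1), clusterWeight e (l + i) a := by
        refine Finset.sum_le_sum fun i _ => ?_
        have := clusterWeight_pos e (l + i) a
        split_ifs <;> linarith
      have h2 := he.sum_clusterWeight_le a (m + 1) l
      have h3 : ((1 : ℝ) / 2) ^ l ≤ 1 := pow_le_one₀ (by norm_num) (by norm_num)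
      have h4 : (if a = rep e l a then (0 : ℝ) else 2 ^ e a (rep e l a)) ≤ 2 ^ e a b := by
        rw [cluster_succ] at hb'
        split_ifs at hb' ⊢ with h5
        · positivity
        · rw [Finset.mem_filter] at hb'
          push Not at hb'
          exact pow_le_pow_right₀ (by norm_num) (hb' hb)
      linarith

end IsUltra

/-- The nodes of the cluster tree, given by their level and their core. -/
abbrev Node (e : X → X → ℕ) : Type _ :=
  {p : ℕ × X // p.1 ≤ Nat.log 2 (Fintype.card X) ∧ rep e p.1 p.2 = p.2}

instance : Finite (Node e) :=
  Finite.of_injective (β := Fin (Nat.log 2 (Fintype.card X) + 1) × X)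
    (fun p => (⟨p.1.1, Nat.lt_succ_of_le p.2.1⟩, p.1.2)) fun p q h => by
      simp only [Prod.mk.injEq, Fin.mk.injEq] at h
      exact Subtype.ext (Prod.ext h.1 h.2)

instance : Fintype (Node e) := Fintype.ofFinite _

/-! ### The clusters as a weighted tree -/

section Tree

variable (he : IsUltra e)

/-- The node of level `l` above `a`. -/
def IsUltra.node (l : ℕ) (hl : l ≤ Nat.log 2 (Fintype.card X)) (a : X) : Node e :=
  ⟨(l, rep e l a), hl, he.rep_rep l a⟩

theorem IsUltra.node_eq_iff {l : ℕ} {hl : l ≤ Nat.log 2 (Fintype.card X)} {a : X} {v : Node e} :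
    he.node l hl a = v ↔ v.1.1 = l ∧ a ∈ cluster e v.1.1 v.1.2 := by
  obtain ⟨⟨l', g⟩, hl', hg⟩ := v
  simp only [IsUltra.node, Subtype.mk.injEq, Prod.mk.injEq] at hg ⊢
  constructor
  · rintro ⟨rfl, rfl⟩
    refine ⟨rfl, ?_⟩
    rw [he.cluster_eq _ (he.rep_mem l a)]
    exact he.mem_cluster_self l a
  · rintro ⟨rfl, h⟩
    exact ⟨rfl, by rw [he.rep_eq h, hg]⟩

/-- The node of level zero. -/
def IsUltra.rootNode (hX : 2 ≤ Fintype.card X) : Node e :=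
  he.node 0 (Nat.zero_le _) (Fintype.card_pos_iff.1 (by omega) : Nonempty X).some

theorem IsUltra.ne_rootNode_iff (hX : 2 ≤ Fintype.card X) {v : Node e} :
    v ≠ he.rootNode hX ↔ v.1.1 ≠ 0 := by
  rw [ne_eq, not_iff_not, eq_comm]
  exact he.node_eq_iff.trans ⟨fun h => h.1, fun h => ⟨h, by rw [h]; exact Finset.mem_univ _⟩⟩

/-- The tree of the clusters of an ultrametric. -/
def IsUltra.tree (hX : 2 ≤ Fintype.card X) : WTree X where
  V := Node e
  root := he.rootNode hX
  par v := he.node (v.1.1 - 1) (by have := v.2.1; omega) v.1.2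
  depth v := v.1.1
  height := Nat.log 2 (Fintype.card X)
  cl v := cluster e v.1.1 v.1.2
  w v := clusterWeight e (v.1.1 - 1) v.1.2
  leaf x := he.node _ le_rfl x
  depth_root := rfl
  depth_par v hv := by
    have := (he.ne_rootNode_iff hX).1 hv
    simp only [IsUltra.node]
    omega
  depth_le v := v.2.1
  cl_root := rfl
  cl_leaf x := by
    have h := he.cluster_log x
    have h1 := he.rep_mem (Nat.log 2 (Fintype.card X)) x
    rw [h, Finset.mem_singleton] at h1
    simp only [IsUltra.node, h1, h]
  leaf_ne_root x := (he.ne_rootNode_iff hX).2 (Nat.log_pos (by norm_num) hX).ne'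
  cl_nonempty v := ⟨v.1.2, he.mem_cluster_self _ _⟩
  card_cl u hu B := by
    obtain ⟨v₀, hv₀, rfl⟩ := hu
    set u := he.node (v₀.1.1 - 1) (by have := v₀.2.1; omega) v₀.1.2 with hu
    have h0 : ∀ v : Node e, v ≠ he.rootNode hX → v.1.1 ≠ 0 := fun v => (he.ne_rootNode_iff hX).1
    have hv0 := h0 v₀ hv₀
    have hul : u.1.1 = v₀.1.1 - 1 := rfl
    have hle : u.1.1 + 1 ≤ Nat.log 2 (Fintype.card X) := by have := v₀.2.1; omega
    rw [Finset.card_eq_sum_card_fiberwise (f := he.node (u.1.1 + 1) hle)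
      (t := Finset.univ.filter fun v : Node e => v ≠ he.rootNode hX ∧
        he.node (v.1.1 - 1) (by have := v.2.1; omega) v.1.2 = u)]
    · refine Finset.sum_congr (by congr) fun v hv => ?_
      rw [Finset.mem_filter] at hv
      congr 1
      ext x
      rw [Finset.mem_filter, Finset.mem_inter, Finset.mem_inter, he.node_eq_iff]
      have h1 := he.node_eq_iff.1 hv.2.2
      have h2 := h0 v hv.2.1
      constructor
      · rintro ⟨hxB, hxv⟩
        refine ⟨⟨hxB, ?_⟩, by omega, hxv⟩
        have h3 : v.1.1 = u.1.1 + 1 := by omega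
        rw [h3] at hxv
        have h4 := he.cluster_subset _ _ hxv
        rwa [he.cluster_eq _ h1.2] at h4
      · rintro ⟨⟨hxB, -⟩, -, hxv⟩
        exact ⟨hxB, hxv⟩
    · intro x hx
      rw [Finset.coe_inter, Set.mem_inter_iff, Finset.mem_coe, Finset.mem_coe] at hx
      rw [Finset.mem_coe, Finset.mem_filter]
      refine ⟨Finset.mem_univ _, (he.ne_rootNode_iff hX).2 (Nat.succ_ne_zero _), ?_⟩
      rw [he.node_eq_iff]
      refine ⟨by simp [IsUltra.node], ?_⟩
      simp only [IsUltra.node]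
      have h1 := he.cluster_subset _ _ (he.rep_mem (u.1.1 + 1) x)
      rwa [he.cluster_eq _ hx.2] at h1
  w_pos v := clusterWeight_pos _ _ _
  par_ne_leaf v hv x h := by
    have h0 := (he.ne_rootNode_iff hX).1 hv
    have h1 := congrArg (fun v : Node e => v.1.1) h
    simp only [IsUltra.node] at h1
    have := v.2.1
    omega
  pos v := v.1.2
  pos_leaf x := by
    have h1 := he.rep_mem (Nat.log 2 (Fintype.card X)) x
    rw [he.cluster_log x, Finset.mem_singleton] at h1
    exact h1

theorem IsUltra.tree_rho_le (hX : 2 ≤ Fintype.card X) (v : (he.tree hX).V) :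
    rho e ((he.tree hX).pos v) ((he.tree hX).pos ((he.tree hX).par v)) ≤ (he.tree hX).w v := by
  have key : ∀ v : Node e, rho e v.1.2 (rep e (v.1.1 - 1) v.1.2) ≤
      clusterWeight e (v.1.1 - 1) v.1.2 := by
    intro v
    rw [clusterWeight]
    split_ifs with h
    · rw [← h, he.rho_self]
      positivity
    · rw [rho]
      linarith
  exact key v

theorem IsUltra.sum_node_le (hX : 2 ≤ Fintype.card X)
    (_ : Fintype {v : Node e // v ≠ he.rootNode hX}) (a b : X) :
    ∑ v : {v : Node e // v ≠ he.rootNode hX},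
      (if a ∈ cluster e v.1.1.1 v.1.1.2 ∧ b ∉ cluster e v.1.1.1 v.1.1.2 then
        clusterWeight e (v.1.1.1 - 1) v.1.1.2 else 0) ≤ 2 * 2 ^ e a b + 2 := by
  refine le_trans (le_of_eq ?_) (he.sum_clusterWeight_separating_le (a := a) (b := b)
    (Nat.log 2 (Fintype.card X)) 0 (Finset.mem_univ b))
  have h1 : ∀ l, (if b ∈ cluster e (0 + l + 1) a then 0 else clusterWeight e (0 + l) a) =
      if b ∉ cluster e (l + 1) a then clusterWeight e l a else 0 := by
    intro l
    rw [zero_add, ite_not]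
  simp_rw [h1]
  rw [← Finset.sum_filter, ← Finset.sum_filter]
  have h0 : ∀ v : {v : Node e // v ≠ he.rootNode hX}, v.1.1.1 - 1 + 1 = v.1.1.1 := fun v => by
    have := (he.ne_rootNode_iff hX).1 v.2
    omega
  refine Finset.sum_bij' (fun v _ => v.1.1.1 - 1)
    (fun l hl => ⟨he.node (l + 1) (by
      have := Finset.mem_range.1 (Finset.mem_filter.1 hl).1
      omega) a, (he.ne_rootNode_iff hX).2 (Nat.succ_ne_zero l)⟩) ?_ ?_ ?_ ?_ ?_
  · intro v hv
    obtain ⟨-, ha, hb⟩ := Finset.mem_filter.1 hv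
    rw [Finset.mem_filter, Finset.mem_range, h0]
    refine ⟨by have := v.1.2.1; have := h0 v; omega, ?_⟩
    rwa [he.cluster_eq _ ha]
  · intro l hl
    rw [Finset.mem_filter] at hl ⊢
    have h2 := he.cluster_eq _ (he.rep_mem (l + 1) a)
    simp only [IsUltra.node, h2]
    exact ⟨Finset.mem_univ _, he.mem_cluster_self _ a, hl.2⟩
  · intro v hv
    obtain ⟨-, ha, hb⟩ := Finset.mem_filter.1 hv
    refine Subtype.ext ?_
    dsimp only
    rw [he.node_eq_iff]
    exact ⟨(h0 v).symm, ha⟩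
  · intro l hl
    rfl
  · intro v hv
    obtain ⟨-, ha, hb⟩ := Finset.mem_filter.1 hv
    refine (he.clusterWeight_eq ?_).symm
    rwa [h0]

theorem IsUltra.sum_tree_le (hX : 2 ≤ Fintype.card X) (a b : X) :
    ∑ v : {v : (he.tree hX).V // v ≠ (he.tree hX).root},
      (if a ∈ (he.tree hX).cl v ∧ b ∉ (he.tree hX).cl v then (he.tree hX).w v else 0) ≤
      2 * 2 ^ e a b + 2 :=
  he.sum_node_le hX _ a b

/-- For a ≠ b the two one-sided sums give 4 * 2 ^ e + 4, which is at most 16 * (2 ^ e - 1) because e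
≥ 1. -/
theorem IsUltra.sum_tree_abs_le (hX : 2 ≤ Fintype.card X) (a b : X) :
    ∑ v : {v : (he.tree hX).V // v ≠ (he.tree hX).root}, (he.tree hX).w v *
      |((if a ∈ (he.tree hX).cl v then 1 else 0) - if b ∈ (he.tree hX).cl v then 1 else 0 : ℝ)| ≤
      16 * rho e a b := by
  by_cases hab : a = b
  · subst hab
    simp [he.rho_self]
  have h1 := he.sum_tree_le hX a b
  have h2 := he.sum_tree_le hX b a
  have h3 : ∑ v : {v : (he.tree hX).V // v ≠ (he.tree hX).root}, (he.tree hX).w v *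
      |((if a ∈ (he.tree hX).cl v then 1 else 0) - if b ∈ (he.tree hX).cl v then 1 else 0 : ℝ)| =
      ∑ v : {v : (he.tree hX).V // v ≠ (he.tree hX).root},
      (if a ∈ (he.tree hX).cl v ∧ b ∉ (he.tree hX).cl v then (he.tree hX).w v else 0) +
      ∑ v : {v : (he.tree hX).V // v ≠ (he.tree hX).root},
      (if b ∈ (he.tree hX).cl v ∧ a ∉ (he.tree hX).cl v then (he.tree hX).w v else 0) := by
    rw [← Finset.sum_add_distrib]
    refine Finset.sum_congr rfl fun v _ => ?_
    by_cases ha : a ∈ (he.tree hX).cl v <;> by_cases hb : b ∈ (he.tree hX).cl v <;> simp [ha, hb]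
  rw [he.symm b a] at h2
  have h4 : (2 : ℝ) ≤ 2 ^ e a b :=
    le_self_pow₀ (by norm_num) fun h => hab (he.eq_of _ _ h)
  rw [h3, rho]
  linarith

end Tree

end Cluster

end KServer
end

noncomputable section
namespace KServer

open scoped Classical

/-! ### Randomized algorithms from hidden Markov chains -/

/-- A Markov chain with states `H` whose transition probabilities depend on the request and on
a deterministic state in `D`, and whose states determine configurations. -/
structure HiddenChain (X : Type*) [Fintype X] (k : ℕ) (D H : Type*) [Fintype H] where
  out : H → Config X k
  succ : D → X → D
  prob : D → X → H → H → ℝ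
  nonneg : ∀ D r x y, 0 ≤ prob D r x y
  sum_eq : ∀ D r x, ∑ y, prob D r x y = 1
  serves : ∀ D r x y, 0 < prob D r x y → r ∈ (out y).1

namespace HiddenChain

variable {X : Type*} [Fintype X] {k : ℕ} {D H : Type*} [Fintype H] (c : HiddenChain X k D H)

/-- The expected cost of the chain on the remaining requests. -/
def value (d : X → X → ℝ) : D → H → List X → ℝ
  | _, _, [] => 0
  | D, x, r :: σ => ∑ y, c.prob D r x y * (moveCost d (c.out x) (c.out y) + value d (c.succ D r) y σ)

/-- The deterministic state after a history. -/
def detState (D₀ : D) : List (X × Config X k) → D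
  | [] => D₀
  | p :: h => c.succ (detState D₀ h) p.1

/-- The probability to be in state `x` and to have produced the history. -/
def belief (D₀ : D) (ν : H → ℝ) : List (X × Config X k) → H → ℝ
  | [], x => ν x
  | p :: h, y => if c.out y = p.2 then ∑ x, belief D₀ ν h x * c.prob (c.detState D₀ h) p.1 x y else 0

variable {D₀ : D} {ν : H → ℝ}

theorem belief_nonneg (hν : ∀ x, 0 ≤ ν x) (h : List (X × Config X k)) (x : H) :
    0 ≤ c.belief D₀ ν h x := by
  induction h generalizing x with
  | nil => exact hν x
  | cons p h ih =>
    rw [belief]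
    split_ifs
    · exact Finset.sum_nonneg fun y _ => mul_nonneg (ih y) (c.nonneg _ _ _ _)
    · exact le_rfl

/-- The probability of the history. -/
def total (D₀ : D) (ν : H → ℝ) (h : List (X × Config X k)) : ℝ := ∑ x, c.belief D₀ ν h x

theorem total_nonneg (hν : ∀ x, 0 ≤ ν x) (h : List (X × Config X k)) : 0 ≤ c.total D₀ ν h :=
  Finset.sum_nonneg fun x _ => c.belief_nonneg hν h x

theorem sum_belief_cons (h : List (X × Config X k)) (r : X) (f : Config X k → H → ℝ) :
    ∑ B, ∑ y, c.belief D₀ ν ((r, B) :: h) y * f B y =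
      ∑ x, c.belief D₀ ν h x * ∑ y, c.prob (c.detState D₀ h) r x y * f (c.out y) y := by
  rw [Finset.sum_comm]
  simp only [belief, ite_mul, zero_mul, Finset.sum_ite_eq, Finset.mem_univ, if_true]
  simp_rw [Finset.sum_mul, Finset.mul_sum]
  rw [Finset.sum_comm]
  exact Finset.sum_congr rfl fun x _ => Finset.sum_congr rfl fun y _ => mul_assoc _ _ _

theorem sum_total_cons (h : List (X × Config X k)) (r : X) :
    ∑ B, c.total D₀ ν ((r, B) :: h) = c.total D₀ ν h := by
  have := c.sum_belief_cons (D₀ := D₀) (ν := ν) h r fun _ _ => 1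
  simp only [mul_one, c.sum_eq] at this
  exact this

theorem exists_config (hk : 1 ≤ k) (hkX : k ≤ Fintype.card X) (r : X) :
    ∃ B : Config X k, r ∈ B.1 := by
  obtain ⟨B, hB, hcard⟩ := Finset.exists_superset_card_eq (s := {r}) (n := k) (by simpa using hk) hkX
  exact ⟨⟨B, hcard⟩, hB (Finset.mem_singleton_self r)⟩

/-- The conditional law of the next configuration is a quotient of totals. After a history of
probability zero any configuration that serves r will do, since both sides vanish. -/
theorem exists_next (hν : ∀ x, 0 ≤ ν x) (hk : 1 ≤ k) (hkX : k ≤ Fintype.card X)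
    (h : List (X × Config X k)) (r : X) : ∃ p : PMF (Config X k), (∀ B ∈ p.support, r ∈ B.1) ∧
      ∀ B, c.total D₀ ν h * (p B).toReal = c.total D₀ ν ((r, B) :: h) := by
  have hsum := c.sum_total_cons (D₀ := D₀) (ν := ν) h r
  have h0 : ∀ B, 0 ≤ c.total D₀ ν ((r, B) :: h) := fun B => c.total_nonneg hν _
  rcases (c.total_nonneg (D₀ := D₀) hν h).eq_or_lt with ht | ht
  · obtain ⟨B₀, hB₀⟩ := exists_config hk hkX r
    refine ⟨PMF.pure B₀, fun B hB => ?_, fun B => ?_⟩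
    · rw [PMF.support_pure, Set.mem_singleton_iff] at hB
      rwa [hB]
    · rw [← ht] at hsum
      rw [← ht, zero_mul, (Finset.sum_eq_zero_iff_of_nonneg fun B _ => h0 B).1 hsum B
        (Finset.mem_univ B)]
  · have hq0 : ∀ B, 0 ≤ c.total D₀ ν ((r, B) :: h) / c.total D₀ ν h := fun B =>
      div_nonneg (h0 B) ht.le
    refine ⟨PMF.ofFintype (fun B => ENNReal.ofReal (c.total D₀ ν ((r, B) :: h) / c.total D₀ ν h)) ?_,
      fun B hB => ?_, fun B => ?_⟩
    · rw [← ENNReal.ofReal_sum_of_nonneg fun B _ => hq0 B, ← Finset.sum_div, hsum, div_self ht.ne',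
        ENNReal.ofReal_one]
    · rw [PMF.mem_support_iff, PMF.ofFintype_apply] at hB
      by_contra hr
      refine hB ?_
      have : c.total D₀ ν ((r, B) :: h) = 0 := by
        refine Finset.sum_eq_zero fun y _ => ?_
        rw [belief]
        split_ifs with hy
        · refine Finset.sum_eq_zero fun x _ => ?_
          rw [(c.nonneg _ _ x y).antisymm' (not_lt.1 fun hp => hr ?_), mul_zero]
          have := c.serves _ _ _ _ hp
          rwa [hy] at this
        · rfl
      rw [this, zero_div, ENNReal.ofReal_zero]
    · rw [PMF.ofFintype_apply, ENNReal.toReal_ofReal (hq0 B), mul_div_cancel₀ _ ht.ne']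

/-- The algorithm does not remember the hidden state. Drawing from the conditional law given the
history reproduces the law of the visible process, and the movement cost depends on nothing else. -/
theorem exists_algorithm (hk : 1 ≤ k) (hkX : k ≤ Fintype.card X) (D₀ : D) (hν : ∀ x, 0 ≤ ν x)
    (hν1 : ∑ x, ν x = 1) (A₀ : Config X k) (hA₀ : ∀ x, ν x ≠ 0 → c.out x = A₀) :
    ∃ alg : RandomizedAlgorithm X k, alg.init = A₀ ∧
      ∀ d σ, alg.expectedCost d σ = ∑ x, ν x * c.value d D₀ x σ := by
  choose next hserves hnext using c.exists_next (D₀ := D₀) hν hk hkX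
  set alg : RandomizedAlgorithm X k := ⟨A₀, next, hserves⟩ with halg
  refine ⟨alg, rfl, fun d σ => ?_⟩
  have hcur : ∀ h x, c.belief D₀ ν h x ≠ 0 → c.out x = alg.current h := by
    intro h x hx
    cases h with
    | nil => exact hA₀ x hx
    | cons p h =>
      rw [belief] at hx
      by_contra hne
      exact hx (if_neg hne)
  -- Multiplying by the probability of the history avoids conditional expectations and makes the
  -- recursion linear in the belief.
  have key : ∀ (σ : List X) (h : List (X × Config X k)),
      c.total D₀ ν h * alg.expectedCostFrom d h σ =
        ∑ x, c.belief D₀ ν h x * c.value d (c.detState D₀ h) x σ := by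
    intro σ
    induction σ with
    | nil => simp [RandomizedAlgorithm.expectedCostFrom, value]
    | cons r σ ih =>
      intro h
      rw [RandomizedAlgorithm.expectedCostFrom, Finset.mul_sum]
      have h1 : ∀ B, c.total D₀ ν h * ((alg.next h r B).toReal *
          (moveCost d (alg.current h) B + alg.expectedCostFrom d ((r, B) :: h) σ)) =
          ∑ y, c.belief D₀ ν ((r, B) :: h) y * (moveCost d (alg.current h) B +
            c.value d (c.succ (c.detState D₀ h) r) y σ) := by
        intro B
        rw [← mul_assoc, hnext, mul_add, ih]
        simp_rw [mul_add, Finset.sum_add_distrib, ← Finset.sum_mul]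
        rfl
      rw [Finset.sum_congr rfl fun B _ => h1 B, c.sum_belief_cons h r fun B y =>
        moveCost d (alg.current h) B + c.value d (c.succ (c.detState D₀ h) r) y σ]
      refine Finset.sum_congr rfl fun x _ => ?_
      by_cases hx : c.belief D₀ ν h x = 0
      · rw [hx, zero_mul, zero_mul]
      · rw [value, hcur h x hx]
  have := key σ []
  rw [show c.total D₀ ν [] = 1 from hν1, one_mul] at this
  exact this

theorem sum_value_cons (d : X → X → ℝ) (D : D) (ν : H → ℝ) (r : X) (σ : List X) :
    ∑ x, ν x * c.value d D x (r :: σ) =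
      ∑ x, ∑ y, ν x * c.prob D r x y * moveCost d (c.out x) (c.out y) +
        ∑ y, (∑ x, ν x * c.prob D r x y) * c.value d (c.succ D r) y σ := by
  simp_rw [Finset.sum_mul]
  rw [Finset.sum_comm (γ := H) (f := fun y x => ν x * c.prob D r x y * c.value d (c.succ D r) y σ),
    ← Finset.sum_add_distrib]
  refine Finset.sum_congr rfl fun x _ => ?_
  rw [value, Finset.mul_sum, ← Finset.sum_add_distrib]
  exact Finset.sum_congr rfl fun y _ => by ring

end HiddenChain

end KServer
end

noncomputable section
namespace KServer

open scoped Classical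

/-! ### Labelled servers that move lazily -/

section Lazy

variable {X : Type*} [Fintype X] {e : X → X → ℕ} {k : ℕ}

/-- The configuration of labelled servers. -/
def configOf (A : {A : Fin k → X // Function.Injective A}) : Config X k :=
  ⟨Finset.univ.image A.1, by
    rw [Finset.card_image_of_injective _ A.2, Finset.card_univ, Fintype.card_fin]⟩

theorem mem_configOf {A : {A : Fin k → X // Function.Injective A}} {x : X} :
    x ∈ (configOf A).1 ↔ ∃ i, A.1 i = x := by
  simp [configOf]

theorem exists_configOf_eq (B : Config X k) : ∃ A, configOf A = B := by
  refine ⟨⟨fun i => (B.1.equivFinOfCardEq B.2).symm i, fun i j h => by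
    simpa using h⟩, Subtype.ext ?_⟩
  ext x
  rw [mem_configOf]
  constructor
  · rintro ⟨i, rfl⟩
    exact ((B.1.equivFinOfCardEq B.2).symm i).2
  · intro hx
    exact ⟨B.1.equivFinOfCardEq B.2 ⟨x, hx⟩, by simp⟩

/-- The servers of a configuration are in bijection with their labels. -/
def configEquiv (A : {A : Fin k → X // Function.Injective A}) : Fin k ≃ (configOf A).1 :=
  Equiv.ofBijective (fun i => ⟨A.1 i, mem_configOf.2 ⟨i, rfl⟩⟩)
    ⟨fun _ _ h => A.2 (congrArg Subtype.val h), fun ⟨_, hx⟩ => by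
      obtain ⟨i, hi⟩ := mem_configOf.1 hx
      exact ⟨i, Subtype.ext hi⟩⟩

theorem moveCost_configOf_le (d : X → X → ℝ) (A B : {A : Fin k → X // Function.Injective A}) :
    moveCost d (configOf A) (configOf B) ≤ ∑ i, d (A.1 i) (B.1 i) := by
  refine (ciInf_le (Set.finite_range _).bddBelow ((configEquiv A).symm.trans (configEquiv B))).trans ?_
  rw [← Equiv.sum_comp (configEquiv A)]
  simp only [Equiv.trans_apply, Equiv.symm_apply_apply]
  exact le_rfl

/-- The label of a server of `M` at `r`. -/
def labelAt (hk : 1 ≤ k) (M : Fin k → X) (r : X) : Fin k :=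
  if h : ∃ i, M i = r then h.choose else ⟨0, hk⟩

/-- The lazy move of the servers `A` that follow the servers `M` to serve a request at `r`. -/
def lazyMove (hk : 1 ≤ k) (A : {A : Fin k → X // Function.Injective A}) (M : Fin k → X) (r : X) :
    {A : Fin k → X // Function.Injective A} :=
  if h : ∃ i, A.1 i = r then A else ⟨Function.update A.1 (labelAt hk M r) r, by
    intro i j hij
    push Not at h
    by_cases hi : i = labelAt hk M r <;> by_cases hj : j = labelAt hk M r
    · rw [hi, hj]
    · rw [hi, Function.update_self, Function.update_of_ne hj] at hij
      exact absurd hij.symm (h j)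
    · rw [hj, Function.update_self, Function.update_of_ne hi] at hij
      exact absurd hij (h i)
    · rw [Function.update_of_ne hi, Function.update_of_ne hj] at hij
      exact A.2 hij⟩

theorem mem_lazyMove (hk : 1 ≤ k) (A : {A : Fin k → X // Function.Injective A}) (M : Fin k → X)
    (r : X) : r ∈ (configOf (lazyMove hk A M r)).1 := by
  rw [mem_configOf, lazyMove]
  split_ifs with h
  · exact h
  · exact ⟨_, Function.update_self _ _ _⟩

/-- The distance from `A` to the placement serves as a potential. If a server moves, it goes to `r`,
where its partner in `M'` already is, so the move is no detour. The lazy servers stay at distinct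
points even when `M'` does not. -/
theorem lazyMove_cost (he : IsUltra e) (hk : 1 ≤ k) (A : {A : Fin k → X // Function.Injective A})
    {M M' : Fin k → X} {r : X} (hM' : ∃ i, M' i = r) :
    moveCost (rho e) (configOf A) (configOf (lazyMove hk A M' r)) +
      dist' e (lazyMove hk A M' r).1 M' ≤ dist' e A.1 M + dist' e M M' := by
  have h1 := moveCost_configOf_le (rho e) A (lazyMove hk A M' r)
  have h2 := dist'_tri he A.1 M M'
  suffices h : ∑ i, rho e (A.1 i) ((lazyMove hk A M' r).1 i) + dist' e (lazyMove hk A M' r).1 M' =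
      dist' e A.1 M' by linarith
  rw [dist', dist', ← Finset.sum_add_distrib]
  refine Finset.sum_congr rfl fun i _ => ?_
  rw [lazyMove]
  split_ifs with h
  · rw [he.rho_self, zero_add]
  · by_cases hi : i = labelAt hk M' r
    · have h3 : M' i = r := by
        rw [hi, labelAt, dif_pos hM']
        exact hM'.choose_spec
      simp only [hi, Function.update_self]
      rw [← hi, h3, he.rho_self, add_zero]
    · simp only [Function.update_of_ne hi, he.rho_self, zero_add]

end Lazy

/-! ### The randomized algorithm for an ultrametric -/

section Online

variable {X : Type*} [Fintype X] {e : X → X → ℕ} {k : ℕ} {T : WTree X} {δ : ℝ}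

/-- A feasible fractional state together with a balanced rounding of its measure. -/
structure RoundState (e : X → X → ℕ) (T : WTree X) (δ : ℝ) (k : ℕ) where
  z : T.Slot → ℝ
  μ : (Fin k → X) → ℝ
  feasible : T.Feasible δ k z
  le_one : ∀ p, z p ≤ 1
  balanced : Balanced e (T.measure δ k z) μ

theorem sum_measure_univ (T : WTree X) (z : T.Slot → ℝ) : ∑ x, T.measure δ k z x = k := by
  rw [T.sum_measure]
  simp

theorem exists_bound (e : X → X → ℕ) : ∃ L, ∀ a b, e a b ≤ L :=
  ⟨∑ a, ∑ b, e a b, fun a b => (Finset.single_le_sum (f := e a) (fun _ _ => Nat.zero_le _)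
    (Finset.mem_univ b)).trans (Finset.single_le_sum (f := fun a => ∑ b, e a b)
    (fun _ _ => Nat.zero_le _) (Finset.mem_univ a))⟩

theorem balanced_single (s : Fin k → X) :
    Balanced e (fun x => (num s {x} : ℝ)) fun t => if t = s then 1 else 0 where
  nonneg t := by positivity
  sum_eq := by simp
  mean x := by simp
  dev i x j := by
    simp only [ite_mul, one_mul, zero_mul, Finset.sum_ite_eq', Finset.mem_univ, if_true]
    rw [num_eq_sum]
    push_cast
    rfl

theorem exists_balanced (he : IsUltra e) (s : Fin k → X) {m : X → ℝ} (hm : ∀ x, 0 ≤ m x)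
    (hmk : ∑ x, m x = k) : ∃ μ : (Fin k → X) → ℝ, Balanced e m μ := by
  obtain ⟨L, hL⟩ := exists_bound e
  obtain ⟨-, μ, h, -⟩ := exists_isStep he hL hm _ _ _ (balanced_single s) (by
    rw [hmk, ← Int.cast_sum, ← num_eq_sum]
    simp [num]) le_rfl
  exact ⟨μ, h⟩

variable (he : IsUltra e) (hδ0 : 0 < δ) (hδ : δ * (4 * k) ≤ 1) (hk : 1 ≤ k)
  (hkX : k ≤ Fintype.card X)
  (hrho : ∀ v, rho e (T.pos v) (T.pos (T.par v)) ≤ T.w v)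
include he hδ0 hδ hk hkX hrho

theorem RoundState.exists_step (S : RoundState e T δ k) (r : X) :
    ∃ (S' : RoundState e T δ k) (K : (Fin k → X) → (Fin k → X) → ℝ) (C : ℝ),
      IsStep e K S.μ S'.μ C ∧ (∀ M, 0 < S'.μ M → ∃ i, M i = r) ∧
      ∀ B : Finset X, B.card = k → r ∈ B →
        C ≤ 16 * (T.potential δ B S.z - T.potential δ B S'.z) := by
  have hk' : (1 : ℝ) ≤ k := by exact_mod_cast hk
  have hδ4 : δ ≤ 1 / 4 := by nlinarith
  have hz0 : ∀ p, 0 < S.z p := fun p => hδ0.trans_le (S.feasible.le hk p)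
  obtain ⟨z', hf, hz1, hr, hpot⟩ := T.exists_step hδ0 (by linarith) hk hkX S.z hz0 S.le_one r
  obtain ⟨L, hL⟩ := exists_bound e
  have hm0 := fun x => T.measure_nonneg hδ0 hδ hk hkX hz1 hf x
  obtain ⟨K, μ', hb, hs⟩ := exists_isStep he hL hm0 _ _ _ S.balanced (by
    rw [sum_measure_univ, sum_measure_univ]) le_rfl
  refine ⟨⟨z', μ', hf, hz1, hb⟩, K, _, hs, fun M hM => ?_, fun B hB hrB => ?_⟩
  · have h1 := hb.floor_le hM 0 r
    rw [he.ball_zero, Finset.sum_singleton] at h1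
    have h2 : (1 : ℤ) ≤ ⌊T.measure δ k z' r⌋ :=
      Int.le_floor.2 (by
        rw [Int.cast_one]
        exact T.one_le_measure hδ0 hδ hk hkX hz1 hf hr)
    have h3 : 0 < num M {r} := by omega
    rw [num, Nat.cast_pos, Finset.card_pos] at h3
    obtain ⟨i, hi⟩ := h3
    exact ⟨i, by simpa using hi⟩
  -- The factor 16 is 2 from `exists_isStep`, 2 from `treeCost_le` and 4 from `abs_count_sub_le`.
  · have h1 := treeCost_le he (v := fun x => T.measure δ k z' x - T.measure δ k S.z x) L
      (fun v : {v : T.V // v ≠ T.root} => T.count δ k z' v - T.count δ k S.z v)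
      (fun v => T.pos v) (fun v => T.pos (T.par v)) (fun c _ => by
        rw [Finset.sum_sub_distrib, T.sum_measure, T.sum_measure, add_sub_add_left_eq_sub,
          ← Finset.sum_sub_distrib]
        exact Finset.sum_congr rfl fun v _ => by ring)
    have h2 : ∑ v : {v : T.V // v ≠ T.root}, |T.count δ k z' v - T.count δ k S.z v| *
        rho e (T.pos v) (T.pos (T.par v)) ≤ 4 * ∑ p, T.w p.1 * |z' p - S.z p| := by
      rw [Fintype.sum_sigma, Finset.mul_sum]
      refine Finset.sum_le_sum fun v _ => ?_
      refine (mul_le_mul (T.abs_count_sub_le hδ4 S.z z' v) (hrho v) (IsUltra.rho_nonneg e _ _)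
        (by positivity)).trans_eq ?_
      rw [mul_assoc, Finset.sum_mul]
      exact congrArg _ (Finset.sum_congr rfl fun j _ => mul_comm _ _)
    linarith [hpot B hB hrB]

/-- The next round state. -/
def RoundState.next (S : RoundState e T δ k) (r : X) : RoundState e T δ k :=
  (S.exists_step he hδ0 hδ hk hkX hrho r).choose

/-- The transition probabilities of the balanced random state. -/
def RoundState.kernel (S : RoundState e T δ k) (r : X) : (Fin k → X) → (Fin k → X) → ℝ :=
  (S.exists_step he hδ0 hδ hk hkX hrho r).choose_spec.choose

theorem RoundState.next_spec (S : RoundState e T δ k) (r : X) :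
    ∃ C, IsStep e (S.kernel he hδ0 hδ hk hkX hrho r) S.μ (S.next he hδ0 hδ hk hkX hrho r).μ C ∧
      (∀ M, 0 < (S.next he hδ0 hδ hk hkX hrho r).μ M → ∃ i, M i = r) ∧
      ∀ B : Finset X, B.card = k → r ∈ B → C ≤ 16 * (T.potential δ B S.z -
        T.potential δ B (S.next he hδ0 hδ hk hkX hrho r).z) :=
  (S.exists_step he hδ0 hδ hk hkX hrho r).choose_spec.choose_spec

/-- The chain that moves a balanced random state and labelled servers that follow it lazily. -/
def lazyChain : HiddenChain X k (RoundState e T δ k)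
    ({A : Fin k → X // Function.Injective A} × (Fin k → X)) where
  out x := configOf x.1
  succ S r := S.next he hδ0 hδ hk hkX hrho r
  prob S r x y := if lazyMove hk x.1 y.2 r = y.1 then S.kernel he hδ0 hδ hk hkX hrho r x.2 y.2 else 0
  nonneg S r x y := by
    obtain ⟨C, h, -⟩ := S.next_spec he hδ0 hδ hk hkX hrho r
    split_ifs
    · exact h.nonneg _ _
    · exact le_rfl
  sum_eq S r x := by
    obtain ⟨C, h, -⟩ := S.next_spec he hδ0 hδ hk hkX hrho r
    rw [Fintype.sum_prod_type_right]
    simp [h.sum_eq]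
  serves S r x y h := by
    split_ifs at h with h1
    · rw [← h1]
      exact mem_lazyMove hk x.1 y.2 r
    · exact absurd h (lt_irrefl _)

-- For every matching, the change of the count at a node is at most the sum of the changes over the
-- matched pairs. The infimum over the matchings follows.
omit he hδ0 hδ hk hkX hrho in
theorem sum_abs_card_le {c : ℝ} {B B' : Config X k} (hc : 0 ≤ c)
    (hsum : ∀ a b, ∑ v : {v : T.V // v ≠ T.root}, T.w v *
      |((if a ∈ T.cl v then 1 else 0) - if b ∈ T.cl v then 1 else 0 : ℝ)| ≤ c * rho e a b) :
    ∑ v : {v : T.V // v ≠ T.root}, T.w v *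
      |((B'.1 ∩ T.cl v).card : ℝ) - (B.1 ∩ T.cl v).card| ≤ c * moveCost (rho e) B B' := by
  have : Nonempty (B.1 ≃ B'.1) := ⟨Fintype.equivOfCardEq (by simp [B.2, B'.2])⟩
  rw [moveCost, Real.mul_iInf_of_nonneg hc]
  refine le_ciInf fun f => ?_
  rw [Finset.mul_sum]
  refine le_trans ?_ (Finset.sum_le_sum fun a _ => hsum a (f a))
  rw [Finset.sum_comm]
  refine Finset.sum_le_sum fun v _ => ?_
  rw [← Finset.mul_sum]
  refine mul_le_mul_of_nonneg_left ?_ (T.w_pos _).le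
  rw [abs_sub_comm]
  have h1 : ∀ B : Config X k, ((B.1 ∩ T.cl v).card : ℝ) =
      ∑ a : B.1, if a.1 ∈ T.cl v then 1 else 0 := by
    intro B
    rw [Finset.sum_coe_sort B.1 fun a => if a ∈ T.cl v then (1 : ℝ) else 0, Finset.sum_boole,
      Finset.filter_mem_eq_inter]
  rw [h1, h1, ← Equiv.sum_comp f, ← Finset.sum_sub_distrib]
  exact Finset.abs_sum_le_sum_abs _ _

/-- Amortization for one request: the offline move raises the potential (`potential_sub_le`), then
the chain pays with its drop, taken relative to the new offline set, which contains the request. The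
distance from the labelled servers to the placement covers lazy moves. The factor 64 is 16 * 4. -/
theorem value_lazyChain_le {c : ℝ} (hc : 0 ≤ c)
    (hsum : ∀ a b, ∑ v : {v : T.V // v ≠ T.root}, T.w v *
      |((if a ∈ T.cl v then 1 else 0) - if b ∈ T.cl v then 1 else 0 : ℝ)| ≤ c * rho e a b)
    (σ : List X) : ∀ (S : RoundState e T δ k)
    (ν : {A : Fin k → X // Function.Injective A} × (Fin k → X) → ℝ), (∀ x, 0 ≤ ν x) →
    (∀ M, ∑ A, ν (A, M) = S.μ M) → ∀ (B : Config X k) (Bs : List (Config X k)), Serves σ Bs →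
    ∑ x, ν x * (lazyChain he hδ0 hδ hk hkX hrho).value (rho e) S x σ ≤
      ∑ x, ν x * dist' e x.1.1 x.2 + 16 * T.potential δ B.1 S.z +
        64 * T.height * -Real.log δ * c * pathCost (rho e) B Bs := by
  have hk' : (1 : ℝ) ≤ k := by exact_mod_cast hk
  have hδ1 : δ ≤ 1 := by nlinarith
  induction σ with
  | nil =>
    intro S ν hν hνμ B Bs hBs
    cases hBs
    have h1 := T.potential_nonneg hδ0 hδ1 B.1 (z := S.z) (fun p => S.feasible.le hk p) S.le_one
    have h2 : 0 ≤ ∑ x, ν x * dist' e x.1.1 x.2 :=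
      Finset.sum_nonneg fun x _ => mul_nonneg (hν x) (dist'_nonneg e _ _)
    simp only [HiddenChain.value, pathCost, mul_zero, Finset.sum_const_zero]
    linarith
  | cons r σ ih =>
    intro S ν hν hνμ B Bs hBs
    obtain ⟨B', Bs', hrB', hBs', rfl⟩ := List.forall₂_cons_left_iff.1 hBs
    set ch := lazyChain he hδ0 hδ hk hkX hrho with hch
    obtain ⟨C, hstep, hserve, hC⟩ := S.next_spec he hδ0 hδ hk hkX hrho r
    set S' := S.next he hδ0 hδ hk hkX hrho r with hS'
    set K := S.kernel he hδ0 hδ hk hkX hrho r with hK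
    set ν' : {A : Fin k → X // Function.Injective A} × (Fin k → X) → ℝ :=
      fun y => ∑ x, ν x * ch.prob S r x y with hν'
    have hprob : ∀ x y, ch.prob S r x y = if lazyMove hk x.1 y.2 r = y.1 then K x.2 y.2 else 0 :=
      fun x y => rfl
    have hν'0 : ∀ y, 0 ≤ ν' y := fun y =>
      Finset.sum_nonneg fun x _ => mul_nonneg (hν x) (ch.nonneg _ _ _ _)
    have hν'μ : ∀ M, ∑ A, ν' (A, M) = S'.μ M := by
      intro M
      simp only [hν', hprob]
      rw [Finset.sum_comm]
      simp only [mul_ite, mul_zero, Finset.sum_ite_eq, Finset.mem_univ, if_true]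
      rw [Fintype.sum_prod_type_right]
      simp only [← Finset.sum_mul, hνμ]
      exact hstep.push M
    have hih := ih S' ν' hν'0 hν'μ B' Bs' hBs'
    have hsucc : ch.succ S r = S' := rfl
    rw [ch.sum_value_cons, hsucc, pathCost]
    have hmove : ∑ x, ∑ y, ν x * ch.prob S r x y * moveCost (rho e) (ch.out x) (ch.out y) +
        ∑ y, ν' y * dist' e y.1.1 y.2 ≤ ∑ x, ν x * dist' e x.1.1 x.2 + C := by
      have h1 : ∑ y, ν' y * dist' e y.1.1 y.2 =
          ∑ x, ∑ y, ν x * ch.prob S r x y * dist' e y.1.1 y.2 := by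
        simp only [hν', Finset.sum_mul]
        exact Finset.sum_comm
      rw [h1, ← Finset.sum_add_distrib]
      simp_rw [← Finset.sum_add_distrib, ← mul_add]
      have h2 : ∀ x y, ν x * ch.prob S r x y *
          (moveCost (rho e) (ch.out x) (ch.out y) + dist' e y.1.1 y.2) ≤
          ν x * ch.prob S r x y * (dist' e x.1.1 x.2 + dist' e x.2 y.2) := by
        intro x y
        rcases (hν x).eq_or_lt with hx | hx
        · simp [← hx]
        rcases (ch.nonneg S r x y).eq_or_lt with hp | hp
        · simp [← hp]
        refine mul_le_mul_of_nonneg_left ?_ (mul_nonneg hx.le hp.le)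
        rw [hprob] at hp
        split_ifs at hp with hy
        · change moveCost (rho e) (configOf x.1) (configOf y.1) + _ ≤ _
          rw [← hy]
          refine lazyMove_cost he hk x.1 (hserve y.2 ?_)
          rw [← hstep.push]
          have hμ : 0 < S.μ x.2 := by
            rw [← hνμ]
            exact hx.trans_le (Finset.single_le_sum (f := fun A => ν (A, x.2))
              (fun A _ => hν _) (Finset.mem_univ x.1))
          exact (mul_pos hμ hp).trans_le (Finset.single_le_sum (f := fun M => S.μ M * K M y.2)
            (fun M _ => mul_nonneg (S.balanced.nonneg M) (hstep.nonneg _ _)) (Finset.mem_univ _))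
        · exact absurd hp (lt_irrefl _)
      refine (Finset.sum_le_sum fun x _ => Finset.sum_le_sum fun y _ => h2 x y).trans ?_
      simp_rw [mul_add, Finset.sum_add_distrib]
      refine add_le_add (le_of_eq ?_) (le_of_eq_of_le ?_ hstep.cost)
      · refine Finset.sum_congr rfl fun x _ => ?_
        rw [← Finset.sum_mul, ← Finset.mul_sum, ch.sum_eq, mul_one]
      · have h3 : ∀ x, ∑ y, ν x * ch.prob S r x y * dist' e x.2 y.2 =
            ∑ M', ν x * (K x.2 M' * dist' e x.2 M') := by
          intro x
          rw [Fintype.sum_prod_type_right]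
          refine Finset.sum_congr rfl fun M' _ => ?_
          simp only [hprob, mul_ite, mul_zero, ite_mul, zero_mul, Finset.sum_ite_eq,
            Finset.mem_univ, if_true]
          ring
        simp_rw [h3]
        rw [Fintype.sum_prod_type_right]
        refine Finset.sum_congr rfl fun M _ => ?_
        rw [Finset.sum_comm]
        refine Finset.sum_congr rfl fun M' _ => ?_
        simp only [← Finset.sum_mul, hνμ]
        ring
    have hpot := T.potential_sub_le hδ0 hδ1 B.1 B'.1 (z := S.z) (fun p => S.feasible.le hk p) S.le_one
    have hcard := sum_abs_card_le (B := B) (B' := B') hc hsum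
    have hlog : 0 ≤ -Real.log δ := neg_nonneg.2 (Real.log_nonpos hδ0.le hδ1)
    have h4 : T.potential δ B'.1 S.z - T.potential δ B.1 S.z ≤
        4 * T.height * (-Real.log δ * (c * moveCost (rho e) B B')) :=
      hpot.trans (mul_le_mul_of_nonneg_left (mul_le_mul_of_nonneg_left hcard hlog) (by positivity))
    have h5 := hC B'.1 B'.2 hrB'
    linarith

theorem exists_isCompetitive_rho {c : ℝ} (hc : 0 ≤ c)
    (hsum : ∀ a b, ∑ v : {v : T.V // v ≠ T.root}, T.w v *
      |((if a ∈ T.cl v then 1 else 0) - if b ∈ T.cl v then 1 else 0 : ℝ)| ≤ c * rho e a b) :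
    ∃ c₀ : ℝ, ∀ A₀ : Config X k, ∃ alg : RandomizedAlgorithm X k, alg.init = A₀ ∧
      alg.IsCompetitive (rho e) (64 * T.height * -Real.log δ * c) c₀ := by
  have hk' : (1 : ℝ) ≤ k := by exact_mod_cast hk
  have hδ1 : δ ≤ 1 := by nlinarith
  obtain ⟨L, hL⟩ := exists_bound e
  obtain ⟨c₁, hc₁⟩ := T.exists_potential_le hδ0 hδ1
  -- The two terms bound the initial distance between servers and placement and the initial
  -- potential, uniformly in `A₀`.
  refine ⟨k * 2 ^ L + 16 * c₁, fun A₀ => ?_⟩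
  obtain ⟨A, hA⟩ := exists_configOf_eq A₀
  have hf : T.Feasible δ k (T.state δ A₀.1) := T.feasible_state hδ0.le hδ1 A₀.2
  have hz1 : ∀ p, T.state δ A₀.1 p ≤ 1 := fun p => T.state_le_one hδ1 _ p
  obtain ⟨μ, hμ⟩ := exists_balanced he A.1
    (fun x => T.measure_nonneg hδ0 hδ hk hkX hz1 hf x) (sum_measure_univ T _)
  set S : RoundState e T δ k := ⟨T.state δ A₀.1, μ, hf, hz1, hμ⟩ with hS
  set ν : {A : Fin k → X // Function.Injective A} × (Fin k → X) → ℝ :=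
    fun x => if x.1 = A then μ x.2 else 0 with hν
  have hν0 : ∀ x, 0 ≤ ν x := by
    intro x
    simp only [hν]
    split_ifs
    · exact hμ.nonneg _
    · exact le_rfl
  have hνμ : ∀ M, ∑ A, ν (A, M) = S.μ M := by
    intro M
    simp [hν, hS]
  have hν1 : ∑ x, ν x = 1 := by
    rw [Fintype.sum_prod_type_right]
    simp only [hνμ]
    exact hμ.sum_eq
  obtain ⟨alg, hinit, hcost⟩ := (lazyChain he hδ0 hδ hk hkX hrho).exists_algorithm hk hkX S hν0 hν1
    A₀ (fun x hx => by
      have : x.1 = A := by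
        by_contra h
        exact hx (if_neg h)
      change configOf x.1 = A₀
      rw [this, hA])
  refine ⟨alg, hinit, fun σ B Bs hBs => ?_⟩
  rw [hcost]
  have h1 := value_lazyChain_le he hδ0 hδ hk hkX hrho hc hsum σ S ν hν0 hνμ B Bs hBs
  have h2 := hc₁ B.1 S.z (fun p => S.feasible.le hk p) S.le_one
  have h3 : ∑ x, ν x * dist' e x.1.1 x.2 ≤ k * 2 ^ L := by
    calc ∑ x, ν x * dist' e x.1.1 x.2 ≤ ∑ x, ν x * (k * 2 ^ L) := by
          refine Finset.sum_le_sum fun x _ => mul_le_mul_of_nonneg_left ?_ (hν0 x)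
          rw [dist']
          refine (Finset.sum_le_card_nsmul _ _ (2 ^ L) fun i _ => ?_).trans_eq (by simp)
          have := IsUltra.rho_le (hL (x.1.1 i) (x.2 i))
          linarith
      _ = k * 2 ^ L := by rw [← Finset.sum_mul, hν1, one_mul]
  linarith

end Online

end KServer
end

noncomputable section
namespace KServer

open scoped Classical

/-! ### Comparison of distances -/

section Comparison

variable {X : Type*} [Fintype X] {k : ℕ} {d d' : X → X → ℝ} {β : ℝ}

theorem moveCost_le_mul (hβ : 0 ≤ β) (h : ∀ a b, d a b ≤ β * d' a b) (A B : Config X k) :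
    moveCost d A B ≤ β * moveCost d' A B := by
  rw [moveCost, moveCost, Real.mul_iInf_of_nonneg hβ]
  refine ciInf_mono (Set.finite_range _).bddBelow fun f => ?_
  rw [Finset.mul_sum]
  exact Finset.sum_le_sum fun a _ => h _ _

theorem pathCost_le_mul (hβ : 0 ≤ β) (h : ∀ a b, d a b ≤ β * d' a b) (A : Config X k)
    (Bs : List (Config X k)) : pathCost d A Bs ≤ β * pathCost d' A Bs := by
  induction Bs generalizing A with
  | nil => simp [pathCost]
  | cons B Bs ih =>
    rw [pathCost, pathCost, mul_add]
    exact add_le_add (moveCost_le_mul hβ h A B) (ih B)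

theorem pathCost_nonneg (h : ∀ a b, 0 ≤ d a b) (A : Config X k) (Bs : List (Config X k)) :
    0 ≤ pathCost d A Bs := by
  induction Bs generalizing A with
  | nil => exact le_rfl
  | cons B Bs ih =>
    exact add_nonneg (Real.iInf_nonneg fun f => Finset.sum_nonneg fun a _ => h _ _) (ih B)

theorem expectedCostFrom_le_mul (hβ : 0 ≤ β) (h : ∀ a b, d a b ≤ β * d' a b)
    (alg : RandomizedAlgorithm X k) (σ : List X) (l : List (X × Config X k)) :
    alg.expectedCostFrom d l σ ≤ β * alg.expectedCostFrom d' l σ := by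
  induction σ generalizing l with
  | nil => simp [RandomizedAlgorithm.expectedCostFrom]
  | cons r σ ih =>
    rw [RandomizedAlgorithm.expectedCostFrom, RandomizedAlgorithm.expectedCostFrom, Finset.mul_sum]
    refine Finset.sum_le_sum fun B _ => ?_
    rw [mul_left_comm β, mul_add β]
    exact mul_le_mul_of_nonneg_left (add_le_add (moveCost_le_mul hβ h _ _) (ih _))
      ENNReal.toReal_nonneg

theorem RandomizedAlgorithm.IsCompetitive.of_comparable {alg : RandomizedAlgorithm X k}
    {R R' c γ : ℝ} (halg : alg.IsCompetitive d' R c) (hβ : 0 ≤ β) (hγ : 0 ≤ γ) (hR : 0 ≤ R)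
    (h : ∀ a b, d a b ≤ β * d' a b) (h' : ∀ a b, d' a b ≤ γ * d a b) (hd : ∀ a b, 0 ≤ d a b)
    (hR' : β * R * γ ≤ R') : alg.IsCompetitive d R' (β * c) := by
  intro σ B₀ Bs hBs
  calc alg.expectedCost d σ ≤ β * alg.expectedCost d' σ := expectedCostFrom_le_mul hβ h alg σ []
    _ ≤ β * (R * pathCost d' B₀ Bs + c) := mul_le_mul_of_nonneg_left (halg σ B₀ Bs hBs) hβ
    _ ≤ β * (R * (γ * pathCost d B₀ Bs) + c) := by
        have := pathCost_le_mul hγ h' B₀ Bs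
        gcongr
    _ = β * R * γ * pathCost d B₀ Bs + β * c := by ring
    _ ≤ R' * pathCost d B₀ Bs + β * c := by
        have := pathCost_nonneg hd B₀ Bs
        gcongr

end Comparison

/-- A competitive algorithm for an ultrametric. -/
theorem exists_isCompetitive_ultra {X : Type*} [Fintype X] {e : X → X → ℕ} (he : IsUltra e) {k : ℕ}
    (hk : 1 ≤ k) (hkX : k ≤ Fintype.card X) (hX : 2 ≤ Fintype.card X) :
    ∃ R c₀ : ℝ, 0 ≤ R ∧ R ≤ 6144 * (Real.log (Fintype.card X) * Real.log (k + 1)) ∧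
      ∀ A₀ : Config X k, ∃ alg : RandomizedAlgorithm X k, alg.init = A₀ ∧
        alg.IsCompetitive (rho e) R c₀ := by
  have hk' : (1 : ℝ) ≤ k := by exact_mod_cast hk
  have hX' : (2 : ℝ) ≤ Fintype.card X := by exact_mod_cast hX
  -- δ = 1/(4k) is the largest value allowed by the truncation. Then log (1/δ) is at most 3 log (k +
  -- 1) because 4k ≤ (k + 1)³, the height is at most 2 log n because log 2 > 1/2, and 6144 = 64 * 2
  -- * 3 * 16.
  obtain ⟨c₀, h⟩ := exists_isCompetitive_rho he (T := he.tree hX) (δ := 1 / (4 * k)) (by positivity)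
    (by rw [one_div_mul_cancel (by positivity)]) hk hkX (he.tree_rho_le hX) (by norm_num)
    (he.sum_tree_abs_le hX)
  have hlog : -Real.log (1 / (4 * k)) = Real.log (4 * k) := by
    rw [one_div, Real.log_inv, neg_neg]
  have hlog0 : 0 ≤ Real.log (4 * k) := Real.log_nonneg (by linarith)
  have hlogk : Real.log (4 * k) ≤ 3 * Real.log (k + 1) := by
    rw [← Real.log_rpow (by positivity)]
    refine Real.log_le_log (by positivity) ?_
    norm_cast
    nlinarith [Nat.zero_le (k * k * k), Nat.zero_le ((k - 1) * (k - 1))]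
  have hheight : ((he.tree hX).height : ℝ) ≤ 2 * Real.log (Fintype.card X) := by
    have h1 : ((Nat.log 2 (Fintype.card X) : ℕ) : ℝ) * Real.log 2 ≤ Real.log (Fintype.card X) := by
      rw [← Real.log_pow]
      refine Real.log_le_log (by positivity) ?_
      exact_mod_cast Nat.pow_log_le_self 2 (by omega)
    have h2 : (1 : ℝ) / 2 < Real.log 2 := by linarith [Real.log_two_gt_d9]
    have h3 : (0 : ℝ) ≤ (Nat.log 2 (Fintype.card X) : ℕ) := Nat.cast_nonneg _
    change ((Nat.log 2 (Fintype.card X) : ℕ) : ℝ) ≤ _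
    nlinarith
  rw [hlog] at h
  refine ⟨_, c₀, by positivity, ?_, h⟩
  calc 64 * ((he.tree hX).height : ℝ) * Real.log (4 * k) * 16
      ≤ 64 * (2 * Real.log (Fintype.card X)) * (3 * Real.log (k + 1)) * 16 := by
        have : 0 ≤ Real.log (Fintype.card X) := Real.log_nonneg (by linarith)
        gcongr
    _ = _ := by ring

end KServer

/-! ### From hierarchically separated trees to ultrametrics -/

namespace HST

open scoped Classical

variable {T : RootedTree} [Fintype T] {w : T → ℝ} {τ : ℝ}

/-- Going up from v the lengths grow geometrically and stay below W. The term - w v carries the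
induction: a new edge adds (τ - 1) * w v, and τ * w v is at most the length of the edge above. -/
theorem IsHST.sum_chain_le (h : IsHST T w τ) (hτ : 1 < τ) {b : T} {W : ℝ} (v : T) (hv : ¬ v ≤ b)
    (hW : ∀ u, u ≤ v → ¬ u ≤ b → w u ≤ W) :
    (τ - 1) * ∑ u : T, (if u ≤ v ∧ ¬ u ≤ b then w u else 0) ≤ τ * W - w v := by
  induction v using WellFoundedLT.induction with
  | ind v ih =>
    have hv0 : v ≠ ⊥ := fun h0 => hv (h0 ▸ bot_le)
    have hpred : Order.pred v < v := Order.pred_lt_of_not_isMin fun hm => hv0 hm.eq_bot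
    have hsplit : ∑ u : T, (if u ≤ v ∧ ¬ u ≤ b then w u else 0) =
        w v + ∑ u : T, if u ≤ Order.pred v ∧ ¬ u ≤ b then w u else 0 := by
      have h1 : ∀ u : T, (if u ≤ v ∧ ¬ u ≤ b then w u else 0) = (if u = v then w u else 0) +
          if u ≤ Order.pred v ∧ ¬ u ≤ b then w u else 0 := by
        intro u
        by_cases huv : u = v
        · subst huv
          rw [if_pos ⟨le_rfl, hv⟩, if_pos rfl, if_neg fun h => hpred.not_ge h.1, add_zero]
        · rw [if_neg huv, zero_add]
          refine if_congr (and_congr_left fun _ => ?_) rfl rfl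
          exact ⟨fun h => Order.le_pred_of_lt (lt_of_le_of_ne h huv), fun h => h.trans hpred.le⟩
      simp_rw [h1, Finset.sum_add_distrib]
      simp
    have hwv := hW v le_rfl hv
    rw [hsplit]
    by_cases hp : Order.pred v ≤ b
    · have h0 : ∑ u : T, (if u ≤ Order.pred v ∧ ¬ u ≤ b then w u else 0) = 0 :=
        Finset.sum_eq_zero fun u _ => if_neg fun hu => hu.2 (hu.1.trans hp)
      rw [h0, add_zero]
      nlinarith
    · have h1 := ih _ hpred hp fun u hu => hW u (hu.trans hpred.le)
      have h2 := h.decreasing v hv0 fun h0 => hp (h0 ▸ bot_le)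
      linarith

theorem leafDist_nonneg (h : IsHST T w τ) (a b : Leaf T) : 0 ≤ leafDist T w a b := by
  refine Finset.sum_nonneg fun u _ => ?_
  split_ifs with hu
  · refine (h.pos u fun h0 => ?_).le
    subst h0
    simp at hu
  · exact le_rfl

/-- The leaf metric of an HST is equivalent to the metric of an ultrametric. -/
theorem IsHST.exists_ultra (h : IsHST T w τ) (hτ : 1 < τ) :
    ∃ (e : Leaf T → Leaf T → ℕ) (s : ℝ), 0 < s ∧ KServer.IsUltra e ∧
      (∀ a b, leafDist T w a b ≤ 4 * τ / (τ - 1) * s * KServer.rho e a b) ∧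
      ∀ a b, KServer.rho e a b ≤ 2 / s * leafDist T w a b := by
  have hτ' : 0 < τ - 1 := by linarith
  obtain ⟨s, hs, hsw⟩ : ∃ s > 0, ∀ u : T, u ≠ ⊥ → s ≤ w u := by
    by_cases hne : (Finset.univ.filter fun u : T => u ≠ ⊥).Nonempty
    · obtain ⟨u, hu, hmin⟩ := Finset.exists_min_image _ w hne
      exact ⟨w u, h.pos u (Finset.mem_filter.1 hu).2, fun v hv => hmin v (by simpa using hv)⟩
    · refine ⟨1, one_pos, fun u hu => absurd ⟨u, ?_⟩ hne⟩
      simpa using hu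
  -- The exponent is one plus the integer part of log₂ (w u / s). The shift makes it positive, so
  -- that `e` vanishes only on the diagonal.
  have hg : ∀ u : T, ∃ g : ℕ, u ≠ ⊥ → 1 ≤ g ∧ w u ≤ s * 2 ^ g ∧ 2 ^ g ≤ 2 / s * w u := by
    intro u
    by_cases hu : u = ⊥
    · exact ⟨0, fun h => absurd hu h⟩
    · obtain ⟨n, hn, hn'⟩ := exists_nat_pow_near (x := w u / s) (y := 2)
        ((one_le_div hs).2 (hsw u hu)) (by norm_num)
      refine ⟨n + 1, fun _ => ⟨by omega, ?_, ?_⟩⟩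
      · rw [div_lt_iff₀ hs] at hn'
        linarith
      · rw [pow_succ]
        calc (2 : ℝ) ^ n * 2 ≤ w u / s * 2 := by linarith
          _ = 2 / s * w u := by ring
  choose g hg using hg
  set xs : Leaf T → Leaf T → Finset T :=
    fun a b => Finset.univ.filter fun u => Xor (u ≤ a.1) (u ≤ b.1) with hxs
  have hmem : ∀ {a b u}, u ∈ xs a b ↔ Xor (u ≤ a.1) (u ≤ b.1) := by simp [hxs]
  have hbot : ∀ {a b u}, u ∈ xs a b → u ≠ ⊥ := by
    rintro a b u hu rfl
    simp [hmem] at hu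
  have hne : ∀ {a b}, a ≠ b → a.1 ∈ xs a b := fun {a b} hab =>
    hmem.2 (Or.inl ⟨le_rfl, fun hle => hab (Subtype.ext (le_antisymm hle (a.2 hle)))⟩)
  -- An edge that separates a from c separates a from b or b from c, so the maximal exponent of a
  -- separating edge is an ultrametric. By `sum_chain_le` the longest separating edge determines the
  -- distance up to a constant.
  set e : Leaf T → Leaf T → ℕ := fun a b => (xs a b).sup g with he
  have hle : ∀ {a b u}, u ∈ xs a b → g u ≤ e a b := fun hu => Finset.le_sup (f := g) hu
  have hu : KServer.IsUltra e := by
    refine ⟨fun a => ?_, fun a b h0 => ?_, fun a b => ?_, fun a b c => ?_⟩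
    · have : xs a a = ∅ := by
        ext u
        simp [hmem]
      simp [he, this]
    · by_contra hab
      have := hle (hne hab)
      have := (hg _ (hbot (hne hab))).1
      omega
    · have : xs a b = xs b a := by
        ext u
        rw [hmem, hmem, xor_comm]
      simp only [he, this]
    · simp only [he]
      rw [← Finset.sup_union]
      refine Finset.sup_mono fun u hu => ?_
      rw [Finset.mem_union, hmem, hmem]
      rw [hmem] at hu
      simp only [Xor] at hu ⊢
      tauto
  refine ⟨e, s, hs, hu, fun a b => ?_, fun a b => ?_⟩
  · by_cases hab : a = b
    · subst hab
      rw [hu.rho_self, mul_zero]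
      simp [leafDist]
    have h2 : (2 : ℝ) ≤ 2 ^ e a b := le_self_pow₀ (by norm_num) fun h0 => hab (hu.eq_of _ _ h0)
    set W := s * 2 ^ e a b with hWdef
    have hW : ∀ u ∈ xs a b, w u ≤ W := fun u hu => by
      refine (hg u (hbot hu)).2.1.trans (mul_le_mul_of_nonneg_left ?_ hs.le)
      exact pow_le_pow_right₀ (by norm_num) (hle hu)
    have hnle : ∀ {a b : Leaf T}, a ≠ b → ¬ a.1 ≤ b.1 := fun {a b} hab hle =>
      hab (Subtype.ext (le_antisymm hle (a.2 hle)))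
    have h3 := h.sum_chain_le hτ (b := b.1) (W := W) a.1 (hnle hab)
      fun u h1 h2 => hW u (hmem.2 (Or.inl ⟨h1, h2⟩))
    have h4 := h.sum_chain_le hτ (b := a.1) (W := W) b.1 (hnle (Ne.symm hab))
      fun u h1 h2 => hW u (hmem.2 (Or.inr ⟨h1, h2⟩))
    have h5 : leafDist T w a b = ∑ u : T, (if u ≤ a.1 ∧ ¬ u ≤ b.1 then w u else 0) +
        ∑ u : T, if u ≤ b.1 ∧ ¬ u ≤ a.1 then w u else 0 := by
      rw [leafDist, ← Finset.sum_add_distrib]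
      refine Finset.sum_congr rfl fun u _ => ?_
      by_cases h6 : u ≤ a.1 <;> by_cases h7 : u ≤ b.1 <;> simp [h6, h7]
    have ha := h.pos a.1 (hbot (hne hab))
    have hb := h.pos b.1 (hbot (hne (Ne.symm hab)))
    have h6 : (τ - 1) * leafDist T w a b ≤ 2 * τ * W := by
      rw [h5, mul_add]
      linarith
    have h7 : W ≤ 2 * (s * KServer.rho e a b) := by
      rw [KServer.rho, hWdef]
      nlinarith
    rw [div_mul_eq_mul_div, div_mul_eq_mul_div, le_div_iff₀ hτ']
    nlinarith
  · by_cases hab : a = b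
    · subst hab
      rw [hu.rho_self]
      exact mul_nonneg (by positivity) (leafDist_nonneg h a a)
    obtain ⟨u, hux, hue⟩ := Finset.exists_mem_eq_sup (xs a b) ⟨_, hne hab⟩ g
    have h1 := (hg u (hbot hux)).2.2
    have h2 : w u ≤ leafDist T w a b := by
      have := Finset.single_le_sum (f := fun u : T => if Xor (u ≤ a.1) (u ≤ b.1) then w u else 0)
        (fun v _ => by
          split_ifs with hv
          · exact (h.pos v (hbot (hmem.2 hv))).le
          · exact le_rfl) (Finset.mem_univ u)
      rwa [if_pos (hmem.1 hux)] at this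
    have h3 : e a b = g u := hue
    rw [KServer.rho, h3]
    have h4 : 2 / s * w u ≤ 2 / s * leafDist T w a b := mul_le_mul_of_nonneg_left h2 (by positivity)
    linarith

end HST

end

theorem mainTheorem7 (τ : ℝ) (hτ : 1 < τ) :
    ∃ C : ℝ, ∀ (T : RootedTree) [Fintype T] (w : T → ℝ), HST.IsHST T w τ →
      ∀ k : ℕ, 1 ≤ k → k ≤ Fintype.card (HST.Leaf T) →
        ∃ c : ℝ, ∀ A₀ : KServer.Config (HST.Leaf T) k,
          ∃ alg : KServer.RandomizedAlgorithm (HST.Leaf T) k,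
            alg.init = A₀ ∧
            alg.IsCompetitive (HST.leafDist T w)
              (C * (Real.log (Fintype.card (HST.Leaf T)) * Real.log (k + 1))) c := by
  have hτ' : 0 < τ - 1 := by linarith
  refine ⟨8 * τ / (τ - 1) * 6144, fun T _ w h k hk hkX => ?_⟩
  by_cases hX : 2 ≤ Fintype.card (HST.Leaf T)
  · obtain ⟨e, s, hs, he, hd, hd'⟩ := h.exists_ultra hτ
    obtain ⟨R, c₀, hR0, hR, halg⟩ := KServer.exists_isCompetitive_ultra he hk hkX hX
    refine ⟨4 * τ / (τ - 1) * s * c₀, fun A₀ => ?_⟩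
    obtain ⟨alg, hinit, hcomp⟩ := halg A₀
    refine ⟨alg, hinit, hcomp.of_comparable (by positivity) (by positivity) hR0 hd hd'
      (HST.leafDist_nonneg h) ?_⟩
    calc 4 * τ / (τ - 1) * s * R * (2 / s) = 8 * τ / (τ - 1) * R := by
          field_simp
          ring
      _ ≤ 8 * τ / (τ - 1) * (6144 * (Real.log (Fintype.card (HST.Leaf T)) * Real.log (k + 1))) :=
          mul_le_mul_of_nonneg_left hR (by positivity)
      _ = _ := by ring
  -- For a single leaf log n = 0, so the ratio is zero and the cost itself has to vanish.
  · have hX1 : Fintype.card (HST.Leaf T) = 1 := by omega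
    have : Subsingleton (HST.Leaf T) := Fintype.card_le_one_iff_subsingleton.1 hX1.le
    refine ⟨0, fun A₀ => ⟨⟨A₀, fun _ _ => PMF.pure A₀, fun _ r B _ => ?_⟩, rfl, ?_⟩⟩
    · have hB : B.1.card = Fintype.card (HST.Leaf T) := by
        have := B.2
        omega
      rw [(Finset.card_eq_iff_eq_univ _).1 hB]
      exact Finset.mem_univ r
    · intro σ B₀ Bs _
      have hlog : Real.log (Fintype.card (HST.Leaf T)) = 0 := by
        rw [hX1, Nat.cast_one, Real.log_one]
      rw [hlog, zero_mul, mul_zero, zero_mul, zero_add]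
      refine (KServer.expectedCostFrom_le_mul (d' := HST.leafDist T w) le_rfl (fun a b => ?_) _ σ
        []).trans_eq (zero_mul _)
      rw [Subsingleton.elim a b, zero_mul]
      simp [HST.leafDist]
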